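/- Let $\beta\in\{1,4\}$, let $a\in\mathbb R$ and put $$w_\beta(x)=\begin{cases}x^{(a-1)/2}e^{-x},&\beta=1,\\ x^{a+1}e^{-x},&\beta=4,\end{cases}\quad (x>0),\qquad \hat N'=\hat N'_{\rm h}=\begin{cases}N+(a-1)/2,&\beta=1,\\ N+(a+1)/4,&\beta=4,\end{cases}\qquad \tilde a=a^2-1,$$ where the exponent of $x$ in $w_\beta$ is assumed larger than $-1$, and $w_\beta(x)=0$ for $x\le 0$. For $N\ge1$ let $\rho_N(x)$ be the one-point density, of total mass $N$ ($N$ times the marginal density of one coordinate), of the ensemble with joint probability density proportional to $\prod_{l=1}^N w_\beta(x_l)\prod_{1\le j<k\le N}|x_k-x_j|^\beta$, and let $\rho^{\rm h}_N(y)=\frac1{4\hat N'}\rho_N\big(\frac{y}{4\hat N'}\big)$ be the hard edge scaled density. For a Laguerre weight $x^\alpha e^{-x}$, put $\kappa=\beta/2$, $X=x/(\kappa-1)$, $A=\alpha/(\kappa-1)$, $c=A+4(\kappa-1)N$, $t=A(A-2)$, and let $$\begin{aligned}\mathcal D_N={}&4x^5\tfrac{d^5}{dx^5}+40x^4\tfrac{d^4}{dx^4}-\big(5X^2-10cX+5t-88\big)x^3\tfrac{d^3}{dx^3}-\big(16X^2-38cX+22t-16\big)x^2\tfrac{d^2}{dx^2}\\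 &+\big(X^4-4cX^3+(4c^2+2t-4)X^2-4c(t-3)X+t^2-14t-16\big)x\tfrac{d}{dx}\\ &-\big(cX^3-(2c^2+t)X^2+c(3t+4)X-t^2\big).\end{aligned}$$ Define further $$\begin{aligned}\mathcal D_0={}&\tilde a^2-(4+3\tilde a)y+2y^2+\big(4y^2-4(-3+\tilde a)y-16-14\tilde a+\tilde a^2\big)y\tfrac{d}{dy}+(38y+16-22\tilde a)y^2\tfrac{d^2}{dy^2}\\&+(10y+88-5\tilde a)y^3\tfrac{d^3}{dy^3}+40y^4\tfrac{d^4}{dy^4}+4y^5\tfrac{d^5}{dy^5},\\ \mathcal D_1={}&y^2\Big(\tilde a-y+2(-2+\tilde a-2y)y\tfrac{d}{dy}-16y^2\tfrac{d^2}{dy^2}-5y^3\tfrac{d^3}{dy^3}\Big),\qquad \mathcal D_2=y^5\tfrac{d}{dy}.\end{aligned}$$ With $\alpha$ the exponent of $w_\beta$, the following hold. 1. For every $N\ge1$, the operator $\mathcal D_N$ annihilates $\rho_N$ on $(0,\infty)$, and, with $x=y/(4\hat N')$, as operators on functions of $y>0$, $$\mathcal D_N\Big|_{x=y/(4\hat N')}=\mathcal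 D_0+(2\sqrt\beta\,\hat N')^{-2}\mathcal D_1+(2\sqrt\beta\,\hat N')^{-4}\mathcal D_2 .$$ 2. For every $N\ge1$, $\rho_N^{\rm h}$ is smooth on $(0,\infty)$ and satisfies there $$\big(\mathcal D_0+(2\sqrt\beta\,\hat N')^{-2}\mathcal D_1+(2\sqrt\beta\,\hat N')^{-4}\mathcal D_2\big)\rho_N^{\rm h}(y)=0 .$$ 3. There are smooth functions $r_0,r_1,r_2,\dots$ on $(0,\infty)$, depending on $a$ and $\beta$ but not on $N$, such that, as $N\to\infty$ with $a$ fixed, $$\rho^{\rm h}_N(y)\sim\sum_{j\ge0}(2\sqrt\beta\,\hat N')^{-2j}\,r_j(y),$$ an asymptotic expansion to all orders that holds uniformly for $y$ in compact subsets of $(0,\infty)$ and may be differentiated term by term any number of times; and, with $r_{-1}=r_{-2}=0$, $$\mathcal D_0r_j(y)=-\mathcal D_1r_{j-1}(y)-\mathcal D_2r_{j-2}(y)\qquad(y>0,\ j=0,1,2,\dots).$$ -/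

import Mathlib

open Set

noncomputable section

/-- The Laguerre weight `x ^ α * exp (-x)`, supported on `x > 0`. -/
def laguerreWeight (α x : ℝ) : ℝ :=
  if 0 < x then x ^ α * Real.exp (-x) else 0

/-- The unnormalised eigenvalue density
`∏_l w (x_l) * ∏_{j < k} |x_k - x_j| ^ β` on `ℝ ^ n`. -/
def betaJointWeight (β : ℕ) (w : ℝ → ℝ) {n : ℕ} (x : Fin n → ℝ) : ℝ :=
  (∏ l, w (x l)) * ∏ j, ∏ k ∈ Finset.Ioi j, |x k - x j| ^ β

/-- The one-point density (of total mass `N`) of the ensemble of `N` eigenvalues with joint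
probability density proportional to `betaJointWeight β w`: `N` times the marginal density
of one coordinate. -/
def betaDensity (β : ℕ) (w : ℝ → ℝ) : ℕ → ℝ → ℝ
  | 0, _ => 0
  | n + 1, x =>
      ((n : ℝ) + 1) * (∫ t : Fin n → ℝ, betaJointWeight β w (Fin.cons x t : Fin (n + 1) → ℝ)) /
        ∫ s : Fin (n + 1) → ℝ, betaJointWeight β w s

/-- For `β = 1` and `β = 4`: the fifth order linear differential operator annihilating the density
of the Laguerre β ensemble of `N` eigenvalues with weight `x ^ α * exp (-x)`. Here `κ = β / 2`,
and `X = x / (κ - 1)`, `A = α / (κ - 1)`, `c = A + 4 (κ - 1) N`, `t = A (A - 2)`. -/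
def laguerreOp (β N : ℕ) (α : ℝ) (f : ℝ → ℝ) (x : ℝ) : ℝ :=
  let κ : ℝ := (β : ℝ) / 2
  let X : ℝ := x / (κ - 1)
  let A : ℝ := α / (κ - 1)
  let c : ℝ := A + 4 * (κ - 1) * N
  let t : ℝ := A * (A - 2)
  4 * x ^ 5 * iteratedDeriv 5 f x
    + 40 * x ^ 4 * iteratedDeriv 4 f x
    - (5 * X ^ 2 - 10 * c * X + 5 * t - 88) * x ^ 3 * iteratedDeriv 3 f x
    - (16 * X ^ 2 - 38 * c * X + 22 * t - 16) * x ^ 2 * iteratedDeriv 2 f x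
    + (X ^ 4 - 4 * c * X ^ 3 + (4 * c ^ 2 + 2 * t - 4) * X ^ 2 - 4 * c * (t - 3) * X
        + t ^ 2 - 14 * t - 16) * x * deriv f x
    - (c * X ^ 3 - (2 * c ^ 2 + t) * X ^ 2 + c * (3 * t + 4) * X - t ^ 2) * f x

/-- The exponent of the weight `w_β`: `(a - 1) / 2` for `β = 1`, and `a + 1` for `β = 4`. -/
def weightExponent (β : ℕ) (a : ℝ) : ℝ :=
  if β = 1 then (a - 1) / 2 else a + 1

/-- The shifted number of eigenvalues: `N + (a - 1) / 2` for `β = 1`, and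
`N + (a + 1) / 4` for `β = 4`. -/
def shiftedN (β : ℕ) (a : ℝ) (N : ℕ) : ℝ :=
  if β = 1 then N + (a - 1) / 2 else N + (a + 1) / 4

/-- The hard edge scaled density, in the variable `y` with `x = y / (4 * shiftedN β a N)`,
for the weight `w_β`. -/
def hardEdgeDensity (β : ℕ) (a : ℝ) (N : ℕ) (y : ℝ) : ℝ :=
  1 / (4 * shiftedN β a N) *
    betaDensity β (laguerreWeight (weightExponent β a)) N (y / (4 * shiftedN β a N))

/-- The expansion parameter `(2 √β N') ^ (-2)`, with `N' = shiftedN β a N`. -/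
def hardEdgeParam (β : ℕ) (a : ℝ) (N : ℕ) : ℝ :=
  (2 * √(β : ℝ) * shiftedN β a N) ^ (-2 : ℤ)

/-- The operator `𝒟₀`. -/
def hardEdgeOp0 (a : ℝ) (f : ℝ → ℝ) (y : ℝ) : ℝ :=
  let t : ℝ := a ^ 2 - 1
  (t ^ 2 - (4 + 3 * t) * y + 2 * y ^ 2) * f y
    + (4 * y ^ 2 - 4 * (-3 + t) * y - 16 - 14 * t + t ^ 2) * y * deriv f y
    + (38 * y + 16 - 22 * t) * y ^ 2 * iteratedDeriv 2 f y
    + (10 * y + 88 - 5 * t) * y ^ 3 * iteratedDeriv 3 f y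
    + 40 * y ^ 4 * iteratedDeriv 4 f y
    + 4 * y ^ 5 * iteratedDeriv 5 f y

/-- The operator `𝒟₁`. -/
def hardEdgeOp1 (a : ℝ) (f : ℝ → ℝ) (y : ℝ) : ℝ :=
  let t : ℝ := a ^ 2 - 1
  y ^ 2 * ((t - y) * f y
    + 2 * (-2 + t - 2 * y) * y * deriv f y
    - 16 * y ^ 2 * iteratedDeriv 2 f y
    - 5 * y ^ 3 * iteratedDeriv 3 f y)

/-- The operator `𝒟₂ = y ^ 5 d/dy`. -/
def hardEdgeOp2 (f : ℝ → ℝ) (y : ℝ) : ℝ :=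
  y ^ 5 * deriv f y

end

/-! At the hard edge scale both ensembles are governed by the same functions. Put c = 2N' for β = 1,
c = 4N' for β = 4 (N' the shifted number of eigenvalues) and ε = c⁻², which is the expansion
parameter. Let E solve E'' = ((a² - 1)/(4y²) - 1/(2y) + ε/4) E with exponent (a + 1)/2 at 0, and let
T be the primitive of (1/(2y) - ε/2) E with the same exponent. At these values of ε, E is a multiple
of y^((a+1)/2) exp(-y/(2c)) L_n^(a)(y/c), with n = N - 1 for β = 1 and n = 2N for β = 4
(`edgeFun_eq`). The scaled density is A times one fixed quadratic form in E, E', T (`hardEdgeQuad`)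
plus B E/y, with B = 0 for β = 4 (`exists_hardEdgeDensity_eq`).

Differential equation. The term B E/y is absorbed by adding a constant to T. The products E², EE',
E'², ET, E'T span a module of rank five over the rational functions, closed under differentiation,
so any quadratic form of this kind satisfies a linear equation of order at most five;
`hardEdgeOp_quad_eq_zero` checks that it is the required one, and `laguerreOp_comp_mul` carries it
back to the variable x.

Expansion. E and T are y^((a+1)/2) times entire series in y whose coefficients are polynomials in ε
with summable bounds. A and B are ratios of Gamma functions with arguments placed symmetrically
about a shifted multiple of c, which leaves only even powers of 1/c (`gammaRatio_asymp`). Families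
with expansions in ε (`ExpandsTo`) are closed under sums, products and derivatives, so the density
has one as well. Its coefficients are unique, and comparing powers of ε in the differential equation
gives the nested equations (`hardEdgeOp_nested`).

Density formulas. No Pfaffians are needed: interpolation at the eigenvalues, multiplied by the joint
weight and integrated, gives a reproducing property. For β = 4, Hermite interpolation at double
nodes shows that an averaged kernel reproduces polynomials of degree below 2N for the skew form ∫ w
(q r' - q' r); an explicit kernel of skew orthogonal polynomials does the same, so the two agree up
to normalisation (`betaDensity_four`). For β = 1, Lagrange interpolation gives a kernel that is
piecewise polynomial before averaging; its derivative is a weight times an antisymmetric polynomial,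
fixed by moments and antisymmetry (`oneKernelDeriv_eq`), and its constant of integration is found
separately for each parity (`oneMean_eq`). -/

/-! ### Passage to the hard edge variable. -/

theorem iteratedDeriv_comp_mul_left (m : ℝ) (f : ℝ → ℝ) (k : ℕ) :
    iteratedDeriv k (fun x => f (m * x)) = fun x => m ^ k * iteratedDeriv k f (m * x) := by
  induction k with
  | zero => simp
  | succ k ih =>
    rw [iteratedDeriv_succ, ih]
    funext x
    rw [deriv_const_mul_field, deriv_comp_mul_left (f := iteratedDeriv k f), iteratedDeriv_succ,
      smul_eq_mul, pow_succ, mul_assoc]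

theorem shiftedN_pos {β : ℕ} (hβ : β = 1 ∨ β = 4) {a : ℝ} (ha : -1 < weightExponent β a) {N : ℕ}
    (hN : 1 ≤ N) : 0 < shiftedN β a N := by
  have : (1 : ℝ) ≤ N := by exact_mod_cast hN
  rcases hβ with rfl | rfl
  · simp only [weightExponent, shiftedN, if_true] at *; linarith
  · simp only [weightExponent, shiftedN, show ¬ (4 = 1) by norm_num, if_false] at *; linarith

/-- The total operator in the hard edge variable. -/
noncomputable def hardEdgeOp (a ε : ℝ) (f : ℝ → ℝ) (y : ℝ) : ℝ :=
  hardEdgeOp0 a f y + ε * hardEdgeOp1 a f y + ε ^ 2 * hardEdgeOp2 f y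

theorem hardEdgeParam_eq_one (a : ℝ) (N : ℕ) :
    hardEdgeParam 1 a N = ((2 * shiftedN 1 a N) ^ 2)⁻¹ := by
  simp [hardEdgeParam, zpow_neg]

theorem hardEdgeParam_eq_four (a : ℝ) (N : ℕ) :
    hardEdgeParam 4 a N = ((4 * shiftedN 4 a N) ^ 2)⁻¹ := by
  have h : √(4 : ℝ) = 2 := by
    rw [show (4 : ℝ) = 2 ^ 2 by norm_num]; exact Real.sqrt_sq (by norm_num)
  simp only [hardEdgeParam, zpow_neg, Nat.cast_ofNat, h]
  norm_num

theorem hardEdgeParam_sq (β : ℕ) (a : ℝ) (N : ℕ) :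
    hardEdgeParam β a N ^ 2 = (2 * √(β : ℝ) * shiftedN β a N) ^ (-4 : ℤ) := by
  rw [hardEdgeParam, ← zpow_natCast, ← zpow_mul]; norm_num

/-- In the notation of `laguerreOp`, c is -2N' for β = 1 and 4N' for β = 4, while t = a² - 1 in both
cases. Hence X = y/c and cX = y, and each monomial in c and X becomes a power of y times a
nonnegative power of c⁻² = ε. -/
theorem laguerreOp_comp_mul {β : ℕ} (hβ : β = 1 ∨ β = 4) {a : ℝ} (ha : -1 < weightExponent β a)
    {N : ℕ} (hN : 1 ≤ N) (f : ℝ → ℝ) (y : ℝ) :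
    laguerreOp β N (weightExponent β a) (fun x => f (4 * shiftedN β a N * x))
      (y / (4 * shiftedN β a N)) = hardEdgeOp a (hardEdgeParam β a N) f y := by
  have hpos := shiftedN_pos hβ ha hN
  have hd : deriv (fun x => f (4 * shiftedN β a N * x)) =
      fun x => 4 * shiftedN β a N * deriv f (4 * shiftedN β a N * x) := by
    funext x
    rw [deriv_comp_mul_left (f := f), smul_eq_mul]
  have hy : 4 * shiftedN β a N * (y / (4 * shiftedN β a N)) = y := by
    field_simp
  simp only [laguerreOp, hardEdgeOp, hardEdgeOp0, hardEdgeOp1, hardEdgeOp2,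
    iteratedDeriv_comp_mul_left, hd, hy]
  generalize iteratedDeriv 5 f y = f5
  generalize iteratedDeriv 4 f y = f4
  generalize iteratedDeriv 3 f y = f3
  generalize iteratedDeriv 2 f y = f2
  generalize deriv f y = f1
  generalize f y = f0
  clear hd hy
  rcases hβ with rfl | rfl
  · rw [hardEdgeParam_eq_one]
    have hNa : (N : ℝ) = shiftedN 1 a N - (a - 1) / 2 := by simp [shiftedN]
    rw [hNa]
    generalize shiftedN 1 a N = s at *
    have hs := hpos.ne'
    simp only [weightExponent, if_true, Nat.cast_one]
    norm_num
    field_simp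
    ring
  · rw [hardEdgeParam_eq_four]
    have hNa : (N : ℝ) = shiftedN 4 a N - (a + 1) / 4 := by simp [shiftedN]
    rw [hNa]
    generalize shiftedN 4 a N = s at *
    have hs := hpos.ne'
    simp only [weightExponent, show ¬ (4 = 1) by norm_num, if_false, Nat.cast_ofNat]
    norm_num
    field_simp
    ring

theorem iteratedDeriv_eq_of_hasDerivAt_Ioi {f : ℝ → ℝ} {F : ℕ → ℝ → ℝ} {n : ℕ}
    (h0 : EqOn f (F 0) (Ioi 0)) (h : ∀ k < n, ∀ y, 0 < y → HasDerivAt (F k) (F (k + 1) y) y) :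
    ∀ k ≤ n, EqOn (iteratedDeriv k f) (F k) (Ioi 0) := by
  intro k
  induction k with
  | zero => intro _; simpa using h0
  | succ k ih =>
    intro hk y hy
    have he : iteratedDeriv k f =ᶠ[nhds y] F k :=
      Filter.eventuallyEq_of_mem (Ioi_mem_nhds hy) (ih (by omega))
    rw [iteratedDeriv_succ, he.deriv_eq]
    exact (h k (by omega) y hy).deriv

/-! ### The fifth order equation for quadratic expressions in E, E', T. -/

section ODE
variable {t ε : ℝ} {E E1 T : ℝ → ℝ}

/-- The quadratic expression in the hard edge functions that gives the density. -/
noncomputable def hardEdgeQuad (t ε : ℝ) (E E1 T : ℝ → ℝ) (y : ℝ) : ℝ :=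
  (2 * y * E1 y ^ 2 - 2 * E y * E1 y + (-t / (2 * y) + 1 - ε * y / 2) * E y ^ 2 - E y * T y) / y

/-- Derivatives of the quadratic form stay in the span of E², EE', E'², ET, E'T over the rational
functions, so the claim becomes an identity between coefficients. -/
theorem hardEdgeOp_quad_eq_zero (a : ℝ) (ht : t = a ^ 2 - 1)
    (hE : ∀ y, 0 < y → HasDerivAt E (E1 y) y)
    (hE1 : ∀ y, 0 < y → HasDerivAt E1 ((t / (4 * y ^ 2) - 1 / (2 * y) + ε / 4) * E y) y)
    (hT : ∀ y, 0 < y → HasDerivAt T ((1 / (2 * y) - ε / 2) * E y) y)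
    {f : ℝ → ℝ} (hf : EqOn f (hardEdgeQuad t ε E E1 T) (Ioi 0)) {y : ℝ} (hy : 0 < y) :
    hardEdgeOp a ε f y = 0 := by
  -- `V k` and `W k` are the successive derivatives of the coefficients in E'' = V E and T' = W E.
  let V : ℕ → ℝ → ℝ
    | 0 => fun y => t / (4 * y ^ 2) - 1 / (2 * y) + ε / 4
    | 1 => fun y => -t / (2 * y ^ 3) + 1 / (2 * y ^ 2)
    | 2 => fun y => 3 * t / (2 * y ^ 4) - 1 / y ^ 3
    | _ => fun y => -6 * t / y ^ 5 + 3 / y ^ 4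
  let W : ℕ → ℝ → ℝ
    | 0 => fun y => 1 / (2 * y) - ε / 2
    | 1 => fun y => -1 / (2 * y ^ 2)
    | 2 => fun y => 1 / y ^ 3
    | 3 => fun y => -3 / y ^ 4
    | _ => fun y => 12 / y ^ 5
  have hinv : ∀ (k : ℕ) (y : ℝ), 0 < y →
      HasDerivAt (fun y : ℝ => 1 / y ^ (k + 1)) (-((k : ℝ) + 1) / y ^ (k + 2)) y := by
    intro k y hy
    have := ((hasDerivAt_pow (k + 1) y).inv (pow_ne_zero _ hy.ne'))
    simp only [one_div]
    refine this.congr_deriv ?_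
    have := hy.ne'
    simp only [Nat.add_sub_cancel]
    push_cast
    field_simp
    ring
  have hV : ∀ k < 3, ∀ y, 0 < y → HasDerivAt (V k) (V (k + 1) y) y := by
    intro k hk y hy
    have h0 := hy.ne'
    interval_cases k
    · refine ((((hinv 1 y hy).const_mul (t / 4)).sub ((hinv 0 y hy).const_mul (1 / 2))).add_const
        (ε / 4)).congr_deriv ?_ |>.congr_of_eventuallyEq ?_
      · simp only [V]; norm_num; field_simp; ring
      · refine Filter.Eventually.of_forall fun z => ?_
        simp only [V, Pi.sub_apply]; norm_num; ring
    · refine (((hinv 2 y hy).const_mul (-t / 2)).add ((hinv 1 y hy).const_mul (1 / 2))).congr_deriv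
        ?_ |>.congr_of_eventuallyEq ?_
      · simp only [V]; norm_num; field_simp; ring
      · refine Filter.Eventually.of_forall fun z => ?_
        simp only [V, Pi.add_apply]; norm_num; ring
    · refine (((hinv 3 y hy).const_mul (3 * t / 2)).sub (hinv 2 y hy)).congr_deriv
        ?_ |>.congr_of_eventuallyEq ?_
      · simp only [V]; norm_num; field_simp; ring
      · refine Filter.Eventually.of_forall fun z => ?_
        simp only [V, Pi.sub_apply]; norm_num; ring
  have hW : ∀ k < 4, ∀ y, 0 < y → HasDerivAt (W k) (W (k + 1) y) y := by
    intro k hk y hy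
    have h0 := hy.ne'
    interval_cases k
    · refine (((hinv 0 y hy).const_mul (1 / 2)).sub_const (ε / 2)).congr_deriv
        ?_ |>.congr_of_eventuallyEq ?_
      · simp only [W]; norm_num; field_simp
      · refine Filter.Eventually.of_forall fun z => ?_
        simp only [W]; norm_num; ring
    · refine ((hinv 1 y hy).const_mul (-1 / 2)).congr_deriv ?_ |>.congr_of_eventuallyEq ?_
      · simp only [W]; norm_num; field_simp
      · refine Filter.Eventually.of_forall fun z => ?_
        simp only [W]; norm_num; ring
    · refine (hinv 2 y hy).congr_deriv ?_
      simp only [W]; norm_num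
    · refine ((hinv 3 y hy).const_mul (-3)).congr_deriv ?_ |>.congr_of_eventuallyEq ?_
      · simp only [W]; norm_num; field_simp; norm_num
      · refine Filter.Eventually.of_forall fun z => ?_
        simp only [W]; ring
  -- `U k` is the k-th derivative of y f, reduced to the five products. The form is chosen so that
  -- its first derivative collapses to W E² - E' T.
  let U : ℕ → ℝ → ℝ
    | 0 => fun y => 2 * (y * E1 y ^ 2) - 2 * (E y * E1 y)
        + (-(t / 2) * (1 / y ^ (0 + 1)) + 1 - ε / 2 * y) * E y ^ 2 - E y * T y
    | 1 => fun y => W 0 y * E y ^ 2 - E1 y * T y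
    | 2 => fun y => W 1 y * E y ^ 2 + W 0 y * (E y * E1 y) - V 0 y * (E y * T y)
    | 3 => fun y => W 2 y * E y ^ 2 + 3 * (W 1 y * (E y * E1 y)) + W 0 y * E1 y ^ 2
        - V 1 y * (E y * T y) - V 0 y * (E1 y * T y)
    | 4 => fun y => W 3 y * E y ^ 2 + 5 * (W 2 y * (E y * E1 y)) + 4 * (W 1 y * E1 y ^ 2)
        + 3 * (W 1 y * (V 0 y * E y ^ 2)) + W 0 y * (V 0 y * (E y * E1 y))
        - V 1 y * (W 0 y * E y ^ 2)
        - V 2 y * (E y * T y) - 2 * (V 1 y * (E1 y * T y)) - V 0 y ^ 2 * (E y * T y)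
    | _ => fun y => W 4 y * E y ^ 2 + 7 * (W 3 y * (E y * E1 y)) + 5 * (W 2 y * (V 0 y * E y ^ 2))
        + 9 * (W 2 y * E1 y ^ 2) + 8 * (W 1 y * (V 0 y * (E y * E1 y)))
        + 3 * (W 2 y * (V 0 y * E y ^ 2)) + 3 * (W 1 y * (V 1 y * E y ^ 2))
        + 6 * (W 1 y * (V 0 y * (E y * E1 y)))
        + W 1 y * (V 0 y * (E y * E1 y)) + W 0 y * (V 1 y * (E y * E1 y))
        + W 0 y * (V 0 y * (E1 y ^ 2)) + W 0 y * (V 0 y * (V 0 y * E y ^ 2))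
        - V 2 y * (W 0 y * E y ^ 2) - V 1 y * (W 1 y * E y ^ 2)
        - 2 * (V 1 y * (W 0 y * (E y * E1 y)))
        - V 3 y * (E y * T y) - V 2 y * (E1 y * T y) - V 2 y * (W 0 y * E y ^ 2)
        - 2 * (V 2 y * (E1 y * T y)) - 2 * (V 1 y * (V 0 y * (E y * T y)))
        - 2 * (V 1 y * (W 0 y * (E y * E1 y)))
        - 2 * (V 0 y * V 1 y * (E y * T y)) - V 0 y ^ 2 * (E1 y * T y)
        - V 0 y ^ 2 * (W 0 y * E y ^ 2)
  have hU : ∀ k < 5, ∀ y, 0 < y → HasDerivAt (U k) (U (k + 1) y) y := by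
    intro k hk y hy
    have h0 := hy.ne'
    have e := hE y hy
    have e1 : HasDerivAt E1 (V 0 y * E y) y := hE1 y hy
    have tt : HasDerivAt T (W 0 y * E y) y := hT y hy
    have v0 := hV 0 (by norm_num) y hy
    have v1 := hV 1 (by norm_num) y hy
    have v2 := hV 2 (by norm_num) y hy
    have w0 := hW 0 (by norm_num) y hy
    have w1 := hW 1 (by norm_num) y hy
    have w2 := hW 2 (by norm_num) y hy
    have w3 := hW 3 (by norm_num) y hy
    have ee := e.fun_pow 2
    have ff := e1.fun_pow 2
    have ef := e.fun_mul e1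
    have et := e.fun_mul tt
    have ft := e1.fun_mul tt
    interval_cases k
    · have hq := ((((hinv 0 y hy).const_mul (-(t / 2))).add_const 1).fun_sub
        ((hasDerivAt_id' y).const_mul (ε / 2))).fun_mul ee
      have := (((((hasDerivAt_id' y).fun_mul ff).const_mul 2).fun_sub (ef.const_mul 2)).fun_add hq).fun_sub et
      refine this.congr_deriv ?_
      simp only [U, V, W]
      norm_num
      field_simp
      ring
    · refine ((w0.fun_mul ee).fun_sub ft).congr_deriv ?_
      simp only [U]; norm_num; ring
    · refine (((w1.fun_mul ee).fun_add (w0.fun_mul ef)).fun_sub (v0.fun_mul et)).congr_deriv ?_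
      simp only [U]; norm_num; ring
    · refine (((((w2.fun_mul ee).fun_add ((w1.fun_mul ef).const_mul 3)).fun_add (w0.fun_mul ff)).fun_sub
        (v1.fun_mul et)).fun_sub (v0.fun_mul ft)).congr_deriv ?_
      simp only [U]; norm_num; ring
    · refine (((((((((w3.fun_mul ee).fun_add ((w2.fun_mul ef).const_mul 5)).fun_add
        ((w1.fun_mul ff).const_mul 4)).fun_add ((w1.fun_mul (v0.fun_mul ee)).const_mul 3)).fun_add
        (w0.fun_mul (v0.fun_mul ef))).fun_sub (v1.fun_mul (w0.fun_mul ee))).fun_sub (v2.fun_mul et)).fun_sub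
        ((v1.fun_mul ft).const_mul 2)).fun_sub ((v0.fun_pow 2).fun_mul et)).congr_deriv ?_
      simp only [U]; norm_num; ring
  -- By Leibniz, (y f)^(k+1) = y f^(k+1) + (k + 1) f^(k); solving for the top derivative of f gives
  -- this recursion.
  let F : ℕ → ℝ → ℝ := fun k =>
    Nat.rec (fun y => U 0 y / y) (fun k g y => (U (k + 1) y - (k + 1) * g y) / y) k
  have hF0 : ∀ y, F 0 y = U 0 y / y := fun _ => rfl
  have hFs : ∀ k y, F (k + 1) y = (U (k + 1) y - (k + 1) * F k y) / y := fun _ _ => rfl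
  have hF : ∀ k < 5, ∀ y, 0 < y → HasDerivAt (F k) (F (k + 1) y) y := by
    intro k
    induction k with
    | zero =>
      intro _ y hy
      refine ((hU 0 (by norm_num) y hy).fun_div (hasDerivAt_id' y) hy.ne').congr_deriv ?_
      rw [hFs, hF0]
      have := hy.ne'
      field_simp
      simp
    | succ k ih =>
      intro hk y hy
      refine (((hU (k + 1) (by omega) y hy).fun_sub ((ih (by omega) y hy).const_mul ((k : ℝ) + 1))).fun_div
        (hasDerivAt_id' y) hy.ne').congr_deriv ?_
      rw [hFs (k + 1), hFs k]
      have := hy.ne'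
      push_cast
      field_simp
      ring
  have hfF : EqOn f (F 0) (Ioi 0) := by
    intro z hz
    rw [hf hz, hF0]
    simp only [hardEdgeQuad, U]
    have := (show (0 : ℝ) < z from hz).ne'
    field_simp
    ring
  have key := iteratedDeriv_eq_of_hasDerivAt_Ioi hfF hF
  have h0 := hy.ne'
  have k1 : deriv f y = F 1 y := by rw [← iteratedDeriv_one]; exact key 1 (by norm_num) hy
  simp only [hardEdgeOp, hardEdgeOp0, hardEdgeOp1, hardEdgeOp2, k1, hfF hy,
    key 2 (by norm_num) hy, key 3 (by norm_num) hy, key 4 (by norm_num) hy, key 5 (by norm_num) hy,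
    hFs, hF0, U, V, W]
  -- The remaining identity is polynomial in the values of E, E' and T, so no relation between them
  -- is used.
  generalize E y = p
  generalize E1 y = q
  generalize T y = r
  subst ht
  norm_num
  field_simp
  ring
end ODE

/-! ### Families of functions with expansions in a small parameter. -/

/-- Families of smooth functions on `(0, ∞)` all of whose derivatives are bounded on compact
sets, uniformly in the index. -/
def BoundedFamily (F : ℕ → ℝ → ℝ) : Prop :=
  (∀ n, ContDiffOn ℝ (⊤ : ℕ∞) (F n) (Ioi 0)) ∧
  ∀ (k : ℕ) (K : Set ℝ), IsCompact K → K ⊆ Ioi 0 →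
    ∃ C : ℝ, ∀ n, ∀ y ∈ K, |iteratedDeriv k (F n) y| ≤ C

/-- Families that have an expansion in powers of `ε n` with `m` terms. -/
def ExpandsTo (ε : ℕ → ℝ) : ℕ → (ℕ → ℝ → ℝ) → Prop
  | 0, F => BoundedFamily F
  | m + 1, F => ∃ (r : ℝ → ℝ) (G : ℕ → ℝ → ℝ), ContDiffOn ℝ (⊤ : ℕ∞) r (Ioi 0) ∧
      ExpandsTo ε m G ∧ ∀ n, EqOn (F n) (fun y => r y + ε n * G n y) (Ioi 0)

theorem ContDiffOn.contDiffAt_pos {f : ℝ → ℝ} (hf : ContDiffOn ℝ (⊤ : ℕ∞) f (Ioi 0)) {y : ℝ}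
    (hy : 0 < y) (k : ℕ) : ContDiffAt ℝ k f y :=
  (hf.contDiffAt (Ioi_mem_nhds hy)).of_le (by exact_mod_cast le_top)

theorem iteratedDeriv_eqOn_Ioi {f g : ℝ → ℝ} (h : EqOn f g (Ioi 0)) (k : ℕ) :
    EqOn (iteratedDeriv k f) (iteratedDeriv k g) (Ioi 0) := fun _ hy =>
  (Filter.eventuallyEq_of_mem (Ioi_mem_nhds hy) h).iteratedDeriv_eq k

theorem iteratedDeriv_add_const_mul {r g : ℝ → ℝ} (hr : ContDiffOn ℝ (⊤ : ℕ∞) r (Ioi 0))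
    (hg : ContDiffOn ℝ (⊤ : ℕ∞) g (Ioi 0)) (e : ℝ) (k : ℕ) {y : ℝ} (hy : 0 < y) :
    iteratedDeriv k (fun y => r y + e * g y) y =
      iteratedDeriv k r y + e * iteratedDeriv k g y := by
  have := iteratedDeriv_add (hr.contDiffAt_pos hy k)
    ((contDiffAt_const (c := e)).mul (hg.contDiffAt_pos hy k))
  rw [iteratedDeriv_const_mul_field e g] at this
  exact this

theorem contDiffOn_deriv_Ioi {f : ℝ → ℝ} (hf : ContDiffOn ℝ (⊤ : ℕ∞) f (Ioi 0)) :
    ContDiffOn ℝ (⊤ : ℕ∞) (deriv f) (Ioi 0) :=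
  hf.deriv_of_isOpen isOpen_Ioi (by simp)

namespace BoundedFamily
variable {F G : ℕ → ℝ → ℝ}

theorem congr (hF : BoundedFamily F) (h : ∀ n, EqOn (G n) (F n) (Ioi 0)) : BoundedFamily G := by
  refine ⟨fun n => (hF.1 n).congr (h n), fun k K hK hK0 => ?_⟩
  obtain ⟨C, hC⟩ := hF.2 k K hK hK0
  exact ⟨C, fun n y hy => by rw [iteratedDeriv_eqOn_Ioi (h n) k (hK0 hy)]; exact hC n y hy⟩

theorem of_smooth {f : ℝ → ℝ} (hf : ContDiffOn ℝ (⊤ : ℕ∞) f (Ioi 0)) :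
    BoundedFamily fun _ => f := by
  refine ⟨fun _ => hf, fun k K hK hK0 => ?_⟩
  have hc : ContinuousOn (iteratedDeriv k f) (Ioi 0) := by
    have : ContDiffOn ℝ (⊤ : ℕ∞) (iteratedDeriv k f) (Ioi 0) := by
      induction k with
      | zero => simpa using hf
      | succ k ih => rw [iteratedDeriv_succ]; exact contDiffOn_deriv_Ioi ih
    exact this.continuousOn
  obtain ⟨C, hC⟩ := hK.exists_bound_of_continuousOn (hc.mono hK0)
  exact ⟨C, fun _ y hy => hC y hy⟩

theorem of_scalar {A : ℕ → ℝ} {C : ℝ} (hA : ∀ n, |A n| ≤ C) :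
    BoundedFamily fun n _ => A n := by
  refine ⟨fun _ => contDiffOn_const, fun k K _ _ => ⟨C, fun n y _ => ?_⟩⟩
  rw [iteratedDeriv_const]
  split_ifs
  · exact hA n
  · simpa using (abs_nonneg _).trans (hA n)

theorem add (hF : BoundedFamily F) (hG : BoundedFamily G) :
    BoundedFamily fun n y => F n y + G n y := by
  refine ⟨fun n => (hF.1 n).add (hG.1 n), fun k K hK hK0 => ?_⟩
  obtain ⟨C, hC⟩ := hF.2 k K hK hK0
  obtain ⟨D, hD⟩ := hG.2 k K hK hK0
  refine ⟨C + D, fun n y hy => ?_⟩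
  have := iteratedDeriv_add ((hF.1 n).contDiffAt_pos (hK0 hy) k)
    ((hG.1 n).contDiffAt_pos (hK0 hy) k)
  change |iteratedDeriv k (F n + G n) y| ≤ _
  rw [this]
  exact (abs_add_le _ _).trans (add_le_add (hC n y hy) (hD n y hy))

theorem mul (hF : BoundedFamily F) (hG : BoundedFamily G) :
    BoundedFamily fun n y => F n y * G n y := by
  refine ⟨fun n => (hF.1 n).mul (hG.1 n), fun k K hK hK0 => ?_⟩
  choose C hC using fun k => hF.2 k K hK hK0
  choose D hD using fun k => hG.2 k K hK hK0
  refine ⟨∑ i ∈ Finset.range (k + 1), k.choose i * C i * D (k - i), fun n y hy => ?_⟩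
  have := iteratedDeriv_mul ((hF.1 n).contDiffAt_pos (hK0 hy) k)
    ((hG.1 n).contDiffAt_pos (hK0 hy) k)
  change |iteratedDeriv k (F n * G n) y| ≤ _
  rw [this]
  refine (Finset.abs_sum_le_sum_abs _ _).trans (Finset.sum_le_sum fun i _ => ?_)
  rw [abs_mul, abs_mul, Nat.abs_cast]
  have h1 := hC i n y hy
  have h2 := hD (k - i) n y hy
  have h3 := (abs_nonneg _).trans h1
  gcongr

theorem deriv (hF : BoundedFamily F) : BoundedFamily fun n => deriv (F n) := by
  refine ⟨fun n => contDiffOn_deriv_Ioi (hF.1 n), fun k K hK hK0 => ?_⟩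
  obtain ⟨C, hC⟩ := hF.2 (k + 1) K hK hK0
  refine ⟨C, fun n y hy => ?_⟩
  rw [← iteratedDeriv_succ']
  exact hC n y hy

end BoundedFamily

namespace ExpandsTo
variable {ε : ℕ → ℝ} {e₀ : ℝ} {F G : ℕ → ℝ → ℝ} {m : ℕ}

theorem congr (hF : ExpandsTo ε m F) (h : ∀ n, EqOn (G n) (F n) (Ioi 0)) : ExpandsTo ε m G := by
  cases m with
  | zero => exact BoundedFamily.congr hF h
  | succ m =>
    obtain ⟨r, H, hr, hH, hF⟩ := hF
    exact ⟨r, H, hr, hH, fun n => (h n).trans (hF n)⟩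

theorem bounded (hε : ∀ n, |ε n| ≤ e₀) (hF : ExpandsTo ε m F) : BoundedFamily F := by
  induction m generalizing F with
  | zero => exact hF
  | succ m ih =>
    obtain ⟨r, H, hr, hH, hF⟩ := hF
    exact ((BoundedFamily.of_smooth hr).add ((BoundedFamily.of_scalar hε).mul (ih hH))).congr hF

theorem of_succ (hε : ∀ n, |ε n| ≤ e₀) (hF : ExpandsTo ε (m + 1) F) : ExpandsTo ε m F := by
  induction m generalizing F with
  | zero => exact hF.bounded hε
  | succ m ih =>
    obtain ⟨r, H, hr, hH, hF⟩ := hF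
    exact ⟨r, H, hr, ih hH, hF⟩

theorem of_smooth {f : ℝ → ℝ} (hf : ContDiffOn ℝ (⊤ : ℕ∞) f (Ioi 0)) (m : ℕ) :
    ExpandsTo ε m fun _ => f := by
  induction m generalizing f with
  | zero => exact BoundedFamily.of_smooth hf
  | succ m ih =>
    exact ⟨f, fun _ _ => 0, hf, ih contDiffOn_const, fun n y _ => by simp⟩

theorem add (hF : ExpandsTo ε m F) (hG : ExpandsTo ε m G) :
    ExpandsTo ε m fun n y => F n y + G n y := by
  induction m generalizing F G with
  | zero => exact BoundedFamily.add hF hG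
  | succ m ih =>
    obtain ⟨r, H, hr, hH, hF⟩ := hF
    obtain ⟨s, I, hs, hI, hG⟩ := hG
    refine ⟨fun y => r y + s y, _, hr.add hs, ih hH hI, fun n y hy => ?_⟩
    simp only [hF n hy, hG n hy]
    ring

theorem mul_param (hε : ∀ n, |ε n| ≤ e₀) (hF : ExpandsTo ε m F) :
    ExpandsTo ε m fun n y => ε n * F n y :=
  of_succ hε ⟨fun _ => 0, F, contDiffOn_const, hF, fun n y _ => by simp⟩

/-- The remainder of (r + εH)(s + εI) is rI + sH + εHI, where r and s count as families independent
of the index. -/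
theorem mul (hε : ∀ n, |ε n| ≤ e₀) (hF : ExpandsTo ε m F) (hG : ExpandsTo ε m G) :
    ExpandsTo ε m fun n y => F n y * G n y := by
  induction m generalizing F G with
  | zero => exact BoundedFamily.mul hF hG
  | succ m ih =>
    obtain ⟨r, H, hr, hH, hF⟩ := hF
    obtain ⟨s, I, hs, hI, hG⟩ := hG
    refine ⟨fun y => r y * s y, _, hr.mul hs,
      ((ih (of_smooth hr m) hI).add (ih (of_smooth hs m) hH)).add (mul_param hε (ih hH hI)),
      fun n y hy => ?_⟩
    simp only [hF n hy, hG n hy]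
    ring

theorem deriv (hε : ∀ n, |ε n| ≤ e₀) (hF : ExpandsTo ε m F) :
    ExpandsTo ε m fun n => deriv (F n) := by
  induction m generalizing F with
  | zero => exact BoundedFamily.deriv hF
  | succ m ih =>
    obtain ⟨r, H, hr, hH, hF⟩ := hF
    refine ⟨_root_.deriv r, _, contDiffOn_deriv_Ioi hr, ih hH, fun n y hy => ?_⟩
    have h1 := iteratedDeriv_eqOn_Ioi (hF n) 1 hy
    rw [iteratedDeriv_add_const_mul hr ((hH.bounded hε).1 n) _ _ hy] at h1
    simpa only [iteratedDeriv_one] using h1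

theorem of_scalar_sum {A R : ℕ → ℝ} (b : ℕ → ℝ) {C : ℝ} (hR : ∀ n, |R n| ≤ C)
    (hA : ∀ n, A n = ∑ j ∈ Finset.range m, b j * ε n ^ j + ε n ^ m * R n) :
    ExpandsTo ε m fun n _ => A n := by
  induction m generalizing A b with
  | zero =>
    refine BoundedFamily.of_scalar (C := C) fun n => ?_
    rw [hA n]; simpa using hR n
  | succ m ih =>
    refine ⟨fun _ => b 0, _, contDiffOn_const, ih (A := fun n =>
      ∑ j ∈ Finset.range m, b (j + 1) * ε n ^ j + ε n ^ m * R n) (fun j => b (j + 1))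
      fun n => rfl, fun n y _ => ?_⟩
    simp only [hA n]
    rw [Finset.sum_range_succ', mul_add, Finset.mul_sum]
    have : ∀ j, b (j + 1) * ε n ^ (j + 1) = ε n * (b (j + 1) * ε n ^ j) := fun j => by ring
    simp only [this]
    ring

/-- Full expansions: the coefficients do not depend on the number of terms. -/
theorem step (h0 : ∀ n, ε n ≠ 0) (hlim : Filter.Tendsto ε Filter.atTop (nhds 0))
    (hε : ∀ n, |ε n| ≤ e₀) (hF : ∀ m, ExpandsTo ε m F) :
    ∃ (r : ℝ → ℝ) (G : ℕ → ℝ → ℝ), ContDiffOn ℝ (⊤ : ℕ∞) r (Ioi 0) ∧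
      (∀ m, ExpandsTo ε m G) ∧ ∀ n, EqOn (F n) (fun y => r y + ε n * G n y) (Ioi 0) := by
  -- The leading coefficient is the pointwise limit of the family, hence the same for every number
  -- of terms. As ε n ≠ 0, the remainder is then determined too and inherits expansions of every
  -- length.
  have lim : ∀ (r : ℝ → ℝ) (G : ℕ → ℝ → ℝ), BoundedFamily G →
      (∀ n, EqOn (F n) (fun y => r y + ε n * G n y) (Ioi 0)) → ∀ y, 0 < y →
      Filter.Tendsto (fun n => F n y) Filter.atTop (nhds (r y)) := by
    intro r G hG h y hy
    obtain ⟨C, hC⟩ := hG.2 0 {y} isCompact_singleton (by simpa using hy)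
    have hb : ∀ n, |G n y| ≤ C := fun n => by simpa using hC n y rfl
    have : Filter.Tendsto (fun n => ε n * G n y) Filter.atTop (nhds 0) :=
      hlim.zero_mul_isBoundedUnder_le ⟨C, Filter.eventually_map.2 (.of_forall hb)⟩
    simpa [fun n => h n hy] using this.const_add (r y)
  obtain ⟨r, G, hr, hG, h⟩ := hF 1
  refine ⟨r, G, hr, fun m => ?_, h⟩
  obtain ⟨r', G', hr', hG', h'⟩ := hF (m + 1)
  refine hG'.congr fun n y hy => ?_
  have := tendsto_nhds_unique (lim r G hG h y hy) (lim r' G' (hG'.bounded hε) h' y hy)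
  have e := h n hy
  rw [h' n hy] at e
  simp only [this] at e
  exact (mul_left_cancel₀ (h0 n) (add_left_cancel e)).symm

/-- Iterates `step`, each time on the previous remainder, so that one sequence of coefficients
serves all orders. -/
theorem exists_expansion (h0 : ∀ n, ε n ≠ 0) (hlim : Filter.Tendsto ε Filter.atTop (nhds 0))
    (hε : ∀ n, |ε n| ≤ e₀) (hF : ∀ m, ExpandsTo ε m F) :
    ∃ (r : ℕ → ℝ → ℝ) (G : ℕ → ℕ → ℝ → ℝ), (∀ j, ContDiffOn ℝ (⊤ : ℕ∞) (r j) (Ioi 0)) ∧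
      (∀ j, BoundedFamily (G j)) ∧ G 0 = F ∧
      ∀ j n, EqOn (G j n) (fun y => r j y + ε n * G (j + 1) n y) (Ioi 0) := by
  have st := fun F : {F : ℕ → ℝ → ℝ // ∀ m, ExpandsTo ε m F} => step h0 hlim hε F.2
  choose r G hr hG h using st
  let S : ℕ → {F : ℕ → ℝ → ℝ // ∀ m, ExpandsTo ε m F} := fun j =>
    Nat.rec ⟨F, hF⟩ (fun _ H => ⟨G H, hG H⟩) j
  exact ⟨fun j => r (S j), fun j => (S j).1, fun j => hr _, fun j => (S j).2 0, rfl,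
    fun j n => h (S j) n⟩

end ExpandsTo

/-! ### Coefficients of the expansion and the nested equations. -/

section Nested
variable {ε : ℕ → ℝ} {r : ℕ → ℝ → ℝ} {G : ℕ → ℕ → ℝ → ℝ}

theorem iteratedDeriv_expansion (hr : ∀ j, ContDiffOn ℝ (⊤ : ℕ∞) (r j) (Ioi 0))
    (hG : ∀ j, BoundedFamily (G j))
    (h : ∀ j n, EqOn (G j n) (fun y => r j y + ε n * G (j + 1) n y) (Ioi 0))
    (k n J : ℕ) {y : ℝ} (hy : 0 < y) :
    iteratedDeriv k (G 0 n) y = ∑ j ∈ Finset.range J, ε n ^ j * iteratedDeriv k (r j) y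
      + ε n ^ J * iteratedDeriv k (G J n) y := by
  induction J with
  | zero => simp
  | succ J ih =>
    rw [ih, Finset.sum_range_succ, iteratedDeriv_eqOn_Ioi (h J n) k hy,
      iteratedDeriv_add_const_mul (hr J) ((hG (J + 1)).1 n) _ _ hy]
    ring

theorem hardEdgeOps_add_const_mul {f s g : ℝ → ℝ} {e : ℝ} (a : ℝ)
    (hs : ContDiffOn ℝ (⊤ : ℕ∞) s (Ioi 0)) (hg : ContDiffOn ℝ (⊤ : ℕ∞) g (Ioi 0))
    (h : EqOn f (fun y => s y + e * g y) (Ioi 0)) {y : ℝ} (hy : 0 < y) :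
    hardEdgeOp0 a f y = hardEdgeOp0 a s y + e * hardEdgeOp0 a g y ∧
    hardEdgeOp1 a f y = hardEdgeOp1 a s y + e * hardEdgeOp1 a g y ∧
    hardEdgeOp2 f y = hardEdgeOp2 s y + e * hardEdgeOp2 g y := by
  have hk : ∀ k, iteratedDeriv k f y = iteratedDeriv k s y + e * iteratedDeriv k g y := fun k => by
    rw [iteratedDeriv_eqOn_Ioi h k hy, iteratedDeriv_add_const_mul hs hg _ _ hy]
  have h1 : deriv f y = deriv s y + e * deriv g y := by simpa using hk 1
  simp only [hardEdgeOp0, hardEdgeOp1, hardEdgeOp2, hk, h1, h hy]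
  refine ⟨?_, ?_, ?_⟩ <;> ring

theorem BoundedFamily.exists_bound_hardEdgeOps {F : ℕ → ℝ → ℝ} (hF : BoundedFamily F) (a : ℝ)
    {y : ℝ} (hy : 0 < y) : ∃ C, ∀ n, |hardEdgeOp0 a (F n) y| ≤ C ∧ |hardEdgeOp1 a (F n) y| ≤ C ∧
      |hardEdgeOp2 (F n) y| ≤ C := by
  choose C hC using fun k => hF.2 k {y} isCompact_singleton (by simpa using hy)
  have hb : ∀ k n, |iteratedDeriv k (F n) y| ≤ C k := fun k n => hC k n y rfl
  have hb0 : ∀ n, |F n y| ≤ C 0 := fun n => by simpa using hb 0 n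
  have hb1 : ∀ n, |_root_.deriv (F n) y| ≤ C 1 := fun n => by simpa using hb 1 n
  have cmul : ∀ (c : ℝ) {f : ℕ → ℝ}, (∃ C, ∀ n, |f n| ≤ C) → ∃ C, ∀ n, |c * f n| ≤ C :=
    fun c f ⟨C, hC⟩ => ⟨|c| * C, fun n => by rw [abs_mul]; gcongr; exact hC n⟩
  have hadd : ∀ {f g : ℕ → ℝ}, (∃ C, ∀ n, |f n| ≤ C) → (∃ C, ∀ n, |g n| ≤ C) →
      ∃ C, ∀ n, |f n + g n| ≤ C := fun ⟨C, hC⟩ ⟨D, hD⟩ =>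
    ⟨C + D, fun n => (abs_add_le _ _).trans (add_le_add (hC n) (hD n))⟩
  have hsub : ∀ {f g : ℕ → ℝ}, (∃ C, ∀ n, |f n| ≤ C) → (∃ C, ∀ n, |g n| ≤ C) →
      ∃ C, ∀ n, |f n - g n| ≤ C := fun ⟨C, hC⟩ ⟨D, hD⟩ =>
    ⟨C + D, fun n => (abs_sub _ _).trans (add_le_add (hC n) (hD n))⟩
  have B0 : ∃ M, ∀ n, |hardEdgeOp0 a (F n) y| ≤ M :=
    hadd (hadd (hadd (hadd (hadd (cmul _ ⟨_, hb0⟩) (cmul _ ⟨_, hb1⟩)) (cmul _ ⟨_, hb 2⟩))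
      (cmul _ ⟨_, hb 3⟩)) (cmul _ ⟨_, hb 4⟩)) (cmul _ ⟨_, hb 5⟩)
  have B1 : ∃ M, ∀ n, |hardEdgeOp1 a (F n) y| ≤ M :=
    cmul _ (hsub (hsub (hadd (cmul _ ⟨_, hb0⟩) (cmul _ ⟨_, hb1⟩)) (cmul _ ⟨_, hb 2⟩))
      (cmul _ ⟨_, hb 3⟩))
  have B2 : ∃ M, ∀ n, |hardEdgeOp2 (F n) y| ≤ M := cmul _ ⟨_, hb1⟩
  obtain ⟨C0, h0⟩ := B0
  obtain ⟨C1, h1⟩ := B1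
  obtain ⟨C2, h2⟩ := B2
  exact ⟨max C0 (max C1 C2), fun n => ⟨(h0 n).trans (le_max_left _ _),
    (h1 n).trans ((le_max_left _ _).trans (le_max_right _ _)),
    (h2 n).trans ((le_max_right _ _).trans (le_max_right _ _))⟩⟩

/-- Induction on the remainders: applied to G_j, the full operator gives -𝒟₁r_(j-1) - 𝒟₂r_(j-2) - ε
𝒟₂r_(j-1). Letting ε tend to 0 gives the equation for r_j; subtracting that equation and dividing by
ε gives the same statement for G_(j+1). -/
theorem hardEdgeOp_nested (a : ℝ) (h0 : ∀ n, ε n ≠ 0)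
    (hlim : Filter.Tendsto ε Filter.atTop (nhds 0))
    (hr : ∀ j, ContDiffOn ℝ (⊤ : ℕ∞) (r j) (Ioi 0)) (hG : ∀ j, BoundedFamily (G j))
    (h : ∀ j n, EqOn (G j n) (fun y => r j y + ε n * G (j + 1) n y) (Ioi 0))
    {y : ℝ} (hy : 0 < y) (hop : ∀ n, hardEdgeOp a (ε n) (G 0 n) y = 0) (rz : ℤ → ℝ → ℝ)
    (hrz : ∀ j : ℕ, rz j = r j) (hz1 : rz (-1) = 0) (hz2 : rz (-2) = 0) (j : ℕ) :
    hardEdgeOp0 a (rz j) y = - hardEdgeOp1 a (rz (j - 1)) y - hardEdgeOp2 (rz (j - 2)) y := by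
  have z1 : hardEdgeOp1 a 0 y = 0 := by
    simp [hardEdgeOp1, show (0 : ℝ → ℝ) = fun _ => 0 from rfl]
  have z2 : hardEdgeOp2 0 y = 0 := by
    simp [hardEdgeOp2, show (0 : ℝ → ℝ) = fun _ => 0 from rfl]
  have lin := fun j n => hardEdgeOps_add_const_mul a (hr j) ((hG (j + 1)).1 n) (h j n) hy
  have main : ∀ j : ℕ, (∀ n, hardEdgeOp a (ε n) (G j n) y
      = - hardEdgeOp1 a (rz (j - 1)) y - hardEdgeOp2 (rz (j - 2)) y
        - ε n * hardEdgeOp2 (rz (j - 1)) y) →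
      hardEdgeOp0 a (rz j) y = - hardEdgeOp1 a (rz (j - 1)) y - hardEdgeOp2 (rz (j - 2)) y := by
    intro j hj
    obtain ⟨C, hC⟩ := (hG (j + 1)).exists_bound_hardEdgeOps a hy
    have bl : ∀ f : ℕ → ℝ, (∀ n, |f n| ≤ C) →
        Filter.Tendsto (fun n => ε n * f n) Filter.atTop (nhds 0) := fun f hf =>
      hlim.zero_mul_isBoundedUnder_le ⟨C, Filter.eventually_map.2 (.of_forall hf)⟩
    have t0 := (bl _ fun n => (hC n).1).const_add (hardEdgeOp0 a (r j) y)
    have t1 := hlim.mul ((bl _ fun n => (hC n).2.1).const_add (hardEdgeOp1 a (r j) y))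
    have t2 := (hlim.pow 2).mul ((bl _ fun n => (hC n).2.2).const_add (hardEdgeOp2 (r j) y))
    have t := (t0.add t1).add t2
    have t' := (hlim.mul_const (hardEdgeOp2 (rz (j - 1)) y)).const_sub
      (- hardEdgeOp1 a (rz (j - 1)) y - hardEdgeOp2 (rz (j - 2)) y)
    have := tendsto_nhds_unique t (t'.congr fun n => by
      rw [← hj n, hardEdgeOp, (lin j n).1, (lin j n).2.1, (lin j n).2.2])
    rw [hrz]
    simpa using this
  refine main j ?_
  induction j with
  | zero => intro n; simp [hop, hz1, hz2, z1, z2]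
  | succ j ih =>
    intro n
    have e0 := main j ih
    have e1 := ih n
    rw [hardEdgeOp, (lin j n).1, (lin j n).2.1, (lin j n).2.2, ← hrz, e0] at e1
    have s1 : ((j + 1 : ℕ) : ℤ) - 1 = j := by push_cast; ring
    have s2 : ((j + 1 : ℕ) : ℤ) - 2 = j - 1 := by push_cast; ring
    rw [s1, s2, hardEdgeOp]
    apply mul_left_cancel₀ (h0 n)
    linear_combination e1
end Nested

/-! ### Ratios of Gamma functions: asymptotics in even powers. -/

theorem AnalyticAt.exists_eq_add_mul {f : ℝ → ℝ} (hf : AnalyticAt ℝ f 0) :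
    ∃ g : ℝ → ℝ, AnalyticAt ℝ g 0 ∧ ∀ w, f w = f 0 + w * g w := by
  obtain ⟨p, hp⟩ := hf
  refine ⟨dslope f 0, ⟨_, hp.has_fpower_series_dslope_fslope⟩, fun w => ?_⟩
  have := sub_smul_dslope f 0 w
  rw [sub_zero, smul_eq_mul] at this
  linarith

theorem AnalyticAt.exists_eq_sum_add {f : ℝ → ℝ} (hf : AnalyticAt ℝ f 0) (m : ℕ) :
    ∃ (b : ℕ → ℝ) (g : ℝ → ℝ), AnalyticAt ℝ g 0 ∧
      ∀ w, f w = ∑ j ∈ Finset.range m, b j * w ^ j + w ^ m * g w := by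
  induction m with
  | zero => exact ⟨0, f, hf, fun w => by simp⟩
  | succ m ih =>
    obtain ⟨b, g, hg, h⟩ := ih
    obtain ⟨k, hk, h'⟩ := hg.exists_eq_add_mul
    refine ⟨fun j => if j = m then g 0 else b j, k, hk, fun w => ?_⟩
    simp only [Finset.sum_range_succ, if_true]
    rw [h w, h' w]
    have : ∀ j ∈ Finset.range m, (if j = m then g 0 else b j) * w ^ j = b j * w ^ j := fun j hj => by
      rw [if_neg (Finset.mem_range.1 hj).ne]
    rw [Finset.sum_congr rfl this]
    ring

theorem AnalyticAt.exists_abs_le {g : ℝ → ℝ} (hg : AnalyticAt ℝ g 0) :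
    ∃ M δ : ℝ, 0 ≤ M ∧ 0 < δ ∧ ∀ w, |w| < δ → |g w| ≤ M := by
  have := hg.continuousAt.abs.tendsto.eventually (ge_mem_nhds (lt_add_one |g 0|))
  obtain ⟨δ, hδ, h⟩ := Metric.eventually_nhds_iff.1 this
  exact ⟨|g 0| + 1, δ, by positivity, hδ, fun w hw => h (by simpa using hw)⟩

/-- The left side is odd in x; the factor A is read off from its power series. -/
theorem exists_analytic_log_sub_log :
    ∃ A : ℝ → ℝ, AnalyticAt ℝ A 0 ∧ A 0 = 2 ∧
      ∀ x : ℝ, |x| < 1 → Real.log (1 + x) - Real.log (1 - x) = x * A (x ^ 2) := by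
  let c : ℕ → ℝ := fun k => 2 * (1 / (2 * k + 1))
  have hs : ∀ w : ℝ, |w| < 1 → Summable fun k => w ^ k * c k := by
    intro w hw
    refine Summable.of_norm_bounded (g := fun k => 2 * |w| ^ k)
      ((summable_geometric_of_lt_one (abs_nonneg _) hw).mul_left 2) fun k => ?_
    have h1 : |c k| ≤ 2 := by
      rw [abs_of_nonneg (by positivity)]
      have : 1 / (2 * (k : ℝ) + 1) ≤ 1 := by
        rw [div_le_one (by positivity)]; linarith [Nat.cast_nonneg (α := ℝ) k]
      simp only [c]; linarith
    rw [Real.norm_eq_abs, abs_mul, abs_pow, mul_comm]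
    gcongr
  refine ⟨fun w => ∑' k, w ^ k * c k, ⟨FormalMultilinearSeries.ofScalars ℝ c, ?_⟩, ?_, ?_⟩
  · rw [hasFPowerSeriesAt_iff]
    filter_upwards [Metric.ball_mem_nhds (0 : ℝ) one_pos] with w hw
    simp only [FormalMultilinearSeries.coeff_ofScalars, smul_eq_mul, zero_add]
    exact (hs w (by simpa using hw)).hasSum
  · simp only
    rw [tsum_eq_single 0 (fun k hk => by simp [hk])]
    simp [c]
  · intro x hx
    rw [← (Real.hasSum_log_sub_log_of_abs_lt_one hx).tsum_eq, ← tsum_mul_left]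
    refine tsum_congr fun k => ?_
    simp only [c]; ring

/-- Even and odd parts of `(1 + x) ^ m`. -/
theorem exists_even_odd_pow (m : ℕ) :
    ∃ e o : ℝ → ℝ, AnalyticAt ℝ e 0 ∧ AnalyticAt ℝ o 0 ∧ e 0 = 1 ∧ o 0 = m ∧
      ∀ x : ℝ, (1 + x) ^ m = e (x ^ 2) + x * o (x ^ 2) ∧
        (1 - x) ^ m = e (x ^ 2) - x * o (x ^ 2) := by
  induction m with
  | zero => exact ⟨fun _ => 1, fun _ => 0, analyticAt_const, analyticAt_const, rfl, by simp, by simp⟩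
  | succ m ih =>
    obtain ⟨e, o, he, ho, e0, o0, h⟩ := ih
    refine ⟨fun w => e w + w * o w, fun w => o w + e w, by fun_prop, by fun_prop, by simp [e0],
      by simp [e0, o0], fun x => ⟨?_, ?_⟩⟩
    · rw [pow_succ, (h x).1]; ring
    · rw [pow_succ, (h x).2]; ring

/-- Seen from the midpoint z + 1/2, the unit difference of z^(-2k) is odd in v = (z + 1/2)⁻¹ and
begins with -2k v^(2k+1). The nonzero leading coefficient lets it cancel a prescribed term. -/
theorem exists_inv_pow_sub (k : ℕ) (hk : 0 < k) :
    ∃ γ : ℝ → ℝ, AnalyticAt ℝ γ 0 ∧ γ 0 ≠ 0 ∧ ∀ z : ℝ, 0 < z →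
      (((z + 1) ^ 2)⁻¹) ^ k - ((z ^ 2)⁻¹) ^ k =
        (z + 1 / 2)⁻¹ * (((z + 1 / 2)⁻¹ ^ 2) ^ k * γ ((z + 1 / 2)⁻¹ ^ 2)) := by
  obtain ⟨e, o, -, ho, -, o0, h⟩ := exists_even_odd_pow (2 * k)
  have hq : AnalyticAt ℝ (fun w : ℝ => w / 4) 0 := by fun_prop
  refine ⟨fun w => - o (w / 4) / (1 - w / 4) ^ (2 * k), ?_, ?_, fun z hz => ?_⟩
  · refine AnalyticAt.div ?_ (by fun_prop) (by simp)
    exact (ho.comp_of_eq hq (by simp)).neg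
  · simp [o0, hk.ne']
  · set v := (z + 1 / 2)⁻¹ with hv
    have hu : z + 1 / 2 ≠ 0 := by positivity
    have hvp : 0 < v := by positivity
    have hz1 : z = (1 - v / 2) / v := by rw [hv]; field_simp; ring
    have hz2 : z + 1 = (1 + v / 2) / v := by rw [hv]; field_simp; ring
    have h1 : 0 < 1 - v / 2 := by
      have : 0 < (1 - v / 2) / v := hz1 ▸ hz
      exact (div_pos_iff_of_pos_right hvp).1 this
    have h2 : 0 < 1 + v / 2 := by positivity
    have e2 : (1 - v ^ 2 / 4) ^ (2 * k) = (1 + v / 2) ^ (2 * k) * (1 - v / 2) ^ (2 * k) := by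
      rw [← mul_pow]; ring
    have h4 : v ^ 2 / 4 = (v / 2) ^ 2 := by ring
    have hd := (h (v / 2)).1
    have hd' := (h (v / 2)).2
    have key : (1 + v / 2) ^ (2 * k) - (1 - v / 2) ^ (2 * k) = v * o (v ^ 2 / 4) := by
      rw [hd, hd', h4]; ring
    simp only
    rw [hz2, hz1, e2]
    have p1 : (1 + v / 2) ^ (2 * k) ≠ 0 := by positivity
    have p2 : (1 - v / 2) ^ (2 * k) ≠ 0 := by positivity
    have t1 : ((((1 + v / 2) / v) ^ 2)⁻¹) ^ k = v ^ (2 * k) / (1 + v / 2) ^ (2 * k) := by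
      rw [div_pow, inv_div, div_pow, ← pow_mul, ← pow_mul]
    have t2 : ((((1 - v / 2) / v) ^ 2)⁻¹) ^ k = v ^ (2 * k) / (1 - v / 2) ^ (2 * k) := by
      rw [div_pow, inv_div, div_pow, ← pow_mul, ← pow_mul]
    rw [t1, t2, ← pow_mul]
    generalize (1 + v / 2) ^ (2 * k) = p at *
    generalize (1 - v / 2) ^ (2 * k) = q at *
    rw [div_sub_div _ _ p1 p2]
    clear_value v
    field_simp
    linear_combination -key

/-- The logarithm of the ratio of Gamma functions, with its leading behaviour removed. -/
noncomputable def logGammaRatio (s z : ℝ) : ℝ :=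
  Real.log (Real.Gamma (z + (1 + s) / 2)) - Real.log (Real.Gamma (z + (1 - s) / 2))
    - s * Real.log z

/-- With u = z + 1/2, the functional equation of Γ turns the difference into log((u + s/2)/(u -
s/2)) - s log((u + 1/2)/(u - 1/2)). This is odd in 1/u and its terms of order 1/u cancel. -/
theorem logGammaRatio_diff (s : ℝ) :
    ∃ g : ℝ → ℝ, AnalyticAt ℝ g 0 ∧ ∀ z : ℝ, |s| < z → 0 < z →
      logGammaRatio s (z + 1) - logGammaRatio s z =
        (z + 1 / 2)⁻¹ * ((z + 1 / 2)⁻¹ ^ 2 * g ((z + 1 / 2)⁻¹ ^ 2)) := by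
  obtain ⟨A, hA, A0, h⟩ := exists_analytic_log_sub_log
  have hf : AnalyticAt ℝ (fun w => s / 2 * A (s ^ 2 / 4 * w) - s / 2 * A (w / 4)) 0 := by
    have h1 : AnalyticAt ℝ (fun w => A (s ^ 2 / 4 * w)) 0 :=
      hA.comp_of_eq (f := fun w => s ^ 2 / 4 * w) (by fun_prop) (by simp)
    have h2 : AnalyticAt ℝ (fun w => A (w / 4)) 0 :=
      hA.comp_of_eq (f := fun w => w / 4) (by fun_prop) (by simp)
    exact (analyticAt_const.mul h1).sub (analyticAt_const.mul h2)
  obtain ⟨g, hg, hfg⟩ := hf.exists_eq_add_mul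
  refine ⟨g, hg, fun z hsz hz => ?_⟩
  have hfg' := hfg ((z + 1 / 2)⁻¹ ^ 2)
  simp only [mul_zero, zero_div, sub_self, zero_add] at hfg'
  rw [← hfg']
  have hs := abs_lt.1 hsz
  set u := z + 1 / 2 with hu
  have hup : 0 < u := by positivity
  have a1 : 0 < z + (1 + s) / 2 := by linarith
  have a2 : 0 < z + (1 - s) / 2 := by linarith
  have G1 : Real.log (Real.Gamma (z + 1 + (1 + s) / 2)) =
      Real.log (u + s / 2) + Real.log (Real.Gamma (z + (1 + s) / 2)) := by
    rw [show z + 1 + (1 + s) / 2 = (z + (1 + s) / 2) + 1 by ring, Real.Gamma_add_one a1.ne',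
      Real.log_mul a1.ne' (Real.Gamma_pos_of_pos a1).ne', hu]
    ring_nf
  have G2 : Real.log (Real.Gamma (z + 1 + (1 - s) / 2)) =
      Real.log (u - s / 2) + Real.log (Real.Gamma (z + (1 - s) / 2)) := by
    rw [show z + 1 + (1 - s) / 2 = (z + (1 - s) / 2) + 1 by ring, Real.Gamma_add_one a2.ne',
      Real.log_mul a2.ne' (Real.Gamma_pos_of_pos a2).ne', hu]
    ring_nf
  have L : ∀ r : ℝ, 0 < u + r → Real.log (u + r) = Real.log u + Real.log (1 + r / u) := by
    intro r hr
    rw [← Real.log_mul hup.ne' (by rw [show 1 + r / u = (u + r) / u by field_simp]; positivity)]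
    congr 1
    field_simp
  have x1 : |s / 2 / u| < 1 := by
    rw [abs_div, abs_of_pos hup, div_lt_one hup, abs_div, abs_two]
    linarith [abs_nonneg s]
  have x2 : |1 / 2 / u| < 1 := by
    rw [abs_div, abs_of_pos hup, div_lt_one hup, abs_of_pos (by norm_num)]; linarith
  have e1 := h _ x1
  have e2 := h _ x2
  have l1 := L (s / 2) (by linarith)
  have l2 := L (-(s / 2)) (by linarith)
  have l3 := L (1 / 2) (by linarith)
  have l4 := L (-(1 / 2)) (by linarith)
  rw [neg_div, ← sub_eq_add_neg, ← sub_eq_add_neg] at l2 l4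
  simp only [logGammaRatio]
  rw [G1, G2, show z + 1 = u + 1 / 2 by rw [hu]; ring, l1, l2, l3,
    show Real.log z = Real.log u + Real.log (1 - 1 / 2 / u) by rw [← l4, hu]; ring_nf]
  have r1 : s ^ 2 / 4 * u⁻¹ ^ 2 = (s / 2 / u) ^ 2 := by ring
  have r2 : u⁻¹ ^ 2 / 4 = (1 / 2 / u) ^ 2 := by ring
  rw [r1, r2]
  linear_combination e1 - s * e2

/-- Every correction b_k z^(-2(k+1)) removes the leading term of the unit difference. By parity the
order then improves by two, so even powers suffice. -/
theorem exists_logGammaRatio_corrected (s : ℝ) (J : ℕ) :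
    ∃ (b : ℕ → ℝ) (g : ℝ → ℝ), AnalyticAt ℝ g 0 ∧ ∀ z : ℝ, |s| < z → 0 < z →
      (logGammaRatio s (z + 1) - ∑ k ∈ Finset.range J, b k * (((z + 1) ^ 2)⁻¹) ^ (k + 1))
        - (logGammaRatio s z - ∑ k ∈ Finset.range J, b k * ((z ^ 2)⁻¹) ^ (k + 1)) =
        (z + 1 / 2)⁻¹ * (((z + 1 / 2)⁻¹ ^ 2) ^ (J + 1) * g ((z + 1 / 2)⁻¹ ^ 2)) := by
  induction J with
  | zero =>
    obtain ⟨g, hg, h⟩ := logGammaRatio_diff s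
    exact ⟨0, g, hg, fun z h1 h2 => by simpa using h z h1 h2⟩
  | succ J ih =>
    obtain ⟨b, g, hg, h⟩ := ih
    obtain ⟨γ, hγ, γ0, hk⟩ := exists_inv_pow_sub (J + 1) J.succ_pos
    -- The new coefficient g 0 / γ 0 is the one that makes this function vanish at 0.
    have ha : AnalyticAt ℝ (fun w => g w - g 0 / γ 0 * γ w) 0 := by fun_prop
    obtain ⟨k, hk', e⟩ := ha.exists_eq_add_mul
    refine ⟨fun j => if j = J then g 0 / γ 0 else b j, k, hk', fun z h1 h2 => ?_⟩
    have : ∀ x : ℝ, ∑ j ∈ Finset.range J, (if j = J then g 0 / γ 0 else b j) * x ^ (j + 1) =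
        ∑ j ∈ Finset.range J, b j * x ^ (j + 1) := fun x => by
      refine Finset.sum_congr rfl fun j hj => ?_
      rw [if_neg (Finset.mem_range.1 hj).ne]
    simp only [Finset.sum_range_succ, if_true]
    rw [this, this]
    have e' := e ((z + 1 / 2)⁻¹ ^ 2)
    simp only [div_mul_cancel₀ _ γ0, sub_self, zero_add] at e'
    have h3 := h z h1 h2
    have h4 := hk z h2
    generalize (z + 1 / 2)⁻¹ = v at *
    rw [show v * ((v ^ 2) ^ (J + 1 + 1) * k (v ^ 2)) =
      v * (v ^ 2) ^ (J + 1) * (v ^ 2 * k (v ^ 2)) by ring, ← e']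
    linear_combination h3 - g 0 / γ 0 * h4

theorem Gamma_add_nat_add_one {p : ℝ} (hp : 0 < p) (n : ℕ) :
    Real.Gamma (p + n + 1) = Real.Gamma p * ∏ j ∈ Finset.range (n + 1), (p + j) := by
  induction n with
  | zero => simp [Real.Gamma_add_one hp.ne', mul_comm]
  | succ n ih =>
    rw [Finset.prod_range_succ, ← mul_assoc, ← ih,
      Real.Gamma_add_one (by positivity : p + (n + 1 : ℕ) ≠ 0)]
    push_cast
    rw [show p + (n : ℝ) + 1 = p + (n + 1) by ring]
    ring

/-- The logarithm of Euler's limit formula for Γ(p). -/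
theorem tendsto_logGamma {p : ℝ} (hp : 0 < p) :
    Filter.Tendsto (fun n : ℕ => Real.log (Real.Gamma (p + n + 1)) - p * Real.log n
      - Real.log n.factorial) Filter.atTop (nhds 0) := by
  have h := (Real.GammaSeq_tendsto_Gamma p).log (Real.Gamma_pos_of_pos hp).ne'
  have h2 := h.const_sub (Real.log (Real.Gamma p))
  rw [sub_self] at h2
  refine h2.congr' ?_
  filter_upwards [Filter.eventually_gt_atTop 0] with n hn
  have hn' : (0 : ℝ) < n := by exact_mod_cast hn
  have hprod : 0 < ∏ j ∈ Finset.range (n + 1), (p + j) :=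
    Finset.prod_pos fun j _ => by positivity
  rw [Gamma_add_nat_add_one hp, Real.log_mul (Real.Gamma_pos_of_pos hp).ne' hprod.ne',
    Real.GammaSeq, Real.log_div (mul_pos (Real.rpow_pos_of_pos hn' p)
    (by exact_mod_cast n.factorial_pos)).ne' hprod.ne', Real.log_mul
    (Real.rpow_pos_of_pos hn' p).ne' (by exact_mod_cast n.factorial_ne_zero), Real.log_rpow hn']
  ring

theorem tendsto_logGammaRatio (s z : ℝ) (hz : |s| + 1 < z) :
    Filter.Tendsto (fun n : ℕ => logGammaRatio s (z + n)) Filter.atTop (nhds 0) := by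
  have hs := abs_lt.1 (show |s| < z by linarith)
  have a := abs_nonneg s
  have h1 := tendsto_logGamma (p := z + (1 + s) / 2 - 1) (by linarith [neg_abs_le s])
  have h2 := tendsto_logGamma (p := z + (1 - s) / 2 - 1) (by linarith [le_abs_self s])
  have h3 : Filter.Tendsto (fun n : ℕ => Real.log (z + n) - Real.log n) Filter.atTop (nhds 0) := by
    have : Filter.Tendsto (fun n : ℕ => Real.log (1 + z / n)) Filter.atTop (nhds 0) := by
      have := ((tendsto_const_div_atTop_nhds_zero_nat z).const_add 1).log (by norm_num)
      simpa using this
    refine this.congr' ?_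
    filter_upwards [Filter.eventually_gt_atTop 0] with n hn
    have hn' : (0 : ℝ) < n := by exact_mod_cast hn
    rw [← Real.log_div (by linarith) hn'.ne']
    congr 1
    field_simp
    ring
  have h := (h1.sub h2).sub (h3.const_mul s)
  simp only [sub_zero, mul_zero] at h
  refine h.congr fun n => ?_
  simp only [logGammaRatio]
  rw [show z + (1 + s) / 2 - 1 + n + 1 = z + n + (1 + s) / 2 by ring,
    show z + (1 - s) / 2 - 1 + n + 1 = z + n + (1 - s) / 2 by ring]
  ring

/-- The corrected function tends to 0 along z + n, so its value at z is minus the sum of its unit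
differences, which are small. -/
theorem logGammaRatio_asymp (s : ℝ) (J : ℕ) :
    ∃ (b : ℕ → ℝ) (C z₀ : ℝ), 1 ≤ z₀ ∧ |s| + 1 < z₀ ∧ 0 ≤ C ∧ ∀ z, z₀ ≤ z →
      |logGammaRatio s z - ∑ k ∈ Finset.range J, b k * ((z ^ 2)⁻¹) ^ (k + 1)|
        ≤ C * ((z ^ 2)⁻¹) ^ (J + 1) := by
  obtain ⟨b, g, hg, h⟩ := exists_logGammaRatio_corrected s J
  obtain ⟨M, δ, hM, hδ, hb⟩ := hg.exists_abs_le
  -- The summand |s| + 2 keeps the Gamma arguments positive and `tendsto_logGammaRatio` applicable;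
  -- δ⁻¹ brings (x + 1/2)⁻¹ below the radius on which g is bounded.
  set z₀ : ℝ := |s| + 2 + δ⁻¹ with hz₀
  have hδ' : 0 < δ⁻¹ := by positivity
  have habs := abs_nonneg s
  refine ⟨b, 2 * M, z₀, by linarith, by linarith, by positivity, fun z hz => ?_⟩
  set D : ℝ → ℝ := fun z => logGammaRatio s z - ∑ k ∈ Finset.range J, b k * ((z ^ 2)⁻¹) ^ (k + 1)
    with hD
  have hz1 : 1 ≤ z := by linarith
  have step : ∀ x, z ≤ x → |D (x + 1) - D x| ≤
      M * ((z ^ 2)⁻¹) ^ J * z⁻¹ * (2 * (x⁻¹ - (x + 1)⁻¹)) := by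
    intro x hx
    have hx0 : 0 < x := by linarith
    have e := h x (by linarith) hx0
    simp only [hD]
    rw [e]
    set v := (x + 1 / 2)⁻¹ with hv
    have hvp : 0 < v := by positivity
    have hvx : v ≤ x⁻¹ := by rw [hv]; gcongr; linarith
    have hxz : x⁻¹ ≤ z⁻¹ := by gcongr
    have hv1 : v ≤ 1 := hvx.trans (inv_le_one_of_one_le₀ (by linarith))
    have hvδ : |v ^ 2| < δ := by
      rw [abs_of_pos (by positivity)]
      have h1 : v ^ 2 ≤ v := by nlinarith
      have h2 : v < δ := by
        rw [hv, inv_lt_comm₀ (by positivity) hδ]; linarith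
      linarith
    rw [abs_mul, abs_mul, abs_of_pos hvp, abs_of_pos (by positivity : (0:ℝ) < (v ^ 2) ^ (J + 1))]
    have hgb := hb _ hvδ
    have e1 : (v ^ 2) ^ J ≤ ((z ^ 2)⁻¹) ^ J := by
      rw [← inv_pow]; gcongr; exact hvx.trans hxz
    -- One factor v² is traded for a telescoping difference; the other powers are bounded by their
    -- values at z.
    have e2 : v ^ 2 ≤ 2 * (x⁻¹ - (x + 1)⁻¹) := by
      rw [hv, inv_sub_inv hx0.ne' (by positivity), inv_pow, inv_eq_one_div, mul_div_assoc', div_le_div_iff₀ (by positivity) (by positivity)]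
      nlinarith
    calc v * ((v ^ 2) ^ (J + 1) * |g (v ^ 2)|) = |g (v ^ 2)| * (v ^ 2) ^ J * v * v ^ 2 := by ring
      _ ≤ M * ((z ^ 2)⁻¹) ^ J * z⁻¹ * (2 * (x⁻¹ - (x + 1)⁻¹)) := by
        gcongr
        exact hvx.trans hxz
  have tel : ∀ n : ℕ, |D (z + n) - D z| ≤
      M * ((z ^ 2)⁻¹) ^ J * z⁻¹ * (2 * (z⁻¹ - (z + n)⁻¹)) := by
    intro n
    induction n with
    | zero => simp
    | succ n ih =>
      have s1 := step (z + n) (by linarith [Nat.cast_nonneg (α := ℝ) n])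
      rw [show z + n + 1 = z + (n + 1 : ℕ) by push_cast; ring] at s1
      calc |D (z + (n + 1 : ℕ)) - D z|
          ≤ |D (z + (n + 1 : ℕ)) - D (z + n)| + |D (z + n) - D z| := abs_sub_le _ _ _
        _ ≤ _ := add_le_add s1 ih
        _ = _ := by ring
  have lim : Filter.Tendsto (fun n : ℕ => D (z + n)) Filter.atTop (nhds 0) := by
    have l1 := tendsto_logGammaRatio s z (by linarith)
    have l2 : Filter.Tendsto (fun n : ℕ => ∑ k ∈ Finset.range J, b k * (((z + n) ^ 2)⁻¹) ^ (k + 1))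
        Filter.atTop (nhds (∑ k ∈ Finset.range J, b k * 0 ^ (k + 1))) := by
      refine tendsto_finsetSum _ fun k _ => ((Filter.Tendsto.pow ?_ _).const_mul _)
      have : Filter.Tendsto (fun n : ℕ => z + (n : ℝ)) Filter.atTop Filter.atTop :=
        Filter.tendsto_atTop_add_const_left _ _ tendsto_natCast_atTop_atTop
      exact ((Filter.tendsto_pow_atTop two_ne_zero).comp this).inv_tendsto_atTop
    have l3 := l1.sub l2
    simp only [ne_eq, Nat.add_eq_zero_iff, one_ne_zero, and_false, not_false_eq_true, zero_pow,
      mul_zero, Finset.sum_const_zero, sub_zero] at l3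
    exact l3
  have final : |0 - D z| ≤ M * ((z ^ 2)⁻¹) ^ J * z⁻¹ * (2 * z⁻¹) := by
    refine le_of_tendsto (lim.sub_const (D z)).abs (Filter.Eventually.of_forall fun n => (tel n).trans ?_)
    have : 0 < (z + n)⁻¹ := by positivity
    gcongr
    linarith
  rw [zero_sub, abs_neg] at final
  refine final.trans (le_of_eq ?_)
  rw [pow_succ _ J, ← inv_pow]
  ring

/-- Exponentiates `logGammaRatio_asymp`: the exponential of the polynomial part is Taylor expanded
in w = z⁻², and the exponential of the remainder is 1 + O(w^m). -/
theorem gammaRatio_asymp (s : ℝ) (m : ℕ) :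
    ∃ (b : ℕ → ℝ) (C z₀ : ℝ), 1 ≤ z₀ ∧ ∀ z, z₀ ≤ z →
      |Real.Gamma (z + (1 + s) / 2) / Real.Gamma (z + (1 - s) / 2) * z ^ (-s)
          - ∑ k ∈ Finset.range m, b k * ((z ^ 2)⁻¹) ^ k| ≤ C * ((z ^ 2)⁻¹) ^ m := by
  obtain ⟨b, C, z₀, hz1, hzs, hC, h⟩ := logGammaRatio_asymp s m
  have ha : AnalyticAt ℝ (fun w => Real.exp (∑ k ∈ Finset.range m, b k * w ^ (k + 1))) 0 := by
    have : AnalyticAt ℝ (fun w : ℝ => ∑ k ∈ Finset.range m, b k * w ^ (k + 1)) 0 :=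
      Finset.analyticAt_fun_sum _ fun k _ => by fun_prop
    exact this.rexp
  obtain ⟨β, g, hg, e⟩ := ha.exists_eq_sum_add m
  obtain ⟨M, δ, hM, hδ, hb⟩ := hg.exists_abs_le
  obtain ⟨M', δ', hM', hδ', hb'⟩ := ha.exists_abs_le
  have p1 : 0 < δ⁻¹ := by positivity
  have p2 : 0 < δ'⁻¹ := by positivity
  refine ⟨β, M + M' * (C * Real.exp C), z₀ + δ⁻¹ + δ'⁻¹, by linarith, fun z hz => ?_⟩
  have hz1' : 1 ≤ z := by linarith
  have hzpos : 0 < z := by linarith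
  set w := (z ^ 2)⁻¹ with hw
  have hw0 : 0 < w := by positivity
  have hwz : w ≤ z⁻¹ := by rw [hw]; gcongr; nlinarith
  have hw1 : w ≤ 1 := hwz.trans (inv_le_one_of_one_le₀ hz1')
  have hwδ : |w| < δ := by
    rw [abs_of_pos hw0]; refine hwz.trans_lt ?_; rw [inv_lt_comm₀ hzpos hδ]; linarith
  have hwδ' : |w| < δ' := by
    rw [abs_of_pos hw0]; refine hwz.trans_lt ?_; rw [inv_lt_comm₀ hzpos hδ']; linarith
  have hs1 := neg_abs_le s
  have hs2 := le_abs_self s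
  have g1 := Real.Gamma_pos_of_pos (show 0 < z + (1 + s) / 2 by linarith)
  have g2 := Real.Gamma_pos_of_pos (show 0 < z + (1 - s) / 2 by linarith)
  set R := logGammaRatio s z - ∑ k ∈ Finset.range m, b k * w ^ (k + 1) with hR
  have hRb : |R| ≤ C * w ^ (m + 1) := h z (by linarith)
  have hRC : |R| ≤ C := hRb.trans (mul_le_of_le_one_right hC (pow_le_one₀ hw0.le hw1))
  have hexp : Real.Gamma (z + (1 + s) / 2) / Real.Gamma (z + (1 - s) / 2) * z ^ (-s) =
      Real.exp (∑ k ∈ Finset.range m, b k * w ^ (k + 1)) * Real.exp R := by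
    rw [← Real.exp_add, hR, add_sub_cancel, logGammaRatio, Real.exp_sub, Real.exp_sub,
      Real.exp_log g1, Real.exp_log g2, Real.rpow_neg hzpos.le, Real.rpow_def_of_pos hzpos,
      mul_comm s, div_eq_mul_inv _ (Real.exp _)]
  have hexpR : |Real.exp R - 1| ≤ C * Real.exp C * w ^ m := by
    have h1 : |Real.exp R - 1| ≤ |R| * Real.exp |R| := by
      rcases le_total 0 R with h0 | h0
      · have h1 := Real.add_one_le_exp (-R)
        have h2 : Real.exp R * Real.exp (-R) = 1 := by rw [← Real.exp_add]; simp
        rw [abs_of_nonneg h0, abs_of_nonneg (by linarith [Real.add_one_le_exp R])]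
        nlinarith [Real.exp_pos R]
      · have h1 := Real.add_one_le_exp R
        have h2 : Real.exp R ≤ 1 := Real.exp_le_one_iff.2 h0
        have h3 : 1 ≤ Real.exp |R| := Real.one_le_exp (abs_nonneg R)
        have h4 : |R| = -R := abs_of_nonpos h0
        rw [abs_of_nonpos (by linarith)]
        nlinarith [abs_nonneg R]
    calc |Real.exp R - 1| ≤ |R| * Real.exp |R| := h1
      _ ≤ (C * w ^ (m + 1)) * Real.exp C := by gcongr
      _ ≤ (C * w ^ m) * Real.exp C := by
        gcongr ?_ * _
        exact mul_le_mul_of_nonneg_left (pow_le_pow_of_le_one hw0.le hw1 m.le_succ) hC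
      _ = _ := by ring
  have e1 := e w
  have b1 := hb w hwδ
  have b2 := hb' w hwδ'
  rw [hexp]
  set X := Real.exp (∑ k ∈ Finset.range m, b k * w ^ (k + 1))
  set S' := ∑ k ∈ Finset.range m, β k * w ^ k
  have : X * Real.exp R - S' = w ^ m * g w + X * (Real.exp R - 1) := by rw [mul_sub]; linarith
  rw [this]
  calc |w ^ m * g w + X * (Real.exp R - 1)| ≤ |w ^ m * g w| + |X * (Real.exp R - 1)| := abs_add_le _ _
    _ ≤ w ^ m * M + M' * (C * Real.exp C * w ^ m) := by
      rw [abs_mul, abs_mul, abs_of_nonneg (by positivity : 0 ≤ w ^ m)]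
      gcongr
    _ = _ := by ring

theorem expandsTo_gammaRatio (s : ℝ) {ε z : ℕ → ℝ} {κ : ℝ} (hκ : κ ≠ 0) (hz : ∀ n, 0 < z n)
    (hlim : Filter.Tendsto z Filter.atTop Filter.atTop) (hε : ∀ n, ε n = κ * (z n ^ 2)⁻¹) (m : ℕ) :
    ExpandsTo ε m fun n _ =>
      Real.Gamma (z n + (1 + s) / 2) / Real.Gamma (z n + (1 - s) / 2) * z n ^ (-s) := by
  obtain ⟨b, C, z₀, -, h⟩ := gammaRatio_asymp s m
  set A : ℕ → ℝ := fun n =>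
      Real.Gamma (z n + (1 + s) / 2) / Real.Gamma (z n + (1 - s) / 2) * z n ^ (-s)
  have hε0 : ∀ n, ε n ≠ 0 := fun n => by
    rw [hε]; exact mul_ne_zero hκ (inv_ne_zero (pow_ne_zero _ (hz n).ne'))
  let R : ℕ → ℝ := fun n => (A n - ∑ k ∈ Finset.range m, (b k / κ ^ k) * ε n ^ k) / ε n ^ m
  have ev : ∀ᶠ n in Filter.atTop, |R n| ≤ C / |κ| ^ m := by
    filter_upwards [hlim.eventually_ge_atTop z₀] with n hn
    have := h _ hn
    have hs : ∑ k ∈ Finset.range m, (b k / κ ^ k) * ε n ^ k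
        = ∑ k ∈ Finset.range m, b k * ((z n ^ 2)⁻¹) ^ k := by
      refine Finset.sum_congr rfl fun k _ => ?_
      rw [hε, mul_pow]; field_simp
    simp only [R]
    rw [abs_div, hs, hε, abs_pow, abs_mul, mul_pow]
    have hw : 0 < (z n ^ 2)⁻¹ := inv_pos.2 (pow_pos (hz n) 2)
    rw [abs_of_pos hw, div_le_div_iff₀ (by positivity) (by positivity)]
    calc _ ≤ C * ((z n ^ 2)⁻¹) ^ m * |κ| ^ m := by gcongr
      _ = _ := by ring
  -- The asymptotic bound holds only for large n; the finitely many other indices enlarge the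
  -- constant.
  obtain ⟨C', hC'⟩ : ∃ C', ∀ n, |R n| ≤ C' := by
    obtain ⟨n₀, hn₀⟩ := Filter.eventually_atTop.1 ev
    refine ⟨C / |κ| ^ m + ∑ i ∈ Finset.range n₀, |R i|, fun n => ?_⟩
    have hnn : 0 ≤ C / |κ| ^ m := (abs_nonneg _).trans (hn₀ n₀ le_rfl)
    rcases lt_or_ge n n₀ with hn | hn
    · have := Finset.single_le_sum (f := fun i => |R i|) (fun i _ => abs_nonneg _)
        (Finset.mem_range.2 hn)
      linarith
    · have : 0 ≤ ∑ i ∈ Finset.range n₀, |R i| := Finset.sum_nonneg fun i _ => abs_nonneg _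
      linarith [hn₀ n hn]
  refine ExpandsTo.of_scalar_sum (R := R) (fun k => b k / κ ^ k) hC' fun n => ?_
  simp only [R]
  rw [mul_div_cancel₀ _ (pow_ne_zero _ (hε0 n))]
  ring

/-! ### Laguerre polynomials with parameter a > -2. -/

section
open Polynomial

/-- The Laguerre polynomials `L_k^{(a)}`. -/
noncomputable def lag (a : ℝ) : ℕ → ℝ[X]
  | 0 => 1
  | 1 => C (a + 1) - X
  | k + 2 => C (1 / ((k : ℝ) + 2)) *
      ((C (2 * (k : ℝ) + 3 + a) - X) * lag a (k + 1) - C ((k : ℝ) + 1 + a) * lag a k)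

/-- The squared norm of `L_k^{(a)}` with respect to `x ^ a * exp (-x)`. -/
noncomputable def lagNorm (a : ℝ) (k : ℕ) : ℝ := Real.Gamma (k + a + 1) / k.factorial

section Algebra
variable (a : ℝ)

theorem lag_zero : lag a 0 = 1 := by rw [lag]

theorem lag_one : lag a 1 = C (a + 1) - X := by rw [lag]

theorem lag_add_two (k : ℕ) : lag a (k + 2) = C (1 / ((k : ℝ) + 2)) *
      ((C (2 * (k : ℝ) + 3 + a) - X) * lag a (k + 1) - C ((k : ℝ) + 1 + a) * lag a k) := by
  rw [lag]

theorem lag_eval_rec (k : ℕ) (x : ℝ) : ((k : ℝ) + 2) * (lag a (k + 2)).eval x =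
    (2 * k + 3 + a - x) * (lag a (k + 1)).eval x - (k + 1 + a) * (lag a k).eval x := by
  rw [lag_add_two]
  have : (k : ℝ) + 2 ≠ 0 := by positivity
  simp only [eval_mul, eval_C, eval_sub, eval_X]
  field_simp

theorem lag_deriv_rec (k : ℕ) (x : ℝ) : ((k : ℝ) + 2) * (lag a (k + 2)).derivative.eval x =
    (2 * k + 3 + a - x) * (lag a (k + 1)).derivative.eval x - (lag a (k + 1)).eval x
      - (k + 1 + a) * (lag a k).derivative.eval x := by
  rw [lag_add_two]
  have : (k : ℝ) + 2 ≠ 0 := by positivity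
  simp only [derivative_mul, derivative_C, derivative_sub, derivative_X, eval_mul, eval_C, eval_sub,
    eval_X, eval_add, zero_mul, zero_add, zero_sub, eval_neg, eval_one]
  field_simp
  ring

theorem lag_eq_sub (k : ℕ) (x : ℝ) : (lag a (k + 1)).eval x =
    (lag (a + 1) (k + 1)).eval x - (lag (a + 1) k).eval x := by
  induction k using Nat.twoStepInduction with
  | zero => simp [lag_zero, lag_one]; ring
  | one =>
    have h1 := lag_eval_rec a 0 x
    have h2 := lag_eval_rec (a + 1) 0 x
    simp [lag_zero, lag_one] at *
    linarith
  | more k h0 h1 =>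
    have e1 := lag_eval_rec a (k + 1) x
    have e2 := lag_eval_rec (a + 1) (k + 1) x
    have e3 := lag_eval_rec (a + 1) k x
    push_cast at *
    have : (k : ℝ) + 1 + 2 ≠ 0 := by positivity
    apply mul_left_cancel₀ this
    rw [h0, h1] at e1
    linear_combination e1 - e2 + e3

theorem lag_deriv (k : ℕ) (x : ℝ) : (lag a (k + 1)).derivative.eval x =
    - (lag (a + 1) k).eval x := by
  induction k using Nat.twoStepInduction with
  | zero => simp [lag_zero, lag_one]
  | one =>
    have h1 := lag_deriv_rec a 0 x
    simp [lag_zero, lag_one] at *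
    linarith
  | more k h0 h1 =>
    have e1 := lag_deriv_rec a (k + 1) x
    have e2 := lag_eq_sub a (k + 1) x
    have e3 := lag_eval_rec (a + 1) k x
    push_cast at *
    have : (k : ℝ) + 1 + 2 ≠ 0 := by positivity
    apply mul_left_cancel₀ this
    rw [h0, h1, e2] at e1
    linear_combination e1 + e3

theorem lag_X_mul_deriv (k : ℕ) (x : ℝ) : x * (lag a (k + 1)).derivative.eval x =
    (k + 1) * (lag a (k + 1)).eval x - (k + 1 + a) * (lag a k).eval x := by
  induction k using Nat.twoStepInduction with
  | zero => simp [lag_zero, lag_one]; ring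
  | one =>
    have h1 := lag_deriv_rec a 0 x
    have h2 := lag_eval_rec a 0 x
    simp [lag_zero, lag_one] at *
    linear_combination x / 2 * h1 - h2
  | more k h0 h1 =>
    have e1 := lag_deriv_rec a (k + 1) x
    have e2 := lag_eval_rec a (k + 1) x
    have e3 := lag_eval_rec a k x
    push_cast at *
    have : (k : ℝ) + 1 + 2 ≠ 0 := by positivity
    apply mul_left_cancel₀ this
    linear_combination x * e1 - (k + 3) * e2 + (2 * k + 5 + a - x) * h1 - (k + 2 + a) * h0
      + (k + 2 + a) * e3

/-- The operator on the left is antisymmetric for the weight x^a e^(-x) when a > -1. It governs the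
norms, the skew orthogonal polynomials for β = 4 and the kernel for β = 1. -/
theorem lag_tridiag (k : ℕ) (x : ℝ) :
    2 * x * (lag a (k + 1)).derivative.eval x + (a + 1 - x) * (lag a (k + 1)).eval x =
      (k + 2) * (lag a (k + 2)).eval x - (k + 1 + a) * (lag a k).eval x := by
  linear_combination 2 * lag_X_mul_deriv a k x - lag_eval_rec a k x

theorem lag_ode (k : ℕ) (x : ℝ) : x * (lag a k).derivative.derivative.eval x
    + (a + 1 - x) * (lag a k).derivative.eval x + k * (lag a k).eval x = 0 := by
  rcases k with _ | _ | k
  · simp [lag_zero]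
  · simp [lag_one]
  · have hd : (lag a (k + 2)).derivative = - lag (a + 1) (k + 1) :=
      Polynomial.funext fun x => by rw [lag_deriv a (k + 1) x, eval_neg]
    rw [hd, derivative_neg, eval_neg, eval_neg, lag_eq_sub a (k + 1)]
    have e1 := lag_X_mul_deriv (a + 1) k x
    have e2 := lag_eval_rec (a + 1) k x
    push_cast
    linear_combination -e1 + e2

theorem lag_degree (k : ℕ) : (lag a k).degree = k := by
  induction k using Nat.twoStepInduction with
  | zero => simp [lag_zero]
  | one =>
    rw [lag_one, ← neg_sub, degree_neg, degree_X_sub_C]; rfl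
  | more k h0 h1 =>
    have hk : (1 : ℝ) / ((k : ℝ) + 2) ≠ 0 := by positivity
    rw [lag_add_two, degree_C_mul hk]
    have hd : ((C (2 * (k : ℝ) + 3 + a) - X) * lag a (k + 1)).degree = ((k + 2 : ℕ) : WithBot ℕ) := by
      rw [degree_mul, h1, ← neg_sub, degree_neg, degree_X_sub_C]
      norm_cast
      ring
    rw [degree_sub_eq_left_of_degree_lt, hd]
    rw [hd]
    refine ((degree_mul_le _ _).trans (add_le_add_left degree_C_le _)).trans_lt ?_
    rw [h0, zero_add]
    exact_mod_cast (by omega : k < k + 2)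

theorem lagNorm_succ (k : ℕ) (h : 0 < k + a + 1) :
    ((k : ℝ) + 1) * lagNorm a (k + 1) = (k + 1 + a) * lagNorm a k := by
  rw [lagNorm, lagNorm, Nat.factorial_succ]
  push_cast
  rw [show (k : ℝ) + 1 + a + 1 = (k + a + 1) + 1 by ring, Real.Gamma_add_one h.ne']
  have : (k.factorial : ℝ) ≠ 0 := by exact_mod_cast k.factorial_ne_zero
  field_simp
  ring

theorem lagNorm_pos (k : ℕ) (h : 0 < k + a + 1) : 0 < lagNorm a k :=
  div_pos (Real.Gamma_pos_of_pos h) (by exact_mod_cast k.factorial_pos)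

/-- The polynomials `π` of even degree `2 j` with `2 x π' + (a + 1 - x) π = 2 L_{2 j + 1}`. -/
noncomputable def lagPrim (a : ℝ) : ℕ → ℝ[X]
  | 0 => 2
  | j + 1 => C (1 / (2 * (j : ℝ) + 3)) *
      (C (2 * (j : ℝ) + 2 + a) * lagPrim a j + 2 * lag a (2 * j + 2))

theorem lagPrim_eval_succ (j : ℕ) (x : ℝ) : (2 * (j : ℝ) + 3) * (lagPrim a (j + 1)).eval x =
    (2 * j + 2 + a) * (lagPrim a j).eval x + 2 * (lag a (2 * j + 2)).eval x := by
  rw [lagPrim]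
  have : 2 * (j : ℝ) + 3 ≠ 0 := by positivity
  simp only [eval_mul, eval_C, eval_add, eval_ofNat]
  field_simp

theorem lagPrim_deriv_succ (j : ℕ) (x : ℝ) :
    (2 * (j : ℝ) + 3) * (lagPrim a (j + 1)).derivative.eval x =
    (2 * j + 2 + a) * (lagPrim a j).derivative.eval x + 2 * (lag a (2 * j + 2)).derivative.eval x := by
  rw [lagPrim]
  have : 2 * (j : ℝ) + 3 ≠ 0 := by positivity
  simp only [derivative_mul, derivative_C, derivative_add, derivative_ofNat, zero_mul, zero_add,
    eval_mul, eval_C, eval_add, eval_ofNat]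
  field_simp

theorem lagPrim_spec (j : ℕ) (x : ℝ) :
    2 * x * (lagPrim a j).derivative.eval x + (a + 1 - x) * (lagPrim a j).eval x =
      2 * (lag a (2 * j + 1)).eval x := by
  induction j with
  | zero => simp [lagPrim, lag_one]; ring
  | succ j ih =>
    have e1 := lagPrim_eval_succ a j x
    have e2 := lagPrim_deriv_succ a j x
    have e3 := lag_tridiag a (2 * j + 1) x
    have : 2 * (j : ℝ) + 3 ≠ 0 := by positivity
    apply mul_left_cancel₀ this
    rw [show 2 * (j + 1) + 1 = 2 * j + 1 + 2 by ring]
    push_cast at e3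
    rw [show 2 * j + 1 + 1 = 2 * j + 2 by ring] at e3
    linear_combination 2 * x * e2 + (a + 1 - x) * e1 + (2 * j + 2 + a) * ih + 2 * e3

theorem lagPrim_degree (j : ℕ) : (lagPrim a j).degree = (2 * j : ℕ) := by
  induction j with
  | zero => rw [lagPrim]; exact degree_C (R := ℝ) two_ne_zero
  | succ j ih =>
    have hk : (1 : ℝ) / (2 * (j : ℝ) + 3) ≠ 0 := by positivity
    rw [lagPrim, degree_C_mul hk]
    have hd : (2 * lag a (2 * j + 2)).degree = ((2 * (j + 1) : ℕ) : WithBot ℕ) := by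
      rw [show (2 : ℝ[X]) = C 2 from rfl, degree_C_mul two_ne_zero, lag_degree]; rfl
    rw [degree_add_eq_right_of_degree_lt, hd]
    rw [hd]
    refine ((degree_mul_le _ _).trans (add_le_add_left degree_C_le _)).trans_lt ?_
    rw [ih, zero_add]
    exact_mod_cast (by omega : 2 * j < 2 * (j + 1))

/-- The factor (a + 1)/Γ(a + 2) stands for 1/Γ(a + 1) and stays meaningful at a = -1. That value
must be allowed for β = 4, where only a > -2 is known, and there n = 0 fails because `lagNorm`
vanishes. -/
theorem lag_eval_zero (n : ℕ) (h : 1 ≤ n ∨ -1 < a) (h2 : -2 < a) :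
    (lag a n).eval 0 = (a + 1) * lagNorm a n / Real.Gamma (a + 2) := by
  have hG : Real.Gamma (a + 2) ≠ 0 := (Real.Gamma_pos_of_pos (by linarith)).ne'
  have h1 : (lag a 1).eval 0 = (a + 1) * lagNorm a 1 / Real.Gamma (a + 2) := by
    rw [lag_one, lagNorm]
    simp only [eval_sub, eval_C, eval_X, Nat.cast_one, Nat.factorial_one, div_one, sub_zero]
    rw [show 1 + a + 1 = a + 2 by ring]
    field_simp
  have hstep : ∀ n : ℕ, (lag a (n + 1)).eval 0 = (a + 1) * lagNorm a (n + 1) / Real.Gamma (a + 2) := by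
    intro n
    induction n with
    | zero => exact h1
    | succ n ih =>
      have e := lag_X_mul_deriv a (n + 1) 0
      have e2 := lagNorm_succ a (n + 1) (by push_cast; have := Nat.cast_nonneg (α := ℝ) n; linarith)
      have : ((n : ℝ) + 1) + 1 ≠ 0 := by positivity
      push_cast at e e2
      rw [zero_mul, ih] at e
      rw [eq_div_iff hG]
      apply mul_left_cancel₀ this
      field_simp at e
      linear_combination -e - (a + 1) * e2
  rcases n with _ | n
  · have ha : -1 < a := by rcases h with h | h; · omega
                           · exact h
    have : Real.Gamma (a + 2) = (a + 1) * Real.Gamma (a + 1) := by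
      rw [show a + 2 = (a + 1) + 1 by ring, Real.Gamma_add_one (by linarith)]
    rw [lag_zero, lagNorm]
    simp only [eval_one, Nat.cast_zero, Nat.factorial_zero, Nat.cast_one, div_one, zero_add]
    rw [← this, div_self hG]
  · exact hstep n

theorem lag_deriv_eval_zero (n : ℕ) (h2 : -2 < a) :
    (lag a n).derivative.eval 0 = - n * lagNorm a n / Real.Gamma (a + 2) := by
  rcases n with _ | n
  · simp [lag_zero]
  · rw [lag_deriv, lag_eval_zero (a + 1) n (Or.inr (by linarith)) (by linarith), lagNorm, lagNorm,
      Nat.factorial_succ]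
    have e : Real.Gamma (a + 1 + 2) = (a + 2) * Real.Gamma (a + 2) := by
      rw [show a + 1 + 2 = (a + 2) + 1 by ring, Real.Gamma_add_one (by linarith)]
    have hG : Real.Gamma (a + 2) ≠ 0 := (Real.Gamma_pos_of_pos (by linarith)).ne'
    have : (n.factorial : ℝ) ≠ 0 := by exact_mod_cast n.factorial_ne_zero
    have h3 : a + 2 ≠ 0 := by linarith
    rw [e]
    push_cast
    rw [show (n : ℝ) + (a + 1) + 1 = n + 1 + a + 1 by ring]
    field_simp
    ring

/-- Christoffel–Darboux on the diagonal. -/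
theorem sum_lag_sq (h2 : -2 < a) (n : ℕ) (x : ℝ) (hx : x ≠ 0) (h : 1 ≤ n ∨ -1 < a) :
    ∑ j ∈ Finset.range n, (lag a j).eval x ^ 2 / lagNorm a j =
      (x * (lag a n).derivative.eval x ^ 2
        + (a - x) * (lag a n).eval x * (lag a n).derivative.eval x
        + n * (lag a n).eval x ^ 2) / lagNorm a n := by
  have hG := (Real.Gamma_pos_of_pos (show 0 < a + 2 by linarith)).ne'
  have h1 : ∑ j ∈ Finset.range 1, (lag a j).eval x ^ 2 / lagNorm a j =
      (x * (lag a 1).derivative.eval x ^ 2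
        + (a - x) * (lag a 1).eval x * (lag a 1).derivative.eval x
        + (1 : ℕ) * (lag a 1).eval x ^ 2) / lagNorm a 1 := by
    -- At a = -1 both sides are 0, because `Real.Gamma` takes the value 0 at its poles and division
    -- by zero gives 0.
    have e : 1 / Real.Gamma (a + 1) = (a + 1) / Real.Gamma (a + 2) := by
      by_cases ha : a + 1 = 0
      · simp [ha]
      · rw [show a + 2 = (a + 1) + 1 by ring, Real.Gamma_add_one ha]
        by_cases hg : Real.Gamma (a + 1) = 0
        · simp [hg]
        · field_simp
    simp [lag_zero, lag_one, lagNorm]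
    rw [inv_eq_one_div, e, show 1 + a + 1 = a + 2 by ring]
    field_simp
    ring
  have hstep : ∀ n : ℕ, ∑ j ∈ Finset.range (n + 1), (lag a j).eval x ^ 2 / lagNorm a j =
      (x * (lag a (n + 1)).derivative.eval x ^ 2
        + (a - x) * (lag a (n + 1)).eval x * (lag a (n + 1)).derivative.eval x
        + (n + 1 : ℕ) * (lag a (n + 1)).eval x ^ 2) / lagNorm a (n + 1) := by
    intro n
    induction n with
    | zero => exact h1
    | succ n ih =>
      have hn := Nat.cast_nonneg (α := ℝ) n
      have p1 := lagNorm_pos a (n + 1) (by push_cast; linarith)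
      have p2 := lagNorm_pos a (n + 2) (by push_cast; linarith)
      have e2 := lagNorm_succ a (n + 1) (by push_cast; linarith)
      rw [Finset.sum_range_succ, ih, ← add_div]
      have d1 := lag_X_mul_deriv a n x
      have d2 := lag_X_mul_deriv a (n + 1) x
      have r := lag_eval_rec a n x
      push_cast at *
      set p := lagNorm a (n + 1)
      set q := lagNorm a (n + 1 + 1)
      set L0 := (lag a n).eval x
      set L1 := (lag a (n + 1)).eval x
      set L2 := (lag a (n + 1 + 1)).eval x
      set D1 := (lag a (n + 1)).derivative.eval x
      set D2 := (lag a (n + 1 + 1)).derivative.eval x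
      have ha2 : (n : ℝ) + 1 + 1 + a ≠ 0 := by linarith
      have hn2 : (n : ℝ) + 1 + 1 ≠ 0 := by positivity
      have hq : q = (n + 1 + 1 + a) * p / (n + 1 + 1) := by field_simp; linarith
      have hD1 : x * D1 = (n + 2) * L2 - (n + 2 + a - x) * L1 := by linear_combination d1 - r
      have hD2 : x * D2 = (n + 2) * L2 - (n + 2 + a) * L1 := by linear_combination d2
      -- Multiplication by x permits both derivatives to be expressed through L1 and L2, which
      -- leaves a polynomial identity.
      have key : (n + 1 + 1 + a) * (x * D1 ^ 2 + (a - x) * L1 * D1 + (n + 1) * L1 ^ 2 + L1 ^ 2) =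
          (n + 1 + 1) * (x * D2 ^ 2 + (a - x) * L2 * D2 + (n + 1 + 1) * L2 ^ 2) := by
        apply mul_left_cancel₀ hx
        rw [show x * ((n + 1 + 1 + a) * (x * D1 ^ 2 + (a - x) * L1 * D1 + (n + 1) * L1 ^ 2 + L1 ^ 2))
          = (n + 1 + 1 + a) * ((x * D1) ^ 2 + (a - x) * L1 * (x * D1) + x * ((n + 1) * L1 ^ 2 + L1 ^ 2))
          by ring, show x * ((n + 1 + 1) * (x * D2 ^ 2 + (a - x) * L2 * D2 + (n + 1 + 1) * L2 ^ 2))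
          = (n + 1 + 1) * ((x * D2) ^ 2 + (a - x) * L2 * (x * D2) + x * ((n + 1 + 1) * L2 ^ 2))
          by ring, hD1, hD2]
        ring
      rw [hq, div_eq_div_iff p1.ne' (div_ne_zero (mul_ne_zero ha2 p1.ne') hn2)]
      field_simp
      linear_combination key
  rcases n with _ | n
  · simp [lag_zero]
  · exact hstep n

theorem lagPrim_eval_zero (h2 : -2 < a) (j : ℕ) :
    (lagPrim a j).eval 0 = 2 * lagNorm a (2 * j + 1) / Real.Gamma (a + 2) := by
  have hG : Real.Gamma (a + 2) ≠ 0 := (Real.Gamma_pos_of_pos (by linarith)).ne'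
  induction j with
  | zero =>
    rw [lagPrim, lagNorm]
    simp [show 1 + a + 1 = a + 2 by ring, hG]
  | succ j ih =>
    have hj := Nat.cast_nonneg (α := ℝ) j
    have e := lagPrim_eval_succ a j 0
    have n1 := lagNorm_succ a (2 * j + 1) (by push_cast; linarith)
    have n2 := lagNorm_succ a (2 * j + 2) (by push_cast; linarith)
    rw [ih, lag_eval_zero a (2 * j + 2) (Or.inl (by omega)) h2] at e
    have : 2 * (j : ℝ) + 3 ≠ 0 := by positivity
    rw [eq_div_iff hG]
    apply mul_left_cancel₀ this
    rw [show 2 * (j + 1) + 1 = 2 * j + 2 + 1 by ring]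
    rw [show 2 * j + 1 + 1 = 2 * j + 2 by ring] at n1
    push_cast at *
    field_simp at e
    linear_combination e - 2 * n1 - 2 * n2

/-- Reduces the diagonal sum of the β = 4 kernel to a Christoffel–Darboux sum and one product. In
the induction `lagPrim_spec` removes the derivative of the new `lagPrim`, `lag_tridiag` that of
L_(2m+3), and the recursion for `lagPrim` moves the boundary term. -/
theorem sum_lagPrim (h2 : -2 < a) (m : ℕ) (x : ℝ) :
    x * ∑ j ∈ Finset.range (m + 1), ((lag a (2 * j + 1)).eval x * (lagPrim a j).derivative.eval x
      - (lagPrim a j).eval x * (lag a (2 * j + 1)).derivative.eval x) / lagNorm a (2 * j + 1) =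
    ∑ i ∈ Finset.range (2 * m + 2), (lag a i).eval x ^ 2 / lagNorm a i
      - (m + 1) / lagNorm a (2 * m + 1) * (lag a (2 * m + 2)).eval x * (lagPrim a m).eval x := by
  induction m with
  | zero =>
    have h1 : Real.Gamma (1 + a + 1) = Real.Gamma (a + 2) := by ring_nf
    have hG := (Real.Gamma_pos_of_pos (show 0 < a + 2 by linarith)).ne'
    have e : 1 / Real.Gamma (a + 1) = (a + 1) / Real.Gamma (a + 2) := by
      by_cases ha : a + 1 = 0
      · simp [ha]
      · rw [show a + 2 = (a + 1) + 1 by ring, Real.Gamma_add_one ha]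
        by_cases hg : Real.Gamma (a + 1) = 0
        · simp [hg]
        · field_simp
    have r := lag_eval_rec a 0 x
    simp [lag_zero, lag_one, lagPrim, lagNorm, Finset.sum_range_succ, h1] at r ⊢
    rw [inv_eq_one_div (Real.Gamma (a + 1)), e]
    field_simp
    linear_combination r
  | succ m ih =>
    have hm := Nat.cast_nonneg (α := ℝ) m
    have n1 := lagNorm_succ a (2 * m + 1) (by push_cast; linarith)
    have n2 := lagNorm_succ a (2 * m + 2) (by push_cast; linarith)
    have p1 := lagNorm_pos a (2 * m + 1) (by push_cast; linarith)
    have p2 := lagNorm_pos a (2 * m + 2) (by push_cast; linarith)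
    have p3 := lagNorm_pos a (2 * m + 3) (by push_cast; linarith)
    have t := lag_tridiag a (2 * m + 2) x
    have q := lagPrim_eval_succ a m x
    have sp := lagPrim_spec a (m + 1) x
    rw [Finset.sum_range_succ, mul_add, ih, show 2 * (m + 1) + 2 = 2 * m + 2 + 1 + 1 by ring,
      Finset.sum_range_succ _ (2 * m + 2 + 1), Finset.sum_range_succ _ (2 * m + 2)]
    rw [show 2 * (m + 1) + 1 = 2 * m + 3 by ring] at sp
    rw [show 2 * m + 2 + 1 = 2 * m + 3 by ring, show 2 * m + 2 + 2 = 2 * m + 4 by ring] at t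
    rw [show 2 * m + 1 + 1 = 2 * m + 2 by ring] at n1
    rw [show 2 * m + 2 + 1 = 2 * m + 3 by ring] at n2
    rw [show 2 * (m + 1) + 1 = 2 * m + 3 by ring, show 2 * m + 2 + 1 + 1 = 2 * m + 4 by ring,
      show 2 * m + 2 + 1 = 2 * m + 3 by ring]
    push_cast at *
    set h1 := lagNorm a (2 * m + 1)
    set h2' := lagNorm a (2 * m + 2)
    set h3 := lagNorm a (2 * m + 3)
    have c1 : (m + 1) / h1 = (2 * m + 2 + a) / (2 * h2') := by
      rw [div_eq_div_iff p1.ne' (by positivity)]; linear_combination n1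
    have c2 : 1 / h2' = (2 * m + 3 + a) / ((2 * m + 3) * h3) := by
      rw [div_eq_div_iff p2.ne' (by positivity)]; linear_combination n2
    have c3 : (m + 1) / h1 = (2 * m + 2 + a) / 2 * ((2 * m + 3 + a) / ((2 * m + 3) * h3)) := by
      rw [c1, ← c2]; field_simp
    have c4 : ∀ z, z / h2' = z * ((2 * m + 3 + a) / ((2 * m + 3) * h3)) := fun z => by
      rw [← c2]; ring
    rw [c3, c4]
    set L2 := (lag a (2 * m + 2)).eval x
    set L3 := (lag a (2 * m + 3)).eval x
    set L4 := (lag a (2 * m + 4)).eval x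
    set D3 := (lag a (2 * m + 3)).derivative.eval x
    set P := (lagPrim a m).eval x
    set Q := (lagPrim a (m + 1)).eval x
    set DQ := (lagPrim a (m + 1)).derivative.eval x
    have hP : (2 * m + 2 + a) * P = (2 * m + 3) * Q - 2 * L2 := by linear_combination -q
    have hP' : (2 * m + 2 + a) / 2 * ((2 * m + 3 + a) / ((2 * m + 3) * h3)) * L2 * P =
      (2 * m + 3 + a) / (2 * (2 * m + 3) * h3) * L2 * ((2 * m + 3) * Q - 2 * L2) := by
      rw [← hP]; field_simp
    rw [hP']
    field_simp
    linear_combination (2 * (m : ℝ) + 3) * (L3 * sp - Q * t)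

end Algebra

/-! ### Moments, orthogonality and norms. -/

section Moments
variable {α : ℝ}

/-- The integral of a polynomial against `x ^ α * exp (-x)`. -/
noncomputable def lagMoment (α : ℝ) (p : ℝ[X]) : ℝ :=
  ∫ x in Ioi (0 : ℝ), x ^ α * Real.exp (-x) * p.eval x

theorem lagMoment_integrable (hα : -1 < α) (p : ℝ[X]) :
    MeasureTheory.IntegrableOn (fun x => x ^ α * Real.exp (-x) * p.eval x) (Ioi 0) := by
  induction p using Polynomial.induction_on' with
  | add p q hp hq =>
    refine (hp.add hq).congr (Filter.Eventually.of_forall fun x => ?_)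
    simp [mul_add]
  | monomial k c =>
    have := (Real.GammaIntegral_convergent (s := α + k + 1)
      (by have := Nat.cast_nonneg (α := ℝ) k; linarith)).const_mul c
    refine MeasureTheory.IntegrableOn.congr_fun this (fun x hx => ?_) measurableSet_Ioi
    have hx : (0 : ℝ) < x := hx
    simp only [eval_monomial, add_sub_cancel_right, Real.rpow_add hx, Real.rpow_natCast]
    ring

theorem lagMoment_add (hα : -1 < α) (p q : ℝ[X]) :
    lagMoment α (p + q) = lagMoment α p + lagMoment α q := by
  simp only [lagMoment, eval_add, mul_add]
  exact MeasureTheory.integral_add (lagMoment_integrable hα p) (lagMoment_integrable hα q)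

theorem lagMoment_C_mul (c : ℝ) (p : ℝ[X]) : lagMoment α (C c * p) = c * lagMoment α p := by
  simp only [lagMoment, eval_mul, eval_C, ← MeasureTheory.integral_const_mul]
  congr 1; ext x; ring

theorem lagMoment_neg (p : ℝ[X]) : lagMoment α (-p) = - lagMoment α p := by
  simpa using lagMoment_C_mul (α := α) (-1) p

theorem lagMoment_sub (hα : -1 < α) (p q : ℝ[X]) :
    lagMoment α (p - q) = lagMoment α p - lagMoment α q := by
  rw [sub_eq_add_neg, lagMoment_add hα, lagMoment_neg, ← sub_eq_add_neg]

theorem lagMoment_zero : lagMoment α 0 = 0 := by simp [lagMoment]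

theorem lagMoment_sum (hα : -1 < α) {ι : Type*} (s : Finset ι) (f : ι → ℝ[X]) :
    lagMoment α (∑ i ∈ s, f i) = ∑ i ∈ s, lagMoment α (f i) := by
  classical
  induction s using Finset.induction_on with
  | empty => simp [lagMoment_zero]
  | insert i s hi ih => rw [Finset.sum_insert hi, Finset.sum_insert hi, lagMoment_add hα, ih]

theorem lagMoment_monomial (hα : -1 < α) (k : ℕ) (c : ℝ) :
    lagMoment α (monomial k c) = c * Real.Gamma (α + k + 1) := by
  rw [Real.Gamma_eq_integral (by have := Nat.cast_nonneg (α := ℝ) k; linarith), lagMoment,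
    ← MeasureTheory.integral_const_mul]
  refine MeasureTheory.setIntegral_congr_fun measurableSet_Ioi fun x hx => ?_
  have hx : (0 : ℝ) < x := hx
  simp only [eval_monomial, add_sub_cancel_right, Real.rpow_add hx, Real.rpow_natCast]
  ring

/-- Integration by parts. -/
theorem lagMoment_parts (hα : -1 < α) (p : ℝ[X]) :
    lagMoment α (X * derivative p + (C (α + 1) - X) * p) = 0 := by
  induction p using Polynomial.induction_on' with
  | add p q hp hq =>
    rw [derivative_add, show X * (derivative p + derivative q) + (C (α + 1) - X) * (p + q) =
      (X * derivative p + (C (α + 1) - X) * p) + (X * derivative q + (C (α + 1) - X) * q) by ring,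
      lagMoment_add hα, hp, hq, add_zero]
  | monomial k c =>
    have hk : α + k + 1 ≠ 0 := by have := Nat.cast_nonneg (α := ℝ) k; linarith
    have e : X * derivative (monomial k c) + (C (α + 1) - X) * monomial k c =
        monomial k ((α + k + 1) * c) - monomial (k + 1) c := by
      rw [derivative_monomial, sub_mul, X_mul_monomial, C_mul_monomial]
      rcases k with _ | k
      · simp [C_mul_X_eq_monomial]
      · rw [X_mul_monomial, Nat.add_sub_cancel, ← add_sub_assoc, ← map_add]
        push_cast
        ring_nf
    rw [e, lagMoment_sub hα, lagMoment_monomial hα, lagMoment_monomial hα]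
    push_cast
    rw [show α + ((k : ℝ) + 1) + 1 = (α + k + 1) + 1 by ring, Real.Gamma_add_one hk]
    ring

/-- By the differential equation and integration by parts, i ∫ L_i L_j = ∫ x L_i' L_j'; the right
side is symmetric in i and j. -/
theorem lagMoment_orthogonal (hα : -1 < α) {i j : ℕ} (hij : i ≠ j) :
    lagMoment α (lag α i * lag α j) = 0 := by
  have sym : ∀ i j : ℕ, (i : ℝ) * lagMoment α (lag α i * lag α j) =
      lagMoment α (X * derivative (lag α i) * derivative (lag α j)) := by
    intro i j
    have h := lagMoment_parts hα (derivative (lag α i) * lag α j)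
    have e : X * derivative (derivative (lag α i) * lag α j) + (C (α + 1) - X) *
        (derivative (lag α i) * lag α j) = X * derivative (lag α i) * derivative (lag α j)
          - C (i : ℝ) * (lag α i * lag α j) := by
      refine Polynomial.funext fun x => ?_
      have := lag_ode α i x
      simp only [derivative_mul, eval_mul, eval_add, eval_sub, eval_X, eval_C]
      linear_combination (lag α j).eval x * this
    rw [e, lagMoment_sub hα, lagMoment_C_mul] at h
    linarith
  have h1 := sym i j
  have h2 := sym j i
  rw [mul_comm (lag α j), show X * derivative (lag α j) * derivative (lag α i) =
    X * derivative (lag α i) * derivative (lag α j) by ring, ← h1] at h2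
  have : ((j : ℝ) - i) * lagMoment α (lag α i * lag α j) = 0 := by linarith
  rcases mul_eq_zero.1 this with h | h
  · exact absurd (by exact_mod_cast (sub_eq_zero.1 h).symm) hij
  · exact h

/-- The operator 2x d/dx + (α + 1 - x) is antisymmetric for the moment form. Comparing its
tridiagonal entries between degrees k and k + 1 gives the recursion of the norms. -/
theorem lagMoment_sq (hα : -1 < α) (k : ℕ) :
    lagMoment α (lag α k * lag α k) = lagNorm α k := by
  have hT : ∀ p q : ℝ[X], lagMoment α (q * (2 * X * derivative p + (C (α + 1) - X) * p)) =
      - lagMoment α (p * (2 * X * derivative q + (C (α + 1) - X) * q)) := by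
    intro p q
    have h := lagMoment_parts hα (p * q)
    have h2 : lagMoment α (C 2 * (X * derivative (p * q) + (C (α + 1) - X) * (p * q))) = 0 := by
      rw [lagMoment_C_mul, h, mul_zero]
    rw [show C (2 : ℝ) * (X * derivative (p * q) + (C (α + 1) - X) * (p * q)) =
      q * (2 * X * derivative p + (C (α + 1) - X) * p)
        + p * (2 * X * derivative q + (C (α + 1) - X) * q) by
      rw [derivative_mul, show (C (2 : ℝ) : ℝ[X]) = 2 from rfl]; ring, lagMoment_add hα] at h2
    linarith
  have tri : ∀ k : ℕ, 2 * X * derivative (lag α (k + 1)) + (C (α + 1) - X) * lag α (k + 1) =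
      C ((k : ℝ) + 2) * lag α (k + 2) - C ((k : ℝ) + 1 + α) * lag α k := fun k => by
    refine Polynomial.funext fun x => ?_
    have := lag_tridiag α k x
    simp only [eval_mul, eval_add, eval_sub, eval_X, eval_C, eval_ofNat]
    linear_combination this
  have tri0 : 2 * X * derivative (lag α 0) + (C (α + 1) - X) * lag α 0 = lag α 1 := by
    simp [lag_zero, lag_one]
  have h0 : lagMoment α (lag α 0 * lag α 0) = lagNorm α 0 := by
    have := lagMoment_monomial hα 0 1
    simpa [lag_zero, lagNorm, monomial_zero_left] using this
  induction k with
  | zero => exact h0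
  | succ k ih =>
    have hk : 0 < (k : ℝ) + α + 1 := by have := Nat.cast_nonneg (α := ℝ) k; linarith
    have hk1 : (k : ℝ) + 1 ≠ 0 := by positivity
    have e := lagNorm_succ α k hk
    apply mul_left_cancel₀ hk1
    rw [e, ← ih]
    have h := hT (lag α (k + 1)) (lag α k)
    rw [tri k, show lag α k * (C ((k : ℝ) + 2) * lag α (k + 2) - C ((k : ℝ) + 1 + α) * lag α k) =
      C ((k : ℝ) + 2) * (lag α k * lag α (k + 2)) - C ((k : ℝ) + 1 + α) * (lag α k * lag α k) by ring,
      lagMoment_sub hα, lagMoment_C_mul, lagMoment_C_mul, lagMoment_orthogonal hα (by omega)] at h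
    rcases k with _ | k
    · rw [tri0] at h
      push_cast at *
      linear_combination h
    · rw [tri k, show lag α (k + 1 + 1) * (C ((k : ℝ) + 2) * lag α (k + 2) -
        C ((k : ℝ) + 1 + α) * lag α k) = C ((k : ℝ) + 2) * (lag α (k + 2) * lag α (k + 2)) -
        C ((k : ℝ) + 1 + α) * (lag α (k + 2) * lag α k) by ring,
        lagMoment_sub hα, lagMoment_C_mul, lagMoment_C_mul, lagMoment_orthogonal hα (show k + 2 ≠ k by omega)] at h
      push_cast at *
      linear_combination h

end Moments

/-! ### Entire series with uniformly bounded coefficients. -/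

/-- `M` bounds the coefficients of entire power series. -/
def EntireBound (M : ℕ → ℝ) : Prop := ∀ R : ℝ, 0 ≤ R → Summable fun k => M k * R ^ k

namespace EntireBound
variable {M : ℕ → ℝ}

/-- The factor k + 1 is at most 2^(k+1), which a larger radius absorbs. -/
theorem derivative (hM : EntireBound M) (h0 : ∀ k, 0 ≤ M k) :
    EntireBound fun k => ((k : ℝ) + 1) * M (k + 1) := by
  intro R hR
  have h := (summable_nat_add_iff 1).2 (hM (2 * (R + 1)) (by positivity))
  refine Summable.of_nonneg_of_le (fun k => by have := h0 (k + 1); positivity) (fun k => ?_) h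
  have h1 : (k : ℝ) + 1 ≤ 2 ^ (k + 1) := by exact_mod_cast (Nat.lt_two_pow_self (n := k + 1)).le
  have h2 : R ^ k ≤ (R + 1) ^ (k + 1) :=
    (pow_le_pow_left₀ hR (by linarith) k).trans (pow_le_pow_right₀ (by linarith) (by omega))
  have := h0 (k + 1)
  rw [mul_pow]
  calc ((k : ℝ) + 1) * M (k + 1) * R ^ k ≤ 2 ^ (k + 1) * M (k + 1) * (R + 1) ^ (k + 1) := by gcongr
    _ = _ := by ring

theorem of_succ (h : EntireBound fun k => M (k + 1)) : EntireBound M := by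
  intro R hR
  refine (summable_nat_add_iff 1).1 (((h R hR).mul_right R).congr fun k => ?_)
  simp only [pow_succ]; ring

theorem add {M' : ℕ → ℝ} (hM : EntireBound M) (hM' : EntireBound M') :
    EntireBound fun k => M k + M' k := fun R hR =>
  ((hM R hR).add (hM' R hR)).congr fun k => by ring

theorem const_mul (hM : EntireBound M) (c : ℝ) : EntireBound fun k => c * M k := fun R hR =>
  ((hM R hR).mul_left c).congr fun k => by ring

theorem summable_abs (hM : EntireBound M) {q : ℕ → ℝ} (hq : ∀ k, |q k| ≤ M k) (y : ℝ) :
    Summable fun k => q k * y ^ k :=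
  Summable.of_norm_bounded (hM |y| (abs_nonneg y)) fun k => by
    rw [Real.norm_eq_abs, abs_mul, abs_pow]; gcongr; exact hq k

theorem hasDerivAt (hM : EntireBound M) {q : ℕ → ℝ} (hq : ∀ k, |q k| ≤ M k) (y : ℝ) :
    HasDerivAt (fun y => ∑' k, q k * y ^ k) (∑' k : ℕ, ((k : ℝ) + 1) * q (k + 1) * y ^ k) y := by
  have h0 : ∀ k, 0 ≤ M k := fun k => (abs_nonneg _).trans (hq k)
  set R : ℝ := |y| + 1
  have hR : 0 ≤ R := by positivity
  have hs : Summable fun k : ℕ => (k : ℝ) * M k * R ^ (k - 1) := by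
    refine (summable_nat_add_iff 1).1 ((hM.derivative h0 R hR).congr fun k => ?_)
    push_cast; simp
  have key := hasDerivAt_tsum_of_isPreconnected (𝕜 := ℝ) (g := fun k y => q k * y ^ k)
    (g' := fun (k : ℕ) y => (k : ℝ) * q k * y ^ (k - 1)) (y₀ := 0) (y := y) hs
    (Metric.isOpen_ball (x := (0 : ℝ)) (ε := R)) (convex_ball _ _).isPreconnected
    (fun k y _ => ((hasDerivAt_pow k y).const_mul (q k)).congr_deriv (by ring))
    (fun k y hy => by
      have hy : |y| ≤ R := by simpa using (Metric.mem_ball.1 hy).le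
      rw [Real.norm_eq_abs, abs_mul, abs_mul, abs_pow, Nat.abs_cast]
      have := h0 k
      gcongr
      exact hq k)
    (Metric.mem_ball_self (by positivity)) (hM.summable_abs hq 0)
    (by simp [R])
  refine key.congr_deriv ?_
  have hs' : Summable fun k : ℕ => (k : ℝ) * q k * y ^ (k - 1) := by
    refine Summable.of_norm_bounded hs fun k => ?_
    rw [Real.norm_eq_abs, abs_mul, abs_mul, abs_pow, Nat.abs_cast]
    have := h0 k
    gcongr
    · exact hq k
    · simp [R]
  rw [hs'.tsum_eq_zero_add]
  simp

theorem contDiff (hM : EntireBound M) {q : ℕ → ℝ} (hq : ∀ k, |q k| ≤ M k) :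
    ContDiff ℝ (⊤ : ℕ∞) fun y => ∑' k, q k * y ^ k := by
  refine contDiff_infty.2 fun m => ?_
  induction m generalizing M q with
  | zero =>
    exact contDiff_zero.2 (continuous_iff_continuousAt.2 fun y => (hM.hasDerivAt hq y).continuousAt)
  | succ m ih =>
    have h0 : ∀ k, 0 ≤ M k := fun k => (abs_nonneg _).trans (hq k)
    push_cast
    rw [contDiff_succ_iff_deriv]
    refine ⟨fun y => (hM.hasDerivAt hq y).differentiableAt, by simp, ?_⟩
    rw [show deriv (fun y => ∑' k, q k * y ^ k) = _ from funext fun y => (hM.hasDerivAt hq y).deriv]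
    refine ih (hM.derivative h0) (q := fun k => ((k : ℝ) + 1) * q (k + 1)) fun k => ?_
    rw [abs_mul, abs_of_pos (by positivity : (0 : ℝ) < k + 1)]
    gcongr
    exact hq _

/-- The constant depends only on the majorant M, which gives uniformity over a family of series. -/
theorem abs_iteratedDeriv_le (hM : EntireBound M) (R : ℝ) (m : ℕ) :
    ∃ C, ∀ q : ℕ → ℝ, (∀ k, |q k| ≤ M k) → ∀ y, |y| ≤ R →
      |iteratedDeriv m (fun y => ∑' k, q k * y ^ k) y| ≤ C := by
  by_cases h0 : ∀ k, 0 ≤ M k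
  swap
  · push Not at h0
    obtain ⟨k, hk⟩ := h0
    exact ⟨0, fun q hq => absurd ((abs_nonneg _).trans (hq k)) (not_le.2 hk)⟩
  induction m generalizing M with
  | zero =>
    refine ⟨∑' k, M k * |R| ^ k, fun q hq y hy => ?_⟩
    rw [iteratedDeriv_zero]
    refine (norm_tsum_le_tsum_norm (hM.summable_abs hq y).norm).trans
      ((hM.summable_abs hq y).norm.tsum_le_tsum (fun k => ?_) (hM _ (abs_nonneg R)))
    rw [Real.norm_eq_abs, abs_mul, abs_pow]
    have := h0 k
    have := hy.trans (le_abs_self R)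
    gcongr
    exact hq k
  | succ m ih =>
    obtain ⟨C, hC⟩ := ih (hM.derivative h0) fun k => by have := h0 (k + 1); positivity
    refine ⟨C, fun q hq y hy => ?_⟩
    rw [iteratedDeriv_succ', show deriv (fun y => ∑' k, q k * y ^ k) = _ from
      funext fun y => (hM.hasDerivAt hq y).deriv]
    refine hC (fun k => ((k : ℝ) + 1) * q (k + 1)) (fun k => ?_) y hy
    rw [abs_mul, abs_of_pos (by positivity : (0 : ℝ) < k + 1)]
    gcongr
    exact hq _

end EntireBound

theorem BoundedFamily.of_series {M : ℕ → ℝ} (hM : EntireBound M) {q : ℕ → ℕ → ℝ}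
    (hq : ∀ n k, |q n k| ≤ M k) : BoundedFamily fun n y => ∑' k, q n k * y ^ k := by
  refine ⟨fun n => (hM.contDiff (hq n)).contDiffOn, fun m K hK _ => ?_⟩
  obtain ⟨R, hR⟩ := hK.isBounded.exists_norm_le
  obtain ⟨C, hC⟩ := hM.abs_iteratedDeriv_le R m
  exact ⟨C, fun n y hy => hC (q n) (hq n) y (hR y hy)⟩

/-- The sum of the absolute values of the coefficients of `p`, weighted by the powers of `e`,
is at most `B`. -/
def PolyBound (e : ℝ) (p : ℝ[X]) (B : ℝ) : Prop :=
  ∀ N, ∑ i ∈ Finset.range N, |p.coeff i| * e ^ i ≤ B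

namespace PolyBound
variable {e B B' : ℝ} {p q : ℝ[X]}

theorem nonneg (h : PolyBound e p B) : 0 ≤ B := by simpa using h 0

theorem mono (h : PolyBound e p B) (hB : B ≤ B') : PolyBound e p B' := fun N => (h N).trans hB

theorem add (he : 0 ≤ e) (hp : PolyBound e p B) (hq : PolyBound e q B') :
    PolyBound e (p + q) (B + B') := fun N => by
  refine le_trans ?_ (add_le_add (hp N) (hq N))
  rw [← Finset.sum_add_distrib]
  refine Finset.sum_le_sum fun i _ => ?_
  rw [coeff_add, ← add_mul]
  gcongr
  exact abs_add_le _ _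

theorem C_mul (hp : PolyBound e p B) (c : ℝ) : PolyBound e (C c * p) (|c| * B) := fun N => by
  refine le_trans (le_of_eq ?_) (mul_le_mul_of_nonneg_left (hp N) (abs_nonneg c))
  rw [Finset.mul_sum]
  refine Finset.sum_congr rfl fun i _ => ?_
  rw [coeff_C_mul, abs_mul]; ring

theorem X_mul (he : 0 ≤ e) (hp : PolyBound e p B) : PolyBound e (X * p) (e * B) := fun N => by
  rcases N with _ | N
  · simpa using mul_nonneg he hp.nonneg
  rw [Finset.sum_range_succ']
  refine le_trans (le_of_eq ?_) (mul_le_mul_of_nonneg_left (hp N) he)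
  rw [Finset.mul_sum]
  simp only [coeff_X_mul, mul_coeff_zero, coeff_X_zero, zero_mul, abs_zero, add_zero]
  exact Finset.sum_congr rfl fun i _ => by ring

theorem one : PolyBound e 1 1 := fun N => by
  have : ∀ i, |(1 : ℝ[X]).coeff i| * e ^ i = if i = 0 then 1 else 0 := fun i => by
    rw [coeff_one]; split_ifs with h <;> simp [h]
  simp only [this]
  rw [Finset.sum_ite_eq']
  split_ifs <;> norm_num

theorem const (c : ℝ) : PolyBound e (C c) |c| := by
  simpa using one.C_mul c

theorem divX (he : 0 < e) (hp : PolyBound e p B) : PolyBound e p.divX (B / e) := fun N => by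
  rw [le_div_iff₀ he, Finset.sum_mul]
  refine le_trans ?_ (hp (N + 1))
  rw [Finset.sum_range_succ']
  refine le_trans (le_of_eq ?_) (le_add_of_nonneg_right (by positivity))
  exact Finset.sum_congr rfl fun i _ => by rw [coeff_divX]; ring

theorem abs_eval_le (hp : PolyBound e p B) {x : ℝ} (hx : |x| ≤ e) : |p.eval x| ≤ B := by
  rw [eval_eq_sum_range]
  refine (Finset.abs_sum_le_sum_abs _ _).trans (le_trans ?_ (hp (p.natDegree + 1)))
  refine Finset.sum_le_sum fun i _ => ?_
  rw [abs_mul, abs_pow]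
  gcongr

theorem abs_coeff_zero_le (hp : PolyBound e p B) : |p.coeff 0| ≤ B := by simpa using hp 1

end PolyBound

/-- Splitting p_k(ε) = p_k(0) + ε q_k(ε) separates the leading term, and the majorant of the q_k is
only divided by e. Hence the remainder is a series of the same kind. -/
theorem ExpandsTo.of_series {ε : ℕ → ℝ} {e : ℝ} (he : 0 < e) (hε : ∀ n, |ε n| ≤ e) {M : ℕ → ℝ}
    (hM : EntireBound M) {p : ℕ → ℝ[X]} (hp : ∀ k, PolyBound e (p k) (M k)) (m : ℕ) :
    ExpandsTo ε m fun n y => ∑' k, (p k).eval (ε n) * y ^ k := by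
  induction m generalizing M p with
  | zero => exact BoundedFamily.of_series hM fun n k => (hp k).abs_eval_le (hε n)
  | succ m ih =>
    have hM' : EntireBound fun k => M k / e := by
      simpa only [div_eq_inv_mul] using hM.const_mul e⁻¹
    refine ⟨fun y => ∑' k, (p k).coeff 0 * y ^ k, _,
      (hM.contDiff fun k => (hp k).abs_coeff_zero_le).contDiffOn,
      ih hM' fun k => (hp k).divX he, fun n y _ => ?_⟩
    dsimp only
    rw [← tsum_mul_left, ← (hM.summable_abs (fun k => (hp k).abs_coeff_zero_le) y).tsum_add
      ((hM'.summable_abs (fun k => ((hp k).divX he).abs_eval_le (hε n)) y).mul_left _)]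
    congr 1; ext k
    conv_lhs => rw [← divX_mul_X_add (p k)]
    simp only [eval_add, eval_mul, eval_X, eval_C]
    ring
-- The hard edge functions E and T as power series.
section EdgeSeries
variable (a : ℝ)

/-- The polynomials `b_k` such that `y ↦ ∑ b_k (ε) d_k y ^ k`, with `d_k = edgeScale a k`, solves
`y G'' + (a + 1) G' + (1 / 2 - ε y / 4) G = 0`. -/
noncomputable def edgePoly : ℕ → ℝ[X]
  | 0 => 1
  | 1 => C (-1 / 2)
  | k + 2 => C (-1 / 2) * edgePoly (k + 1) +
      C (((k : ℝ) + 1) * (k + 1 + a) / 4) * (X * edgePoly k)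

/-- The scaling factors `1 / (k! * Γ (k + a + 1))`. -/
noncomputable def edgeScale : ℕ → ℝ
  | 0 => (a + 1) / Real.Gamma (a + 2)
  | k + 1 => 1 / ((k + 1).factorial * Real.Gamma (k + a + 2))

/-- The coefficients of the hard edge series. -/
noncomputable def edgeCoeff (k : ℕ) : ℝ[X] := C (edgeScale a k) * edgePoly a k

/-- The coefficients of the solution of `y T' + (a + 1) / 2 * T = (1 - ε y) / 2 * G`, for the hard
edge series `G`. -/
noncomputable def edgePrimCoeff : ℕ → ℝ[X]
  | 0 => C (1 / Real.Gamma (a + 2))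
  | k + 1 => C (1 / (2 * ((k : ℝ) + 1) + a + 1)) * (edgeCoeff a (k + 1) + C (-1) * (X * edgeCoeff a k))

/-- The solution `E` of `E'' = ((a ^ 2 - 1) / (4 y ^ 2) - 1 / (2 y) + ε / 4) E` with leading term
`y ^ ((a + 1) / 2) / Γ (a + 1)` at `0`. -/
noncomputable def edgeFun (ε y : ℝ) : ℝ :=
  y ^ ((a + 1) / 2) * ∑' k, (edgeCoeff a k).eval ε * y ^ k

/-- The primitive of `(1 / (2 y) - ε / 2) * edgeFun a ε y` with exponent `(a + 1) / 2` at `0`. -/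
noncomputable def edgePrim (ε y : ℝ) : ℝ :=
  y ^ ((a + 1) / 2) * ∑' k, (edgePrimCoeff a k).eval ε * y ^ k

variable {a}

theorem edgeScale_succ (ha : -2 < a) (k : ℕ) :
    edgeScale a k = (k + 1) * (k + 1 + a) * edgeScale a (k + 1) := by
  have hG := (Real.Gamma_pos_of_pos (show 0 < a + 2 by linarith)).ne'
  rcases k with _ | k
  · simp [edgeScale]; field_simp; ring
  · have hk : 0 < (k : ℝ) + a + 2 := by have := Nat.cast_nonneg (α := ℝ) k; linarith
    have hf : ((k + 1).factorial : ℝ) ≠ 0 := by exact_mod_cast (k + 1).factorial_ne_zero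
    rw [edgeScale, edgeScale, Nat.factorial_succ (k + 1)]
    push_cast
    rw [show (k : ℝ) + 1 + a + 2 = (k + a + 2) + 1 by ring, Real.Gamma_add_one hk.ne']
    have h1 := (Real.Gamma_pos_of_pos hk).ne'
    have h2 := hk.ne'
    have h3 : (k : ℝ) + 1 + 1 ≠ 0 := by positivity
    field_simp
    ring

theorem edgeCoeff_rec (ha : -2 < a) (k : ℕ) (x : ℝ) :
    ((k : ℝ) + 2) * (k + 2 + a) * (edgeCoeff a (k + 2)).eval x =
      -1 / 2 * (edgeCoeff a (k + 1)).eval x + x / 4 * (edgeCoeff a k).eval x := by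
  have h1 := edgeScale_succ ha k
  have h2 := edgeScale_succ ha (k + 1)
  simp only [edgeCoeff, eval_mul, eval_C]
  rw [h1, h2, edgePoly]
  push_cast
  simp only [eval_mul, eval_C, eval_add, eval_X]
  ring

theorem edgePrimCoeff_rec (ha : -2 < a) (k : ℕ) (x : ℝ) :
    (2 * ((k : ℝ) + 1) + a + 1) * (edgePrimCoeff a (k + 1)).eval x =
      (edgeCoeff a (k + 1)).eval x - x * (edgeCoeff a k).eval x := by
  have hk : 2 * ((k : ℝ) + 1) + a + 1 ≠ 0 := by have := Nat.cast_nonneg (α := ℝ) k; linarith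
  simp only [edgePrimCoeff, eval_mul, eval_C, eval_add, eval_X]
  field_simp
  ring

variable (a) in
/-- Bounds for the coefficients of the hard edge series. -/
noncomputable def edgeBound (e : ℝ) (k : ℕ) : ℝ :=
  |edgeScale a k| * ((1 + e * (1 + |a|)) ^ k * k.factorial)

/-- The recursion for `edgePoly` has coefficients of order k², hence growth k! D^k; the base D = 1 +
e(1 + |a|) dominates both of its terms. The factor k! is cancelled by `edgeScale`. -/
theorem polyBound_edgePoly {e : ℝ} (he : 0 ≤ e) (k : ℕ) :
    PolyBound e (edgePoly a k) ((1 + e * (1 + |a|)) ^ k * k.factorial) := by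
  set D := 1 + e * (1 + |a|) with hD
  have hD1 : 1 ≤ D := by have : 0 ≤ e * (1 + |a|) := by positivity
                         linarith
  induction k using Nat.twoStepInduction with
  | zero => simpa [edgePoly] using PolyBound.one
  | one =>
    refine (PolyBound.const (-1 / 2)).mono ?_
    rw [abs_of_neg (by norm_num)]; simp; linarith
  | more k h0 h1 =>
    rw [edgePoly]
    refine ((h1.C_mul (-1 / 2)).add he ((h0.X_mul he).C_mul _)).mono ?_
    have hk := Nat.cast_nonneg (α := ℝ) k
    have e1 : |((k : ℝ) + 1) * (k + 1 + a) / 4| ≤ (k + 1) * ((k + 2) * (1 + |a|)) / 4 := by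
      rw [abs_div, abs_mul, abs_of_nonneg (by positivity : (0 : ℝ) ≤ k + 1),
        abs_of_pos (by norm_num : (0 : ℝ) < 4)]
      have : |(k : ℝ) + 1 + a| ≤ (k + 2) * (1 + |a|) := by
        refine (abs_add_le _ _).trans ?_
        rw [abs_of_nonneg (by positivity : (0 : ℝ) ≤ k + 1)]
        nlinarith [abs_nonneg a]
      gcongr
    have e2 : |(-1 / 2 : ℝ)| = 1 / 2 := by rw [abs_of_neg (by norm_num)]; norm_num
    rw [e2]
    have hf : (0 : ℝ) < k.factorial := by exact_mod_cast k.factorial_pos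
    have f1 : (((k + 1).factorial : ℕ) : ℝ) = (k + 1) * k.factorial := by
      rw [Nat.factorial_succ]; push_cast; ring
    have f2 : (((k + 2).factorial : ℕ) : ℝ) = (k + 2) * ((k + 1) * k.factorial) := by
      rw [Nat.factorial_succ, Nat.factorial_succ]; push_cast; ring
    rw [f1, f2]
    have hDk : 0 < D ^ k := by positivity
    have s1 : 1 / 2 * (D ^ (k + 1) * ((k + 1) * k.factorial)) ≤
        1 / 2 * (D ^ (k + 2) * ((k + 2) * ((k + 1) * k.factorial))) := by
      have i1 : D ^ (k + 1) ≤ D ^ (k + 2) := pow_le_pow_right₀ hD1 (by omega)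
      have i2 : (k + 1) * (k.factorial : ℝ) ≤ (k + 2) * ((k + 1) * k.factorial) := by
        nlinarith [mul_nonneg hk hf.le, mul_nonneg hk (mul_nonneg hk hf.le)]
      gcongr
    have s2 : |((k : ℝ) + 1) * (k + 1 + a) / 4| * (e * (D ^ k * k.factorial)) ≤
        1 / 2 * (D ^ (k + 2) * ((k + 2) * ((k + 1) * k.factorial))) := by
      calc _ ≤ (k + 1) * ((k + 2) * (1 + |a|)) / 4 * (e * (D ^ k * k.factorial)) := by gcongr
        _ = (e * (1 + |a|)) * (D ^ k * ((k + 2) * ((k + 1) * k.factorial))) / 4 := by ring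
        _ ≤ (D * D) * (D ^ k * ((k + 2) * ((k + 1) * k.factorial))) / 4 := by
          have : e * (1 + |a|) ≤ D * D := by nlinarith
          exact div_le_div_of_nonneg_right (mul_le_mul_of_nonneg_right this (by positivity))
            (by norm_num)
        _ ≤ _ := by
          have : 0 ≤ (D * D) * (D ^ k * ((k + 2) * ((k + 1) * k.factorial))) := by positivity
          rw [pow_add]; nlinarith
    linarith

theorem polyBound_edgeCoeff {e : ℝ} (he : 0 ≤ e) (k : ℕ) :
    PolyBound e (edgeCoeff a k) (edgeBound a e k) :=
  (polyBound_edgePoly he k).C_mul _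

theorem entireBound_edgeBound (ha : -2 < a) {e : ℝ} (he : 0 ≤ e) :
    EntireBound (edgeBound a e) := by
  -- The index 0 is dropped because only the later scaling factors have the form 1/(k! Γ(k + a + 1))
  -- with a positive Gamma value.
  refine EntireBound.of_succ fun R hR => ?_
  obtain ⟨D, hD⟩ : ∃ D, D = 1 + e * (1 + |a|) := ⟨_, rfl⟩
  have hD1 : 0 < D := by rw [hD]; positivity
  have hpos : ∀ k : ℕ, 0 < (k : ℝ) + a + 2 := fun k => by
    have := Nat.cast_nonneg (α := ℝ) k; linarith
  have hf : ∀ k : ℕ, edgeBound a e (k + 1) * R ^ k = D * ((D * R) ^ k / Real.Gamma (k + a + 2)) :=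
    fun k => by
    have h1 : (0 : ℝ) < (k + 1).factorial := by exact_mod_cast (k + 1).factorial_pos
    have h2 := Real.Gamma_pos_of_pos (hpos k)
    rw [edgeBound, edgeScale, abs_of_pos (by positivity), pow_succ, mul_pow, ← hD]
    field_simp
  simp only [hf]
  refine Summable.mul_left _ ?_
  rcases hR.eq_or_lt with rfl | hR
  · refine summable_of_ne_finset_zero (s := {0}) fun k hk => ?_
    have : k ≠ 0 := by simpa using hk
    simp [this]
  have hG := fun k => Real.Gamma_pos_of_pos (hpos k)
  have hne : ∀ k : ℕ, (D * R) ^ k / Real.Gamma (k + a + 2) ≠ 0 := fun k =>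
    (div_pos (by positivity) (hG k)).ne'
  refine summable_of_ratio_test_tendsto_lt_one (l := 0) zero_lt_one
    (Filter.Eventually.of_forall hne) ?_
  have hr : ∀ k : ℕ, ‖(D * R) ^ (k + 1) / Real.Gamma ((k + 1 : ℕ) + a + 2)‖ /
      ‖(D * R) ^ k / Real.Gamma (k + a + 2)‖ = D * R / (k + (a + 2)) := fun k => by
    have h1 := hG k
    have h2 := hG (k + 1)
    have h3 := hpos k
    have h3' : 0 < (k : ℝ) + (a + 2) := by linarith
    rw [Real.norm_of_nonneg (by positivity), Real.norm_of_nonneg (by positivity)]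
    push_cast
    rw [show (k : ℝ) + 1 + a + 2 = (k + a + 2) + 1 by ring, Real.Gamma_add_one h3.ne', pow_succ]
    have : (0 : ℝ) < (D * R) ^ k := by positivity
    rw [show (k : ℝ) + (a + 2) = k + a + 2 by ring]
    field_simp
  simp only [hr]
  exact tendsto_const_nhds.div_atTop
    (Filter.tendsto_atTop_add_const_right _ _ tendsto_natCast_atTop_atTop)

variable (a) in
/-- Bounds for the coefficients of the primitive of the hard edge series. -/
noncomputable def edgePrimBound (e : ℝ) : ℕ → ℝ
  | 0 => |1 / Real.Gamma (a + 2)|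
  | k + 1 => edgeBound a e (k + 1) + e * edgeBound a e k

theorem edgeBound_nonneg {e : ℝ} (he : 0 ≤ e) (k : ℕ) : 0 ≤ edgeBound a e k := by
  rw [edgeBound]; positivity

theorem polyBound_edgePrimCoeff (ha : -2 < a) {e : ℝ} (he : 0 ≤ e) (k : ℕ) :
    PolyBound e (edgePrimCoeff a k) (edgePrimBound a e k) := by
  rcases k with _ | k
  · exact PolyBound.const _
  -- For a > -2 the divisor exceeds 1, so dividing by it does not enlarge the bound.
  · have hk : 1 ≤ 2 * ((k : ℝ) + 1) + a + 1 := by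
      have := Nat.cast_nonneg (α := ℝ) k; linarith
    have h := (polyBound_edgeCoeff (a := a) he (k + 1)).add he
      (((polyBound_edgeCoeff (a := a) he k).X_mul he).C_mul (-1))
    refine (h.C_mul (1 / (2 * ((k : ℝ) + 1) + a + 1))).mono ?_
    rw [abs_neg, abs_one, one_mul, abs_of_pos (by positivity), edgePrimBound]
    have h0 := edgeBound_nonneg (a := a) he k
    have h1 := edgeBound_nonneg (a := a) he (k + 1)
    refine mul_le_of_le_one_left (by positivity) ?_
    rw [div_le_one (by linarith)]
    exact hk

theorem entireBound_edgePrimBound (ha : -2 < a) {e : ℝ} (he : 0 ≤ e) :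
    EntireBound (edgePrimBound a e) := by
  have h := entireBound_edgeBound ha he
  refine EntireBound.of_succ ?_
  simp only [edgePrimBound]
  refine EntireBound.add (fun R hR => ?_) (h.const_mul e)
  have := EntireBound.derivative h (edgeBound_nonneg he) R hR
  refine Summable.of_nonneg_of_le (fun k => ?_) (fun k => ?_) this
  · have := edgeBound_nonneg (a := a) he (k + 1); positivity
  · have h1 := edgeBound_nonneg (a := a) he (k + 1)
    have hk := Nat.cast_nonneg (α := ℝ) k
    gcongr
    nlinarith

theorem expandsTo_edgeFun (ha : -2 < a) {ε : ℕ → ℝ} {e : ℝ} (he : 0 < e) (hε : ∀ n, |ε n| ≤ e)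
    (m : ℕ) : ExpandsTo ε m fun n => edgeFun a (ε n) :=
  (ExpandsTo.of_smooth (f := fun y => y ^ ((a + 1) / 2))
    (fun _ hy => (Real.contDiffAt_rpow_const_of_ne (ne_of_gt hy)).contDiffWithinAt) m).mul hε
    (ExpandsTo.of_series he hε (entireBound_edgeBound ha he.le) (polyBound_edgeCoeff he.le) m)

theorem expandsTo_edgePrim (ha : -2 < a) {ε : ℕ → ℝ} {e : ℝ} (he : 0 < e) (hε : ∀ n, |ε n| ≤ e)
    (m : ℕ) : ExpandsTo ε m fun n => edgePrim a (ε n) :=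
  (ExpandsTo.of_smooth (f := fun y => y ^ ((a + 1) / 2))
    (fun _ hy => (Real.contDiffAt_rpow_const_of_ne (ne_of_gt hy)).contDiffWithinAt) m).mul hε
    (ExpandsTo.of_series he hε (entireBound_edgePrimBound ha he.le)
      (polyBound_edgePrimCoeff ha he.le) m)

theorem summable_edgeCoeff (ha : -2 < a) (ε y : ℝ) :
    Summable fun k => (edgeCoeff a k).eval ε * y ^ k :=
  (entireBound_edgeBound ha (abs_nonneg ε)).summable_abs
    (fun k => (polyBound_edgeCoeff (abs_nonneg ε) k).abs_eval_le le_rfl) y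

theorem summable_edgePrimCoeff (ha : -2 < a) (ε y : ℝ) :
    Summable fun k => (edgePrimCoeff a k).eval ε * y ^ k :=
  (entireBound_edgePrimBound ha (abs_nonneg ε)).summable_abs
    (fun k => (polyBound_edgePrimCoeff ha (abs_nonneg ε) k).abs_eval_le le_rfl) y

theorem hasDerivAt_edgePrimSeries (ha : -2 < a) (ε y : ℝ) :
    HasDerivAt (fun y => ∑' k, (edgePrimCoeff a k).eval ε * y ^ k)
      (∑' k : ℕ, ((k : ℝ) + 1) * (edgePrimCoeff a (k + 1)).eval ε * y ^ k) y :=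
  (entireBound_edgePrimBound ha (abs_nonneg ε)).hasDerivAt
    (fun k => (polyBound_edgePrimCoeff ha (abs_nonneg ε) k).abs_eval_le le_rfl) y

/-- Removing the factor y^((a+1)/2) from T' = (1/(2y) - ε/2) E leaves this equation, which
`edgePrimCoeff_rec` verifies coefficient by coefficient. -/
theorem edgePrimSeries_ode (ha : -2 < a) (ε y : ℝ) :
    2 * (y * ∑' k : ℕ, ((k : ℝ) + 1) * (edgePrimCoeff a (k + 1)).eval ε * y ^ k) +
      (a + 1) * ∑' k, (edgePrimCoeff a k).eval ε * y ^ k =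
      (1 - ε * y) * ∑' k, (edgeCoeff a k).eval ε * y ^ k := by
  have h1 := summable_edgeCoeff ha ε y
  have h2 := summable_edgePrimCoeff ha ε y
  have h1' := (summable_nat_add_iff 1).2 h1
  have h2' := (summable_nat_add_iff 1).2 h2
  -- For a = -1 both sides vanish and the recursion leaves the constant coefficient free; the value
  -- 1/Γ(a + 2) is the one that matches the Laguerre primitive.
  have h0 : (a + 1) * (edgePrimCoeff a 0).eval ε = (edgeCoeff a 0).eval ε := by
    simp [edgePrimCoeff, edgeCoeff, edgeScale, edgePoly]; ring
  have h3 : Summable fun k : ℕ => ((k : ℝ) + 1) * (edgePrimCoeff a (k + 1)).eval ε * y ^ k :=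
    ((entireBound_edgePrimBound ha (abs_nonneg ε)).derivative
      (fun k => (polyBound_edgePrimCoeff ha (abs_nonneg ε) k).nonneg)).summable_abs
      (q := fun k => ((k : ℝ) + 1) * (edgePrimCoeff a (k + 1)).eval ε) (fun k => by
        rw [abs_mul, abs_of_pos (by positivity : (0 : ℝ) < k + 1)]
        gcongr
        exact (polyBound_edgePrimCoeff ha (abs_nonneg ε) _).abs_eval_le le_rfl) y
  have key : 2 * y * ∑' k : ℕ, ((k : ℝ) + 1) * (edgePrimCoeff a (k + 1)).eval ε * y ^ k +
      (a + 1) * ∑' k : ℕ, (edgePrimCoeff a (k + 1)).eval ε * y ^ (k + 1) =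
      ∑' k : ℕ, (edgeCoeff a (k + 1)).eval ε * y ^ (k + 1) -
        ε * y * ∑' k, (edgeCoeff a k).eval ε * y ^ k := by
    rw [← tsum_mul_left, ← tsum_mul_left, ← tsum_mul_left,
      ← (h3.mul_left _).tsum_add (h2'.mul_left _), ← h1'.tsum_sub (h1.mul_left _)]
    congr 1; ext k
    have := edgePrimCoeff_rec ha k ε
    simp only [pow_succ]
    linear_combination y ^ k * y * this
  have e1 := h1.tsum_eq_zero_add
  have e2 := h2.tsum_eq_zero_add
  rw [pow_zero, mul_one] at e1 e2
  linear_combination key + (a + 1) * e2 - e1 + h0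

theorem hasDerivAt_edgePrim (ha : -2 < a) (ε : ℝ) {y : ℝ} (hy : 0 < y) :
    HasDerivAt (edgePrim a ε) ((1 / (2 * y) - ε / 2) * edgeFun a ε y) y := by
  have h := (Real.hasDerivAt_rpow_const (p := (a + 1) / 2) (Or.inl hy.ne')).fun_mul
    (hasDerivAt_edgePrimSeries ha ε y)
  refine h.congr_deriv ?_
  have := edgePrimSeries_ode ha ε y
  rw [edgeFun, Real.rpow_sub_one hy.ne']
  field_simp
  linear_combination this

end EdgeSeries

/-! ### Identification of E and T with Laguerre functions. -/

/-- The coefficients of the power series of `exp (- s / 2) * P s`. -/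
noncomputable def expCoeff (P : ℝ[X]) (k : ℕ) : ℝ :=
  PowerSeries.coeff k (PowerSeries.mk (fun k => (-1 / 2 : ℝ) ^ k / k.factorial) * (P : PowerSeries ℝ))

theorem expCoeff_add (P Q : ℝ[X]) (k : ℕ) : expCoeff (P + Q) k = expCoeff P k + expCoeff Q k := by
  simp [expCoeff, mul_add]

theorem expCoeff_C_mul (c : ℝ) (P : ℝ[X]) (k : ℕ) : expCoeff (C c * P) k = c * expCoeff P k := by
  simp only [expCoeff, coe_mul, coe_C, mul_left_comm _ (PowerSeries.C c), PowerSeries.coeff_C_mul]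

theorem expCoeff_sub (P Q : ℝ[X]) (k : ℕ) : expCoeff (P - Q) k = expCoeff P k - expCoeff Q k := by
  rw [sub_eq_add_neg, expCoeff_add, show -Q = C (-1) * Q by simp, expCoeff_C_mul]; ring

theorem expCoeff_X_mul_succ (P : ℝ[X]) (k : ℕ) : expCoeff (X * P) (k + 1) = expCoeff P k := by
  simp only [expCoeff, coe_mul, coe_X, mul_left_comm _ PowerSeries.X, PowerSeries.coeff_succ_X_mul]

theorem expCoeff_X_mul_zero (P : ℝ[X]) : expCoeff (X * P) 0 = 0 := by
  simp only [expCoeff, coe_mul, coe_X, mul_left_comm _ PowerSeries.X, PowerSeries.coeff_zero_X_mul]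

theorem expCoeff_zero (P : ℝ[X]) : expCoeff P 0 = P.eval 0 := by
  simp [expCoeff, coeff_zero_eq_eval_zero]

theorem expCoeff_derivative (P : ℝ[X]) (k : ℕ) :
    expCoeff (derivative P - C (1 / 2) * P) k = (k + 1) * expCoeff P (k + 1) := by
  set e : PowerSeries ℝ := PowerSeries.mk fun k => (-1 / 2 : ℝ) ^ k / k.factorial with he
  have de : PowerSeries.derivative ℝ e = PowerSeries.C (-1 / 2) * e := by
    ext k
    rw [PowerSeries.coeff_derivative, PowerSeries.coeff_C_mul, he, PowerSeries.coeff_mk,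
      PowerSeries.coeff_mk, Nat.factorial_succ, pow_succ]
    push_cast
    have : (k.factorial : ℝ) ≠ 0 := by exact_mod_cast k.factorial_ne_zero
    field_simp
  have h := PowerSeries.coeff_derivative (e * (P : PowerSeries ℝ)) k
  rw [Derivation.leibniz, de, PowerSeries.derivative_coe] at h
  rw [expCoeff, expCoeff, ← he, mul_comm ((k : ℝ) + 1), ← h, coe_sub, coe_mul, coe_C, smul_eq_mul,
    smul_eq_mul]
  congr 1
  rw [neg_div, map_neg]
  ring

theorem hasSum_expCoeff (P : ℝ[X]) (s : ℝ) :
    HasSum (fun k => expCoeff P k * s ^ k) (Real.exp (-(s / 2)) * P.eval s) := by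
  induction P using Polynomial.induction_on with
  | C c =>
    have h := (NormedSpace.expSeries_div_hasSum_exp (𝔸 := ℝ) (-(s / 2))).mul_left c
    rw [← Real.exp_eq_exp_ℝ] at h
    rw [eval_C, mul_comm]
    refine h.congr_fun ?_
    intro k
    rw [show C c = C c * 1 by simp, expCoeff_C_mul, expCoeff, coe_one, mul_one,
      PowerSeries.coeff_mk, show -(s / 2) = (-1 / 2) * s by ring, mul_pow]
    ring
  | add P Q hP hQ =>
    simpa only [expCoeff_add, add_mul, eval_add, mul_add] using hP.add hQ
  | monomial n c h =>
    rw [show C c * X ^ (n + 1) = X * (C c * X ^ n) by ring]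
    rw [← hasSum_nat_add_iff' 1]
    simp only [expCoeff_X_mul_succ, Finset.sum_range_one, expCoeff_X_mul_zero, zero_mul, sub_zero]
    have := h.mul_left s
    rw [eval_mul, eval_X]
    rw [mul_left_comm]
    refine this.congr_fun fun k => ?_
    ring

section EdgeFun
variable {a : ℝ}

theorem lag_param_pos {n : ℕ} (h : 1 ≤ n ∨ -1 < a) (h2 : -2 < a) : 0 < 2 * (n : ℝ) + a + 1 := by
  rcases h with h | h
  · have : (1 : ℝ) ≤ n := by exact_mod_cast h
    linarith
  · have := Nat.cast_nonneg (α := ℝ) n; linarith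

/-- After s = y/c with c = 2n + a + 1, the equation of e^(-s/2) L_n(s) is that of the hard edge
series at ε = c⁻². The coefficients thus satisfy the same recurrence, and the first two agree. -/
theorem expCoeff_lag {n : ℕ} (h : 1 ≤ n ∨ -1 < a) (h2 : -2 < a) {c : ℝ} (hc : c = 2 * n + a + 1)
    (k : ℕ) : expCoeff (lag a n) k =
      c ^ k * lagNorm a n * (edgeCoeff a k).eval (c ^ 2)⁻¹ := by
  have hc0 : c ≠ 0 := by rw [hc]; exact (lag_param_pos h h2).ne'
  have hG := (Real.Gamma_pos_of_pos (show 0 < a + 2 by linarith)).ne'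
  set L := lag a n
  set Q := derivative L - C (1 / 2) * L
  have hrec : ∀ k : ℕ, ((k : ℝ) + 2) * (k + 2 + a) * expCoeff L (k + 2) =
      -(c / 2) * expCoeff L (k + 1) + 1 / 4 * expCoeff L k := by
    intro k
    have e : X * (derivative Q - C (1 / 2) * Q) + C (a + 1) * Q + C (c / 2) * L
        - C (1 / 4) * (X * L) = 0 := by
      refine Polynomial.funext fun x => ?_
      have := lag_ode a n x
      simp only [Q, L, derivative_sub, derivative_mul, derivative_C, eval_add, eval_sub, eval_mul,
        eval_X, eval_C, eval_zero, hc, zero_mul, zero_add]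
      linear_combination this
    have e2 := congrArg (fun P => expCoeff P (k + 1)) e
    simp only [expCoeff_sub, expCoeff_add, expCoeff_C_mul, expCoeff_X_mul_succ] at e2
    have d1 := expCoeff_derivative Q k
    have d2 := expCoeff_derivative L (k + 1)
    have z : expCoeff (0 : ℝ[X]) (k + 1) = 0 := by simp [expCoeff]
    rw [expCoeff_sub, expCoeff_C_mul] at d1
    rw [show derivative L - C (1 / 2) * L = Q from rfl] at d2
    push_cast at d2
    rw [z] at e2
    linear_combination e2 - d1 - ((k : ℝ) + 1 + a + 1) * d2
  induction k using Nat.twoStepInduction with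
  | zero =>
    rw [expCoeff_zero, lag_eval_zero a n h h2, edgeCoeff, edgeScale, edgePoly]
    simp
    ring
  | one =>
    have := expCoeff_derivative L 0
    rw [expCoeff_sub, expCoeff_C_mul, expCoeff_zero, expCoeff_zero, lag_eval_zero a n h h2,
      lag_deriv_eval_zero a n h2] at this
    rw [edgeCoeff, edgeScale, edgePoly]
    simp at this ⊢
    rw [← this, hc]
    field_simp
    ring
  | more k h0 h1 =>
    have hk : ((k : ℝ) + 2) * (k + 2 + a) ≠ 0 := by
      have := Nat.cast_nonneg (α := ℝ) k
      have : 0 < (k : ℝ) + 2 + a := by linarith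
      positivity
    apply mul_left_cancel₀ hk
    rw [hrec, h0, h1]
    have := edgeCoeff_rec h2 k (c ^ 2)⁻¹
    have hc2 : c ^ 2 * (c ^ 2)⁻¹ = 1 := mul_inv_cancel₀ (pow_ne_zero 2 hc0)
    rw [pow_add c k 2, pow_succ c k]
    linear_combination -(c ^ k * c ^ 2 * lagNorm a n) * this
      - 1 / 4 * c ^ k * lagNorm a n * (edgeCoeff a k).eval (c ^ 2)⁻¹ * hc2

/-- The equation on P is the one for T with y = cx and ε = c⁻², where 1 - εy = (c - x)/c. The value
at 0 is prescribed separately since the equation does not fix it at a = -1. -/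
theorem expCoeff_lagPrim {n : ℕ} (h : 1 ≤ n ∨ -1 < a) (h2 : -2 < a) {c : ℝ}
    (hc : c = 2 * n + a + 1) {P : ℝ[X]} (hP : ∀ x, 2 * x * P.derivative.eval x +
      (a + 1 - x) * P.eval x = (c - x) * (lag a n).eval x)
    (hP0 : P.eval 0 = c * lagNorm a n / Real.Gamma (a + 2)) (k : ℕ) :
    expCoeff P k = c ^ (k + 1) * lagNorm a n * (edgePrimCoeff a k).eval (c ^ 2)⁻¹ := by
  have hc0 : c ≠ 0 := by rw [hc]; exact (lag_param_pos h h2).ne'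
  rcases k with _ | k
  · rw [expCoeff_zero, hP0, edgePrimCoeff, eval_C]; ring
  have e : C 2 * (X * (derivative P - C (1 / 2) * P)) + C (a + 1) * P - C c * lag a n
      + X * lag a n = 0 := by
    refine Polynomial.funext fun x => ?_
    have := hP x
    simp only [eval_add, eval_sub, eval_mul, eval_X, eval_C, eval_zero]
    linear_combination this
  have e2 := congrArg (fun P => expCoeff P (k + 1)) e
  have z : expCoeff (0 : ℝ[X]) (k + 1) = 0 := by simp [expCoeff]
  have d := expCoeff_derivative P k
  have r := edgePrimCoeff_rec h2 k (c ^ 2)⁻¹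
  simp only [expCoeff_sub, expCoeff_add, expCoeff_C_mul, expCoeff_X_mul_succ, z] at e2 d
  rw [expCoeff_lag h h2 hc, expCoeff_lag h h2 hc] at e2
  have hk : 2 * ((k : ℝ) + 1) + a + 1 ≠ 0 := by have := Nat.cast_nonneg (α := ℝ) k; linarith
  apply mul_left_cancel₀ hk
  have hc2 : c ^ 2 * (c ^ 2)⁻¹ = 1 := mul_inv_cancel₀ (pow_ne_zero 2 hc0)
  linear_combination e2 - 2 * d - (c ^ (k + 2) * lagNorm a n) * r
    + c ^ k * lagNorm a n * (edgeCoeff a k).eval (c ^ 2)⁻¹ * hc2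

theorem edgeFun_eq {n : ℕ} (h : 1 ≤ n ∨ -1 < a) (h2 : -2 < a) {c : ℝ} (hc : c = 2 * n + a + 1)
    (y : ℝ) : edgeFun a (c ^ 2)⁻¹ y =
      y ^ ((a + 1) / 2) * (Real.exp (-(y / c / 2)) * (lag a n).eval (y / c)) / lagNorm a n := by
  have hc0 : c ≠ 0 := by rw [hc]; exact (lag_param_pos h h2).ne'
  have hn : lagNorm a n ≠ 0 := (lagNorm_pos a n (by
    rcases h with h | h
    · have : (1 : ℝ) ≤ n := by exact_mod_cast h
      linarith
    · have := Nat.cast_nonneg (α := ℝ) n; linarith)).ne'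
  rw [edgeFun, ← (hasSum_expCoeff (lag a n) (y / c)).tsum_eq, mul_div_assoc, ← tsum_div_const]
  congr 2; ext k
  rw [expCoeff_lag h h2 hc, div_pow]
  field_simp

theorem edgePrim_eq {n : ℕ} (h : 1 ≤ n ∨ -1 < a) (h2 : -2 < a) {c : ℝ}
    (hc : c = 2 * n + a + 1) {P : ℝ[X]} (hP : ∀ x, 2 * x * P.derivative.eval x +
      (a + 1 - x) * P.eval x = (c - x) * (lag a n).eval x)
    (hP0 : P.eval 0 = c * lagNorm a n / Real.Gamma (a + 2)) (y : ℝ) :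
    edgePrim a (c ^ 2)⁻¹ y =
      y ^ ((a + 1) / 2) * (Real.exp (-(y / c / 2)) * P.eval (y / c)) / (c * lagNorm a n) := by
  have hc0 : c ≠ 0 := by rw [hc]; exact (lag_param_pos h h2).ne'
  have hn : lagNorm a n ≠ 0 := (lagNorm_pos a n (by
    rcases h with h | h
    · have : (1 : ℝ) ≤ n := by exact_mod_cast h
      linarith
    · have := Nat.cast_nonneg (α := ℝ) n; linarith)).ne'
  rw [edgePrim, ← (hasSum_expCoeff P (y / c)).tsum_eq, mul_div_assoc, ← tsum_div_const]
  congr 2; ext k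
  rw [expCoeff_lagPrim h h2 hc hP hP0, div_pow]
  field_simp
  ring

/-- The derivative of `edgeFun`, for the parameter attached to the Laguerre polynomial of
degree `n`. -/
noncomputable def edgeFunDeriv (a : ℝ) (n : ℕ) (c y : ℝ) : ℝ :=
  y ^ ((a + 1) / 2) * Real.exp (-(y / c / 2)) * (((a + 1) / (2 * y) - 1 / (2 * c)) *
    (lag a n).eval (y / c) + (lag a n).derivative.eval (y / c) / c) / lagNorm a n

theorem hasDerivAt_rpow_mul_exp_mul (c : ℝ) (P : ℝ[X]) {y : ℝ} (hy : 0 < y) :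
    HasDerivAt (fun y => y ^ ((a + 1) / 2) * (Real.exp (-(y / c / 2)) * P.eval (y / c)))
      (y ^ ((a + 1) / 2) * Real.exp (-(y / c / 2)) * (((a + 1) / (2 * y) - 1 / (2 * c)) *
        P.eval (y / c) + P.derivative.eval (y / c) / c)) y := by
  have h1 := Real.hasDerivAt_rpow_const (p := (a + 1) / 2) (Or.inl hy.ne')
  have h2 : HasDerivAt (fun y => Real.exp (-(y / c / 2))) (Real.exp (-(y / c / 2)) * (-(1 / c / 2))) y :=
    ((((hasDerivAt_id y).div_const c).div_const 2).neg).exp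
  have h3 : HasDerivAt (fun y => P.eval (y / c)) (P.derivative.eval (y / c) * (1 / c)) y :=
    HasDerivAt.comp (h₂ := fun x => P.eval x) y (P.hasDerivAt (y / c))
      ((hasDerivAt_id y).div_const c)
  refine (h1.fun_mul (h2.fun_mul h3)).congr_deriv ?_
  rw [Real.rpow_sub_one hy.ne']
  ring

theorem hasDerivAt_edgeFun {n : ℕ} (h : 1 ≤ n ∨ -1 < a) (h2 : -2 < a) {c : ℝ}
    (hc : c = 2 * n + a + 1) {y : ℝ} (hy : 0 < y) :
    HasDerivAt (edgeFun a (c ^ 2)⁻¹) (edgeFunDeriv a n c y) y := by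
  rw [show edgeFun a (c ^ 2)⁻¹ = _ from funext fun y => edgeFun_eq h h2 hc y]
  exact (hasDerivAt_rpow_mul_exp_mul c _ hy).div_const _

theorem hasDerivAt_edgeFunDeriv {n : ℕ} (h : 1 ≤ n ∨ -1 < a) (h2 : -2 < a) {c : ℝ}
    (hc : c = 2 * n + a + 1) {y : ℝ} (hy : 0 < y) :
    HasDerivAt (edgeFunDeriv a n c) (((a ^ 2 - 1) / (4 * y ^ 2) - 1 / (2 * y) + (c ^ 2)⁻¹ / 4) *
      edgeFun a (c ^ 2)⁻¹ y) y := by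
  have hc0 : c ≠ 0 := by rw [hc]; exact (lag_param_pos h h2).ne'
  set L := lag a n with hL
  have h1 := hasDerivAt_rpow_mul_exp_mul (a := a) c L hy
  have h3 := hasDerivAt_rpow_mul_exp_mul (a := a) c (derivative L) hy
  have h4 : HasDerivAt (fun y => (a + 1) / (2 * y) - 1 / (2 * c)) (-(a + 1) / (2 * y ^ 2)) y := by
    have := ((hasDerivAt_inv hy.ne').const_mul ((a + 1) / 2)).sub_const (1 / (2 * c))
    refine (this.congr_deriv ?_).congr_of_eventuallyEq ?_
    · field_simp
    · exact Filter.Eventually.of_forall fun y => by simp only; ring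
  have := ((h4.fun_mul h1).fun_add (h3.div_const c)).div_const (lagNorm a n)
  refine (this.congr_deriv ?_).congr_of_eventuallyEq ?_
  · rw [edgeFun_eq h h2 hc]
    have ode := lag_ode a n (y / c)
    rw [← hL] at ode ⊢
    set u := L.eval (y / c)
    set v := (derivative L).eval (y / c)
    set w := (derivative (derivative L)).eval (y / c)
    have hw : w = - ((a + 1 - y / c) * v + n * u) * c / y := by
      field_simp; field_simp at ode; linear_combination ode
    rw [hw]
    have hn : (n : ℝ) = (c - a - 1) / 2 := by rw [hc]; ring
    rw [hn]
    field_simp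
    ring
  · exact Filter.Eventually.of_forall fun y => by simp only [edgeFunDeriv]; ring

end EdgeFun

end

/-! ### Joint weights: symmetry, integrability and removal of one eigenvalue. -/

section
open Polynomial MeasureTheory

section JointWeight

theorem abs_prod_sub_pow_eq_det (β : ℕ) {n : ℕ} (x : Fin n → ℝ) :
    ∏ j, ∏ k ∈ Finset.Ioi j, |x k - x j| ^ β = |(Matrix.vandermonde x).det| ^ β := by
  simp only [Matrix.det_vandermonde, Finset.abs_prod, Finset.prod_pow]

theorem betaJointWeight_comp_perm (β : ℕ) (w : ℝ → ℝ) {n : ℕ} (x : Fin n → ℝ)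
    (σ : Equiv.Perm (Fin n)) : betaJointWeight β w (x ∘ σ) = betaJointWeight β w x := by
  rw [betaJointWeight, betaJointWeight, abs_prod_sub_pow_eq_det, abs_prod_sub_pow_eq_det,
    show Matrix.vandermonde (x ∘ σ) = (Matrix.vandermonde x).submatrix σ id from rfl,
    Matrix.det_permute, abs_mul]
  have : |(((Equiv.Perm.sign σ : ℤˣ) : ℤ) : ℝ)| = 1 := by
    rcases Int.units_eq_one_or (Equiv.Perm.sign σ) with h | h <;> simp [h]
  rw [this, one_mul]
  congr 1
  exact Equiv.prod_comp σ fun l => w (x l)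

theorem betaJointWeight_cons (β : ℕ) (w : ℝ → ℝ) {n : ℕ} (s : ℝ) (t : Fin n → ℝ) :
    betaJointWeight β w (Fin.cons s t : Fin (n + 1) → ℝ) =
      w s * (∏ i, |t i - s| ^ β) * betaJointWeight β w t := by
  simp only [betaJointWeight, Fin.prod_univ_succ, Fin.cons_zero, Fin.cons_succ,
    Fin.prod_Ioi_zero, Fin.prod_Ioi_succ]
  ring

/-- By symmetry any eigenvalue can be moved to the front and split off. Each node of an
interpolation formula thereby leaves a joint weight of one variable fewer. -/
theorem betaJointWeight_removeNth (β : ℕ) (w : ℝ → ℝ) {n : ℕ} (l : Fin (n + 1))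
    (z : Fin (n + 1) → ℝ) : betaJointWeight β w z =
      w (z l) * (∏ i, |l.removeNth z i - z l| ^ β) * betaJointWeight β w (l.removeNth z) := by
  rw [← betaJointWeight_cons, Fin.cons_removeNth_eq_comp_cycleRange_symm,
    betaJointWeight_comp_perm]

end JointWeight

/-- Measurable functions on `ℝ ^ ι` of at most polynomial growth. -/
def PolyGrowth {ι : Type*} [Fintype ι] (f : (ι → ℝ) → ℝ) : Prop :=
  Measurable f ∧ ∃ (C : ℝ) (k : ℕ), ∀ z, |f z| ≤ C * (∏ i, (1 + |z i|)) ^ k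

namespace PolyGrowth
variable {ι : Type*} [Fintype ι] {f g : (ι → ℝ) → ℝ}

theorem one_le_prod (z : ι → ℝ) : 1 ≤ ∏ i, (1 + |z i|) := by
  simpa using Finset.prod_le_prod (s := Finset.univ) (f := fun _ : ι => (1 : ℝ))
    (g := fun i => 1 + |z i|) (fun _ _ => zero_le_one) (fun i _ => by simp)

theorem of_bounded (hf : Measurable f) {C : ℝ} (h : ∀ z, |f z| ≤ C) : PolyGrowth f :=
  ⟨hf, C, 0, fun z => by simpa using h z⟩

theorem const (c : ℝ) : PolyGrowth fun _ : ι → ℝ => c :=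
  of_bounded measurable_const fun _ => le_rfl

theorem apply (i : ι) : PolyGrowth fun z : ι → ℝ => z i := by
  refine ⟨measurable_pi_apply i, 1, 1, fun z => ?_⟩
  rw [one_mul, pow_one]
  classical
  refine (le_add_of_nonneg_left zero_le_one).trans ?_
  simpa using Finset.prod_le_prod_of_subset_of_one_le (f := fun i => 1 + |z i|)
    (Finset.subset_univ {i}) (by intros; positivity) (by intros; simp)

theorem add (hf : PolyGrowth f) (hg : PolyGrowth g) : PolyGrowth fun z => f z + g z := by
  obtain ⟨hf, C, k, hC⟩ := hf
  obtain ⟨hg, D, l, hD⟩ := hg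
  refine ⟨hf.add hg, |C| + |D|, k + l, fun z => ?_⟩
  have h1 := one_le_prod z
  set B := ∏ i, (1 + |z i|)
  calc |f z + g z| ≤ |f z| + |g z| := abs_add_le _ _
    _ ≤ |C| * B ^ k + |D| * B ^ l := by
      refine add_le_add ((hC z).trans ?_) ((hD z).trans ?_) <;> gcongr <;> exact le_abs_self _
    _ ≤ |C| * B ^ (k + l) + |D| * B ^ (k + l) := by
      gcongr <;> first | exact h1 | omega
    _ = _ := by ring

theorem mul (hf : PolyGrowth f) (hg : PolyGrowth g) : PolyGrowth fun z => f z * g z := by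
  obtain ⟨hf, C, k, hC⟩ := hf
  obtain ⟨hg, D, l, hD⟩ := hg
  refine ⟨hf.mul hg, C * D, k + l, fun z => ?_⟩
  rw [abs_mul, pow_add]
  calc _ ≤ (C * (∏ i, (1 + |z i|)) ^ k) * (D * (∏ i, (1 + |z i|)) ^ l) :=
      mul_le_mul (hC z) (hD z) (abs_nonneg _) ((abs_nonneg _).trans (hC z))
    _ = _ := by ring

theorem const_mul (hf : PolyGrowth f) (c : ℝ) : PolyGrowth fun z => c * f z := (const c).mul hf

theorem sub (hf : PolyGrowth f) (hg : PolyGrowth g) : PolyGrowth fun z => f z - g z := by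
  simpa only [sub_eq_add_neg, neg_one_mul] using hf.add (hg.const_mul (-1))

theorem abs (hf : PolyGrowth f) : PolyGrowth fun z => |f z| :=
  ⟨hf.1.abs, by simpa using hf.2⟩

theorem prod {κ : Type*} (s : Finset κ) {F : κ → (ι → ℝ) → ℝ} (h : ∀ j ∈ s, PolyGrowth (F j)) :
    PolyGrowth fun z => ∏ j ∈ s, F j z := by
  classical
  induction s using Finset.induction_on with
  | empty => simpa using const 1
  | insert j s hj ih =>
    simp only [Finset.prod_insert hj]
    exact (h j (by simp)).mul (ih fun i hi => h i (by simp [hi]))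

theorem sum {κ : Type*} (s : Finset κ) {F : κ → (ι → ℝ) → ℝ} (h : ∀ j ∈ s, PolyGrowth (F j)) :
    PolyGrowth fun z => ∑ j ∈ s, F j z := by
  classical
  induction s using Finset.induction_on with
  | empty => simpa using const 0
  | insert j s hj ih =>
    simp only [Finset.sum_insert hj]
    exact (h j (by simp)).add (ih fun i hi => h i (by simp [hi]))

theorem pow (hf : PolyGrowth f) (k : ℕ) : PolyGrowth fun z => f z ^ k := by
  simpa using prod (Finset.range k) (F := fun _ => f) fun _ _ => hf

theorem eval (p : ℝ[X]) (hf : PolyGrowth f) : PolyGrowth fun z => p.eval (f z) := by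
  simp only [eval_eq_sum_range]
  exact sum _ fun i _ => (hf.pow i).const_mul _

theorem comp {κ : Type*} [Fintype κ] (hf : PolyGrowth f) {e : ι → κ} (he : Function.Injective e) :
    PolyGrowth fun z : κ → ℝ => f fun i => z (e i) := by
  obtain ⟨hm, C, k, hC⟩ := hf
  refine ⟨hm.comp (measurable_pi_lambda _ fun i => measurable_pi_apply _), |C|, k, fun z => ?_⟩
  refine (hC _).trans (mul_le_mul (le_abs_self C) ?_ (pow_nonneg (zero_le_one.trans
    (one_le_prod _)) _) (abs_nonneg C))
  refine pow_le_pow_left₀ (zero_le_one.trans (one_le_prod _)) ?_ k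
  classical
  rw [← Finset.prod_image (s := Finset.univ) (g := e) (f := fun j => 1 + |z j|) he.injOn]
  exact Finset.prod_le_prod_of_subset_of_one_le (Finset.subset_univ _)
    (by intros; positivity) (by intros; simp)

end PolyGrowth

theorem laguerreWeight_of_pos {α x : ℝ} (hx : 0 < x) :
    laguerreWeight α x = x ^ α * Real.exp (-x) := by rw [laguerreWeight, if_pos hx]

theorem laguerreWeight_nonneg (α x : ℝ) : 0 ≤ laguerreWeight α x := by
  rw [laguerreWeight]; split_ifs with h <;> positivity

theorem measurable_laguerreWeight (α : ℝ) : Measurable (laguerreWeight α) := by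
  unfold laguerreWeight
  refine Measurable.ite measurableSet_Ioi ?_ measurable_const
  fun_prop

theorem laguerreWeight_mul_eq_indicator (α : ℝ) (f : ℝ → ℝ) :
    (fun x => laguerreWeight α x * f x) =
      (Ioi (0 : ℝ)).indicator fun x => x ^ α * Real.exp (-x) * f x := by
  ext x
  by_cases hx : 0 < x
  · rw [laguerreWeight_of_pos hx, indicator_of_mem (by exact hx)]
  · rw [laguerreWeight, if_neg hx, indicator_of_notMem (by exact hx), zero_mul]

theorem integral_laguerreWeight_mul_eval (α : ℝ) (p : ℝ[X]) :
    ∫ x, laguerreWeight α x * p.eval x = lagMoment α p := by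
  rw [laguerreWeight_mul_eq_indicator, integral_indicator measurableSet_Ioi, lagMoment]

theorem integrable_laguerreWeight_mul_eval {α : ℝ} (hα : -1 < α) (p : ℝ[X]) :
    Integrable fun x => laguerreWeight α x * p.eval x := by
  rw [laguerreWeight_mul_eq_indicator, integrable_indicator_iff measurableSet_Ioi]
  exact lagMoment_integrable hα p

theorem PolyGrowth.integrable {ι : Type*} [Fintype ι] {f : (ι → ℝ) → ℝ} (hf : PolyGrowth f)
    {α : ℝ} (hα : -1 < α) : Integrable fun z : ι → ℝ => f z * ∏ i, laguerreWeight α (z i) := by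
  obtain ⟨hm, C, k, hC⟩ := hf
  have h1 : Integrable fun x => laguerreWeight α x * (1 + |x|) ^ k := by
    refine (integrable_laguerreWeight_mul_eval hα ((1 + X) ^ k)).congr
      (Filter.Eventually.of_forall fun x => ?_)
    by_cases hx : 0 < x
    · simp [abs_of_pos hx]
    · simp [laguerreWeight, hx]
  have h2 : Integrable fun z : ι → ℝ => ∏ i, (laguerreWeight α (z i) * (1 + |z i|) ^ k) :=
    Integrable.fintype_prod (f := fun _ x => laguerreWeight α x * (1 + |x|) ^ k) fun _ => h1
  refine (h2.const_mul C).mono' ?_ (Filter.Eventually.of_forall fun z => ?_)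
  · exact (hm.mul (Finset.measurable_prod _ fun i _ =>
      (measurable_laguerreWeight α).comp (measurable_pi_apply i))).aestronglyMeasurable
  · have h3 : 0 ≤ ∏ i, laguerreWeight α (z i) :=
      Finset.prod_nonneg fun i _ => laguerreWeight_nonneg _ _
    rw [Real.norm_eq_abs, abs_mul, abs_of_nonneg h3, Finset.prod_mul_distrib, Finset.prod_pow]
    calc _ ≤ (C * (∏ i, (1 + |z i|)) ^ k) * ∏ i, laguerreWeight α (z i) := by
          gcongr; exact hC z
      _ = _ := by ring

theorem polyGrowth_prod_abs_sub (β n : ℕ) :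
    PolyGrowth fun x : Fin n → ℝ => ∏ j, ∏ k ∈ Finset.Ioi j, |x k - x j| ^ β :=
  PolyGrowth.prod _ fun j _ => PolyGrowth.prod _ fun k _ =>
    (((PolyGrowth.apply k).sub (PolyGrowth.apply j)).abs).pow β

theorem PolyGrowth.integrable_mul_betaJointWeight {n : ℕ} {f : (Fin n → ℝ) → ℝ}
    (hf : PolyGrowth f) {α : ℝ} (hα : -1 < α) (β : ℕ) :
    Integrable fun z => f z * betaJointWeight β (laguerreWeight α) z := by
  refine ((hf.mul (polyGrowth_prod_abs_sub β n)).integrable hα).congr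
    (Filter.Eventually.of_forall fun z => ?_)
  simp only [betaJointWeight]; ring

theorem betaJointWeight_nonneg (β : ℕ) (α : ℝ) {n : ℕ} (z : Fin n → ℝ) :
    0 ≤ betaJointWeight β (laguerreWeight α) z :=
  mul_nonneg (Finset.prod_nonneg fun i _ => laguerreWeight_nonneg _ _)
    (Finset.prod_nonneg fun i _ => Finset.prod_nonneg fun k _ => by positivity)

/-- The weight is strictly positive on the open box i + 1 < z_i < i + 2, where the coordinates are
positive and distinct. -/
theorem integral_betaJointWeight_pos (β : ℕ) {α : ℝ} (hα : -1 < α) (n : ℕ) :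
    0 < ∫ z : Fin n → ℝ, betaJointWeight β (laguerreWeight α) z := by
  have hi : Integrable fun z : Fin n → ℝ => betaJointWeight β (laguerreWeight α) z := by
    simpa using (PolyGrowth.const 1).integrable_mul_betaJointWeight hα β
  rw [integral_pos_iff_support_of_nonneg (betaJointWeight_nonneg β α) hi]
  have ho : IsOpen (Set.pi univ fun i : Fin n => Ioo ((i : ℝ) + 1) (i + 2)) :=
    isOpen_set_pi finite_univ fun _ _ => isOpen_Ioo
  refine (ho.measure_pos volume ⟨fun i => (i : ℝ) + 3 / 2, fun i _ => ⟨by linarith, by linarith⟩⟩).trans_le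
    (measure_mono fun z hz => ?_)
  have hz : ∀ i : Fin n, (i : ℝ) + 1 < z i ∧ z i < i + 2 := fun i => hz i (mem_univ i)
  rw [Function.mem_support]
  refine (mul_pos (Finset.prod_pos fun i _ => ?_) (Finset.prod_pos fun j _ =>
    Finset.prod_pos fun k hk => ?_)).ne'
  · have h0 : 0 < z i := by have := (hz i).1; have := Nat.cast_nonneg (α := ℝ) (i : ℕ); linarith
    rw [laguerreWeight_of_pos h0]; positivity
  · have hjk : (j : ℕ) + 1 ≤ k := Finset.mem_Ioi.1 hk
    have hjk' : (j : ℝ) + 1 ≤ k := by exact_mod_cast hjk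
    have := (hz j).2
    have := (hz k).1
    exact pow_pos (abs_pos.2 (by linarith)) β

section RemoveNth
variable {n : ℕ} {F : ℝ → (Fin n → ℝ) → ℝ}

theorem integrable_removeNth_iff (l : Fin (n + 1)) :
    Integrable (fun z : Fin (n + 1) → ℝ => F (z l) (l.removeNth z)) ↔
      Integrable (fun p : ℝ × (Fin n → ℝ) => F p.1 p.2) (volume.prod volume) :=
  (volume_preserving_piFinSuccAbove (fun _ : Fin (n + 1) => ℝ) l).integrable_comp_emb
    (MeasurableEquiv.measurableEmbedding _) (g := fun p : ℝ × (Fin n → ℝ) => F p.1 p.2)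

/-- Singling out any coordinate preserves Lebesgue measure, so the n + 1 summands of an integrated
interpolation formula coincide. -/
theorem integral_removeNth (h : Integrable (fun z : Fin (n + 1) → ℝ => F (z 0) (Fin.tail z)))
    (l : Fin (n + 1)) :
    ∫ z : Fin (n + 1) → ℝ, F (z l) (l.removeNth z) = ∫ s, ∫ t, F s t := by
  have h0 := (integrable_removeNth_iff (F := F) 0).1 (by simpa only [Fin.removeNth_zero] using h)
  rw [← integral_prod _ h0]
  exact (volume_preserving_piFinSuccAbove (fun _ : Fin (n + 1) => ℝ) l).integral_comp'
    (g := fun p : ℝ × (Fin n → ℝ) => F p.1 p.2)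

theorem integrable_removeNth (h : Integrable (fun z : Fin (n + 1) → ℝ => F (z 0) (Fin.tail z)))
    (l : Fin (n + 1)) : Integrable (fun z : Fin (n + 1) → ℝ => F (z l) (l.removeNth z)) :=
  (integrable_removeNth_iff l).2
    ((integrable_removeNth_iff (F := F) 0).1 (by simpa only [Fin.removeNth_zero] using h))

end RemoveNth

/-- The polynomial of degree less than `d` obtained by integrating the coefficients of `P t`. -/
noncomputable def intPoly {T : Type*} [MeasureSpace T] (d : ℕ) (P : T → ℝ[X]) (g : T → ℝ) : ℝ[X] :=
  ∑ k ∈ Finset.range d, monomial k (∫ t, (P t).coeff k * g t)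

section IntPoly
variable {T : Type*} [MeasureSpace T] {d : ℕ} {P : T → ℝ[X]} {g : T → ℝ}

theorem intPoly_degree_lt : (intPoly d P g).degree < d := by
  refine (degree_sum_le _ _).trans_lt ((Finset.sup_lt_iff (WithBot.bot_lt_coe d)).2 fun k hk => ?_)
  exact (degree_monomial_le _ _).trans_lt (WithBot.coe_lt_coe.2 (Finset.mem_range.1 hk))

theorem intPoly_eval (hP : ∀ t, (P t).natDegree < d)
    (hi : ∀ k, Integrable fun t => (P t).coeff k * g t) (z : ℝ) :
    (intPoly d P g).eval z = ∫ t, (P t).eval z * g t := by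
  simp only [intPoly, eval_finsetSum, eval_monomial]
  simp only [fun t => eval_eq_sum_range' (hP t) z, Finset.sum_mul]
  rw [integral_finsetSum _ fun k _ =>
    ((hi k).mul_const (z ^ k)).congr (Filter.Eventually.of_forall fun t => by ring)]
  refine Finset.sum_congr rfl fun k _ => ?_
  rw [← integral_mul_const]
  congr 1; ext t; ring

theorem intPoly_derivative_eval (hP : ∀ t, (P t).natDegree < d)
    (hi : ∀ k, Integrable fun t => (P t).coeff k * g t) (z : ℝ) :
    (intPoly d P g).derivative.eval z = ∫ t, (P t).derivative.eval z * g t := by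
  have h1 : (intPoly d P g).derivative = intPoly d (fun t => (P t).derivative) g := by
    ext k
    rw [coeff_derivative]
    simp only [intPoly, finsetSum_coeff, coeff_monomial, Finset.sum_ite_eq', Finset.mem_range,
      coeff_derivative]
    by_cases hk : k + 1 < d
    · rw [if_pos hk, if_pos (by omega), ← integral_mul_const]
      congr 1; ext t; ring
    · rw [if_neg hk, zero_mul]
      split_ifs
      · have : ∀ t, (P t).coeff (k + 1) = 0 := fun t =>
          coeff_eq_zero_of_natDegree_lt ((hP t).trans_le (by omega))
        simp [this]
      · rfl
  rw [h1, intPoly_eval]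
  · exact fun t => (natDegree_derivative_le _).trans_lt ((Nat.sub_le _ _).trans_lt (hP t))
  · intro k
    simp only [coeff_derivative]
    refine ((hi (k + 1)).mul_const ((k : ℝ) + 1)).congr (Filter.Eventually.of_forall fun t => ?_)
    ring

end IntPoly

theorem Polynomial.degree_lt_induction {S : ℕ → ℝ[X]} (hS : ∀ i, (S i).degree = i) {p : ℝ[X] → Prop}
    (h0 : p 0) (hadd : ∀ q r, p q → p r → p (q + r)) (hC : ∀ c q, p q → p (C c * q)) (n : ℕ)
    (hp : ∀ i < n, p (S i)) {q : ℝ[X]} (hq : q.degree < n) : p q := by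
  induction n generalizing q with
  | zero =>
    have : q = 0 := by
      rw [← degree_eq_bot]; simpa using hq
    rwa [this]
  | succ n ih =>
    set c := q.coeff n / (S n).coeff n
    have hlead : (S n).coeff n ≠ 0 := by
      have := leadingCoeff_ne_zero.2 (show S n ≠ 0 from fun h => by
        have := hS n
        rw [h, degree_zero] at this
        exact absurd this (by simp))
      rwa [leadingCoeff, natDegree_eq_of_degree_eq_some (hS n)] at this
    have hr : (q - C c * S n).degree < n := by
      rw [degree_lt_iff_coeff_zero]
      intro m hm
      rw [coeff_sub, coeff_C_mul]
      rcases hm.eq_or_lt with rfl | hm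
      · simp only [c]; field_simp; ring
      · rw [coeff_eq_zero_of_degree_lt (hq.trans_le (by exact_mod_cast hm)),
          coeff_eq_zero_of_degree_lt (by rw [hS]; exact_mod_cast hm)]
        ring
    have h := hadd _ _ (ih (fun i hi => hp i (by omega)) hr) (hC c _ (hp n (by omega)))
    simpa using h

theorem Polynomial.degree_C_mul_le' (c : ℝ) (p : ℝ[X]) : (C c * p).degree ≤ p.degree := by
  rw [← smul_eq_C_mul]; exact degree_smul_le c p

/-- The coefficients of the polynomials `P t` are of at most polynomial growth in `t`. -/
def CoeffGrowth {ι : Type*} [Fintype ι] (P : (ι → ℝ) → ℝ[X]) : Prop :=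
  ∀ k, PolyGrowth fun t => (P t).coeff k

namespace CoeffGrowth
variable {ι : Type*} [Fintype ι] {P Q : (ι → ℝ) → ℝ[X]}

theorem mul (hP : CoeffGrowth P) (hQ : CoeffGrowth Q) : CoeffGrowth fun t => P t * Q t := fun k => by
  simp only [coeff_mul]
  exact PolyGrowth.sum _ fun i _ => (hP _).mul (hQ _)

theorem C {f : (ι → ℝ) → ℝ} (hf : PolyGrowth f) : CoeffGrowth fun t => C (f t) := fun k => by
  simp only [coeff_C]
  rcases k with _ | k
  · simpa using hf
  · simpa using PolyGrowth.const 0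

theorem X_sub_C {f : (ι → ℝ) → ℝ} (hf : PolyGrowth f) :
    CoeffGrowth fun t => X - Polynomial.C (f t) := fun k => by
  simp only [coeff_sub]
  exact (PolyGrowth.const _).sub (C hf k)

theorem prod {κ : Type*} (s : Finset κ) {F : κ → (ι → ℝ) → ℝ[X]}
    (h : ∀ j ∈ s, CoeffGrowth (F j)) : CoeffGrowth fun t => ∏ j ∈ s, F j t := by
  classical
  induction s using Finset.induction_on with
  | empty => simpa using C (PolyGrowth.const (ι := ι) 1)
  | insert j s hj ih =>
    simp only [Finset.prod_insert hj]
    exact (h j (by simp)).mul (ih fun i hi => h i (by simp [hi]))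

theorem derivative (hP : CoeffGrowth P) : CoeffGrowth fun t => derivative (P t) := fun k => by
  simp only [coeff_derivative]
  exact (hP _).mul (PolyGrowth.const _)

theorem eval {κ : Type*} [Fintype κ] (hP : CoeffGrowth P) {d : ℕ} (hd : ∀ t, (P t).natDegree < d)
    {e : ι → κ} (he : Function.Injective e) {f : (κ → ℝ) → ℝ} (hf : PolyGrowth f) :
    PolyGrowth fun z : κ → ℝ => (P fun i => z (e i)).eval (f z) := by
  simp only [fun z : κ → ℝ => eval_eq_sum_range' (hd fun i => z (e i)) (f z)]
  exact PolyGrowth.sum _ fun k _ => ((hP k).comp he).mul (hf.pow k)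

end CoeffGrowth

theorem PolyGrowth.integrable_cons {n : ℕ} {f : (Fin (n + 1) → ℝ) → ℝ}
    (hf : PolyGrowth f) {α : ℝ} (hα : -1 < α) (β : ℕ) :
    Integrable fun z => laguerreWeight α (z 0) * f z *
      betaJointWeight β (laguerreWeight α) (Fin.tail z) := by
  refine ((hf.mul ((polyGrowth_prod_abs_sub β n).comp (Fin.succ_injective n))).integrable hα).congr
    (Filter.Eventually.of_forall fun z => ?_)
  simp only [betaJointWeight, Fin.prod_univ_succ, Fin.tail]
  ring

theorem betaJointWeight_eq_zero {β : ℕ} (hβ : β ≠ 0) (w : ℝ → ℝ) {n : ℕ} {z : Fin n → ℝ}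
    (hz : ¬ Function.Injective z) : betaJointWeight β w z = 0 := by
  rw [betaJointWeight, abs_prod_sub_pow_eq_det,
    not_not.1 (mt Matrix.det_vandermonde_ne_zero_iff.1 hz), abs_zero, zero_pow hβ, mul_zero]

theorem exists_removeNth_eq {n : ℕ} {z : Fin (n + 1) → ℝ} (hz : ¬ Function.Injective z)
    {l : Fin (n + 1)} (ht : Function.Injective (l.removeNth z)) : ∃ m, l.removeNth z m = z l := by
  by_contra! hne
  refine hz fun i j hij => ?_
  by_contra hne'
  rcases eq_or_ne i l with rfl | hi
  · obtain ⟨m, rfl⟩ := Fin.exists_succAbove_eq (Ne.symm hne')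
    exact hne m hij.symm
  · obtain ⟨m, rfl⟩ := Fin.exists_succAbove_eq hi
    rcases eq_or_ne j l with rfl | hj
    · exact hne m hij
    · obtain ⟨m', rfl⟩ := Fin.exists_succAbove_eq hj
      exact hne' (congrArg _ (ht hij))

/-! ### Hermite interpolation for β = 4. -/

section Hermite

/-- The polynomial `∏ (X - t i) ^ 2`. -/
noncomputable def sqPoly {n : ℕ} (t : Fin n → ℝ) : ℝ[X] := ∏ i, (X - C (t i)) ^ 2

variable {n : ℕ}

theorem sqPoly_natDegree (t : Fin n → ℝ) : (sqPoly t).natDegree = 2 * n := by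
  rw [sqPoly, natDegree_prod_of_monic _ _ fun i _ => (monic_X_sub_C _).pow 2]
  simp [natDegree_pow, mul_comm]

theorem sqPoly_eval (t : Fin n → ℝ) (s : ℝ) : (sqPoly t).eval s = ∏ i, (s - t i) ^ 2 := by
  simp [sqPoly, eval_prod]

theorem sqPoly_eval_sq (t : Fin n → ℝ) (s : ℝ) : (sqPoly t).eval s ^ 2 = ∏ i, |t i - s| ^ 4 := by
  rw [sqPoly_eval, ← Finset.prod_pow]
  refine Finset.prod_congr rfl fun i _ => ?_
  rw [show |t i - s| ^ 4 = (|t i - s| ^ 2) ^ 2 by ring, sq_abs]; ring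

theorem sqPoly_root (t : Fin n → ℝ) (i : Fin n) :
    (sqPoly t).eval (t i) = 0 ∧ (sqPoly t).derivative.eval (t i) = 0 := by
  obtain ⟨r, hr⟩ : (X - C (t i)) ^ 2 ∣ sqPoly t := Finset.dvd_prod_of_mem _ (Finset.mem_univ i)
  rw [hr]
  simp [derivative_mul, derivative_pow]

theorem eq_zero_of_double_roots {z : Fin n → ℝ} (hz : Function.Injective z) {R : ℝ[X]}
    (hR : R.degree < (2 * n : ℕ)) (h0 : ∀ k, R.eval (z k) = 0)
    (h1 : ∀ k, R.derivative.eval (z k) = 0) : R = 0 := by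
  have hd : sqPoly z ∣ R := by
    refine Finset.prod_dvd_of_coprime (fun i _ j _ hij => ?_) fun k _ => ?_
    · exact (pairwise_coprime_X_sub_C hz hij).pow
    · by_cases hR0 : R = 0
      · simp [hR0]
      · exact (le_rootMultiplicity_iff hR0).1
          ((one_lt_rootMultiplicity_iff_isRoot hR0).2 ⟨h0 k, h1 k⟩)
  refine eq_zero_of_dvd_of_degree_lt hd ?_
  rw [degree_eq_natDegree (p := sqPoly z) (Finset.prod_ne_zero_iff.2 fun i _ =>
    pow_ne_zero 2 (X_sub_C_ne_zero _)), sqPoly_natDegree]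
  exact hR

/-- Hermite interpolation at the double nodes `z`, multiplied by the fourth power of the
Vandermonde determinant. -/
theorem betaJointWeight_four_mul_eval (w : ℝ → ℝ) (z : Fin (n + 1) → ℝ) {q : ℝ[X]}
    (hq : q.degree < (2 * (n + 1) : ℕ)) (x : ℝ) :
    betaJointWeight 4 w z * q.eval x = ∑ l, w (z l) * (let Q := sqPoly (l.removeNth z)
      Q.eval x * (q.eval (z l) * (Q.eval (z l) + (z l - x) * Q.derivative.eval (z l))
        - q.derivative.eval (z l) * ((z l - x) * Q.eval (z l)))) *
        betaJointWeight 4 w (l.removeNth z) := by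
  dsimp only
  have hJ : ∀ l : Fin (n + 1), betaJointWeight 4 w z = w (z l) *
      (sqPoly (l.removeNth z)).eval (z l) ^ 2 * betaJointWeight 4 w (l.removeNth z) := fun l => by
    rw [sqPoly_eval_sq, ← betaJointWeight_removeNth]
  by_cases hz : Function.Injective z
  -- `A l` is the Hermite interpolant of q attached to the node z_l, times the joint weight. By `hJ`
  -- that weight contains Q(z_l)², exactly the denominator of the interpolant.
  · set A : Fin (n + 1) → ℝ[X] := fun l => let Q := sqPoly (l.removeNth z)
      C (w (z l) * betaJointWeight 4 w (l.removeNth z)) * (Q *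
        (C (q.eval (z l) * Q.eval (z l)) + C (q.derivative.eval (z l) * Q.eval (z l)
          - q.eval (z l) * Q.derivative.eval (z l)) * (X - C (z l)))) with hA
    have key : C (betaJointWeight 4 w z) * q - ∑ l, A l = 0 := by
      have roots : ∀ k l : Fin (n + 1), l ≠ k → (sqPoly (l.removeNth z)).eval (z k) = 0 ∧
          (sqPoly (l.removeNth z)).derivative.eval (z k) = 0 := fun k l hl => by
        obtain ⟨m, rfl⟩ := Fin.exists_succAbove_eq hl.symm
        exact sqPoly_root (l.removeNth z) m
      refine eq_zero_of_double_roots hz ?_ (fun k => ?_) fun k => ?_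
      · refine (degree_sub_le _ _).trans_lt (max_lt ((degree_C_mul_le' _ _).trans_lt hq) ?_)
        refine (degree_sum_le _ _).trans_lt
          ((Finset.sup_lt_iff (WithBot.bot_lt_coe _)).2 fun l _ => ?_)
        refine (degree_C_mul_le' _ _).trans_lt ((degree_mul_le _ _).trans_lt ?_)
        have d1 : (sqPoly (l.removeNth z)).degree ≤ (2 * n : ℕ) := by
          rw [← sqPoly_natDegree (l.removeNth z)]; exact degree_le_natDegree
        have d2 : ∀ c d : ℝ, (C c + C d * (X - C (z l))).degree ≤ ((1 : ℕ) : WithBot ℕ) := fun c d => by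
          refine (degree_add_le _ _).trans (max_le (degree_C_le.trans (by exact_mod_cast zero_le_one)) ?_)
          refine (degree_C_mul_le' _ _).trans ?_
          rw [degree_X_sub_C]
          exact le_rfl
        refine (add_le_add d1 (d2 _ _)).trans_lt ?_
        exact_mod_cast (by omega : 2 * n + 1 < 2 * (n + 1))
      · rw [eval_sub, eval_finsetSum, Finset.sum_eq_single k (fun l _ hl => by
          simp [hA, (roots k l hl).1]) (by simp), eval_mul, eval_C, hJ k]
        simp [hA]; ring
      · rw [derivative_sub, derivative_sum, eval_sub, eval_finsetSum,
          Finset.sum_eq_single k (fun l _ hl => by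
          simp [hA, derivative_mul, (roots k l hl).1, (roots k l hl).2]) (by simp), derivative_C_mul,
          eval_mul, eval_C, hJ k]
        simp [hA, derivative_mul]; ring
    have h := congrArg (fun R => R.eval x) (sub_eq_zero.1 key)
    simp only [eval_mul, eval_C, eval_finsetSum, hA, eval_add, eval_sub, eval_X] at h
    rw [h]
    exact Finset.sum_congr rfl fun l _ => by ring
  -- If two nodes coincide, each summand vanishes: either z_l is among the remaining nodes, a double
  -- root of Q, or the remaining nodes themselves repeat.
  · rw [betaJointWeight_eq_zero (by norm_num) w hz, zero_mul]
    refine (Finset.sum_eq_zero fun l _ => ?_).symm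
    by_cases ht : Function.Injective (l.removeNth z)
    · obtain ⟨m, hm⟩ := exists_removeNth_eq hz ht
      have h := sqPoly_root (l.removeNth z) m
      rw [hm] at h
      simp [h.1, h.2]
    · rw [betaJointWeight_eq_zero (by norm_num) w ht, mul_zero]

end Hermite

/-! ### Skew orthogonal polynomials and their reproducing kernel. -/

/-- The skew form `∫ x ^ α * exp (-x) * (q r' - q' r)`. -/
noncomputable def skewMoment (α : ℝ) (q r : ℝ[X]) : ℝ :=
  lagMoment α (q * derivative r - derivative q * r)

section Skew
variable {α : ℝ}

theorem skewMoment_swap (q r : ℝ[X]) : skewMoment α q r = - skewMoment α r q := by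
  rw [skewMoment, skewMoment, ← lagMoment_neg]; congr 1; ring

theorem skewMoment_add_left (hα : -1 < α) (p q r : ℝ[X]) :
    skewMoment α (p + q) r = skewMoment α p r + skewMoment α q r := by
  rw [skewMoment, skewMoment, skewMoment, ← lagMoment_add hα, derivative_add]; congr 1; ring

theorem skewMoment_C_mul_left (c : ℝ) (q r : ℝ[X]) :
    skewMoment α (C c * q) r = c * skewMoment α q r := by
  rw [skewMoment, skewMoment, ← lagMoment_C_mul, derivative_C_mul]; congr 1; ring

theorem skewMoment_C_mul_right (c : ℝ) (q r : ℝ[X]) :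
    skewMoment α q (C c * r) = c * skewMoment α q r := by
  rw [skewMoment_swap, skewMoment_C_mul_left, skewMoment_swap]; ring

theorem skewMoment_zero_left (r : ℝ[X]) : skewMoment α 0 r = 0 := by
  simp [skewMoment, lagMoment_zero]

theorem skewMoment_sub_right (hα : -1 < α) (p q r : ℝ[X]) :
    skewMoment α p (q - r) = skewMoment α p q - skewMoment α p r := by
  rw [skewMoment, skewMoment, skewMoment, ← lagMoment_sub hα, derivative_sub]; congr 1; ring

theorem skewMoment_sum_right (hα : -1 < α) {ι : Type*} (s : Finset ι) (p : ℝ[X]) (f : ι → ℝ[X]) :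
    skewMoment α p (∑ i ∈ s, f i) = ∑ i ∈ s, skewMoment α p (f i) := by
  simp only [skewMoment]
  rw [← lagMoment_sum hα, derivative_sum, Finset.mul_sum, Finset.mul_sum, Finset.sum_sub_distrib]

end Skew

section SkewLag
variable {a : ℝ}

/-- For the weight x^(a+1) e^(-x), both L_i^(a) = L_i^(a+1) - L_(i-1)^(a+1) and its derivative
-L_(i-1)^(a+1) are expressed in the orthogonal basis. Only neighbouring degrees pair nontrivially.
-/
theorem skewMoment_lag (ha : -2 < a) (i j : ℕ) : skewMoment (a + 1) (lag a i) (lag a j) =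
    (if i = j + 1 then lagNorm (a + 1) j else 0) - if j = i + 1 then lagNorm (a + 1) i else 0 := by
  have hα : -1 < a + 1 := by linarith
  set Pm : ℕ → ℝ[X] := fun i => if i = 0 then 0 else lag (a + 1) (i - 1) with hPm
  have h1 : ∀ i, lag a i = lag (a + 1) i - Pm i := fun i => by
    rcases i with _ | i
    · simp [hPm, lag_zero]
    · refine Polynomial.funext fun x => ?_
      rw [lag_eq_sub, eval_sub]; simp [hPm]
  have h2 : ∀ i, derivative (lag a i) = - Pm i := fun i => by
    rcases i with _ | i
    · simp [hPm, lag_zero]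
    · refine Polynomial.funext fun x => ?_
      rw [lag_deriv, eval_neg]; simp [hPm]
  have h3 : ∀ i j, lagMoment (a + 1) (lag (a + 1) i * Pm j) =
      if j = i + 1 then lagNorm (a + 1) i else 0 := fun i j => by
    rcases j with _ | j
    · simp [hPm, lagMoment_zero]
    · simp only [hPm, Nat.add_sub_cancel, if_neg (Nat.succ_ne_zero j), add_left_inj]
      split_ifs with h
      · rw [h, lagMoment_sq hα]
      · exact lagMoment_orthogonal hα (Ne.symm h)
  rw [skewMoment, h2, h2, h1 i, h1 j, ← h3, ← h3, ← lagMoment_sub hα]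
  congr 1; ring

theorem lagNorm_add_one (k : ℕ) :
    lagNorm (a + 1) k = (k + 1) * lagNorm a (k + 1) := by
  rw [lagNorm, lagNorm, Nat.factorial_succ]
  push_cast
  rw [show (k : ℝ) + (a + 1) + 1 = k + 1 + a + 1 by ring]
  have h1 : (k.factorial : ℝ) ≠ 0 := by exact_mod_cast k.factorial_ne_zero
  have h2 : (k : ℝ) + 1 ≠ 0 := by positivity
  field_simp

theorem skewMoment_lag_odd (ha : -2 < a) (i j : ℕ) :
    skewMoment (a + 1) (lag a (2 * i + 1)) (lag a (2 * j + 1)) = 0 := by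
  rw [skewMoment_lag ha, if_neg (by omega), if_neg (by omega), sub_zero]

theorem skewMoment_lagPrim_even (ha : -2 < a) (i j : ℕ) :
    skewMoment (a + 1) (lagPrim a i) (lag a (2 * j)) = 0 := by
  have hα : -1 < a + 1 := by linarith
  induction i with
  | zero =>
    rw [lagPrim, show (2 : ℝ[X]) = C 2 * lag a (2 * 0) by rw [lag_zero, mul_one]; rfl,
      skewMoment_C_mul_left, skewMoment_lag ha, if_neg (by omega), if_neg (by omega), sub_zero,
      mul_zero]
  | succ i ih =>
    rw [lagPrim, skewMoment_C_mul_left, skewMoment_add_left hα, skewMoment_C_mul_left, ih,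
      show (2 : ℝ[X]) = C 2 from rfl, skewMoment_C_mul_left, skewMoment_lag ha,
      if_neg (by omega), if_neg (by omega)]
    simp

theorem skewMoment_lagPrim (ha : -2 < a) (i j : ℕ) :
    skewMoment (a + 1) (lagPrim a i) (lagPrim a j) = 0 := by
  have hα : -1 < a + 1 := by linarith
  induction j with
  | zero =>
    rw [lagPrim, show (2 : ℝ[X]) = C 2 * lag a (2 * 0) by rw [lag_zero, mul_one]; rfl,
      skewMoment_C_mul_right, skewMoment_lagPrim_even ha, mul_zero]
  | succ j ih =>
    rw [skewMoment_swap] at ih ⊢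
    rw [lagPrim, skewMoment_C_mul_left, skewMoment_add_left hα, skewMoment_C_mul_left,
      show (2 : ℝ[X]) = C 2 from rfl, skewMoment_C_mul_left, neg_eq_zero.1 ih,
      skewMoment_swap, show 2 * j + 2 = 2 * (j + 1) by ring, skewMoment_lagPrim_even ha]
    simp

/-- In the recursion of `lagPrim`, the pairing of L_(2i+2) with L_(2i+1) cancels the one inherited
from the previous polynomial. Together with the vanishing odd–odd and `lagPrim`–`lagPrim` pairings
this makes the family skew orthogonal. -/
theorem skewMoment_lagPrim_lag (ha : -2 < a) (i j : ℕ) :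
    skewMoment (a + 1) (lagPrim a i) (lag a (2 * j + 1)) =
      if i = j then -2 * lagNorm a (2 * j + 1) else 0 := by
  have hα : -1 < a + 1 := by linarith
  induction i with
  | zero =>
    rw [lagPrim, show (2 : ℝ[X]) = C 2 * lag a (2 * 0) by rw [lag_zero, mul_one]; rfl,
      skewMoment_C_mul_left, skewMoment_lag ha, if_neg (by omega)]
    rcases j with _ | j
    · simp [lagNorm_add_one]
    · simp
  | succ i ih =>
    have hk : 2 * (i : ℝ) + 3 ≠ 0 := by positivity
    rw [lagPrim, skewMoment_C_mul_left, skewMoment_add_left hα, skewMoment_C_mul_left, ih,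
      show (2 : ℝ[X]) = C 2 from rfl, skewMoment_C_mul_left, skewMoment_lag ha]
    rcases eq_or_ne i j with rfl | hij
    · rw [if_pos rfl, if_pos rfl, if_neg (by omega), if_neg (by omega), lagNorm_add_one]
      have := lagNorm_succ a (2 * i + 1) (by
        have := Nat.cast_nonneg (α := ℝ) i; push_cast; linarith)
      push_cast at *
      field_simp
      linear_combination 2 * this
    · rw [if_neg hij, if_neg (by omega)]
      rcases eq_or_ne (i + 1) j with rfl | hij'
      · rw [if_pos (by ring), if_pos rfl, lagNorm_add_one,
          show 2 * (i + 1) + 1 = 2 * i + 2 + 1 by ring]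
        push_cast
        field_simp
        ring
      · rw [if_neg (by omega), if_neg hij']
        simp

/-- The reproducing kernel for the skew form with weight `x ^ (a + 1) * exp (-x)`. -/
noncomputable def skewKernel (a : ℝ) (N : ℕ) (x : ℝ) : ℝ[X] :=
  ∑ j ∈ Finset.range N, C (1 / (2 * lagNorm a (2 * j + 1))) *
    (C ((lag a (2 * j + 1)).eval x) * lagPrim a j - C ((lagPrim a j).eval x) * lag a (2 * j + 1))

theorem skewKernel_degree (N : ℕ) (x : ℝ) : (skewKernel a N x).degree < (2 * N : ℕ) := by
  refine (degree_sum_le _ _).trans_lt ((Finset.sup_lt_iff (WithBot.bot_lt_coe _)).2 fun j hj => ?_)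
  have hj := Finset.mem_range.1 hj
  refine (degree_C_mul_le' _ _).trans_lt ((degree_sub_le _ _).trans_lt (max_lt ?_ ?_))
  · refine (degree_C_mul_le' _ _).trans_lt ?_
    rw [lagPrim_degree]; exact Nat.cast_lt.2 (by omega)
  · refine (degree_C_mul_le' _ _).trans_lt ?_
    rw [lag_degree]; exact Nat.cast_lt.2 (by omega)

theorem skewKernel_swap (N : ℕ) (x z : ℝ) :
    (skewKernel a N x).eval z = - (skewKernel a N z).eval x := by
  simp only [skewKernel, eval_finsetSum, ← Finset.sum_neg_distrib]
  refine Finset.sum_congr rfl fun j _ => ?_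
  simp only [eval_mul, eval_sub, eval_C]
  ring

theorem skewMoment_skewKernel (ha : -2 < a) (N : ℕ) (x : ℝ) {q : ℝ[X]}
    (hq : q.degree < (2 * N : ℕ)) : skewMoment (a + 1) q (skewKernel a N x) = q.eval x := by
  have hα : -1 < a + 1 := by linarith
  have hpos : ∀ j : ℕ, lagNorm a (2 * j + 1) ≠ 0 := fun j => (lagNorm_pos a _ (by
    have := Nat.cast_nonneg (α := ℝ) j; push_cast; linarith)).ne'
  -- `lagPrim` in even degrees and the Laguerre polynomials in odd degrees give one polynomial of
  -- each degree.
  refine Polynomial.degree_lt_induction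
    (S := fun i => if i % 2 = 0 then lagPrim a (i / 2) else lag a i)
    (p := fun q => skewMoment (a + 1) q (skewKernel a N x) = q.eval x) (fun i => ?_)
    (by simp [skewMoment_zero_left]) (fun q r hq hr => by rw [skewMoment_add_left hα, hq, hr, eval_add])
    (fun c q hq => by rw [skewMoment_C_mul_left, hq, eval_mul, eval_C]) (2 * N) (fun i hi => ?_) hq
  · split_ifs with h
    · rw [lagPrim_degree]; congr 1; omega
    · exact lag_degree a i
  · rw [skewKernel, skewMoment_sum_right hα]
    simp only [skewMoment_C_mul_right, skewMoment_sub_right hα]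
    split_ifs with h
    · simp only [skewMoment_lagPrim ha, skewMoment_lagPrim_lag ha]
      rw [Finset.sum_eq_single (i / 2)]
      · rw [if_pos rfl]
        have := hpos (i / 2)
        field_simp; ring
      · intro j _ hj; rw [if_neg (Ne.symm hj)]; ring
      · intro hh; exact absurd (Finset.mem_range.2 (by omega)) hh
    · obtain ⟨k, rfl⟩ : ∃ k, i = 2 * k + 1 := ⟨i / 2, by omega⟩
      simp only [skewMoment_lag_odd ha, skewMoment_swap (lag a (2 * k + 1)) (lagPrim a _),
        skewMoment_lagPrim_lag ha]
      rw [Finset.sum_eq_single k]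
      · rw [if_pos rfl]
        have := hpos k
        field_simp; ring
      · intro j _ hj; rw [if_neg hj]; ring
      · intro hh; exact absurd (Finset.mem_range.2 (by omega)) hh

end SkewLag

/-! ### The density for β = 4. -/

section DensityFour
variable {α : ℝ} {n : ℕ}

/-- The integrand of the kernel of the `β = 4` ensemble, as a polynomial. -/
noncomputable def fourPoly (x : ℝ) (t : Fin n → ℝ) : ℝ[X] :=
  (X - C x) * (C ((sqPoly t).eval x) * sqPoly t)

theorem fourPoly_natDegree (x : ℝ) (t : Fin n → ℝ) : (fourPoly x t).natDegree < 2 * (n + 1) := by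
  refine natDegree_mul_le.trans_lt ?_
  have := natDegree_C_mul_le ((sqPoly t).eval x) (sqPoly t)
  rw [sqPoly_natDegree] at this
  rw [natDegree_X_sub_C]
  omega

theorem fourPoly_eval (x : ℝ) (t : Fin n → ℝ) (s : ℝ) : (fourPoly x t).eval s =
    (sqPoly t).eval x * ((s - x) * (sqPoly t).eval s) := by
  simp [fourPoly]; ring

theorem fourPoly_derivative_eval (x : ℝ) (t : Fin n → ℝ) (s : ℝ) :
    (fourPoly x t).derivative.eval s =
      (sqPoly t).eval x * ((sqPoly t).eval s + (s - x) * (sqPoly t).derivative.eval s) := by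
  simp [fourPoly, derivative_mul]; ring

theorem coeffGrowth_fourPoly (x : ℝ) : CoeffGrowth (fourPoly (n := n) x) := by
  have hs : CoeffGrowth (sqPoly (n := n)) := CoeffGrowth.prod _ fun i _ => by
    simp only [pow_two]
    exact (CoeffGrowth.X_sub_C (PolyGrowth.apply i)).mul (CoeffGrowth.X_sub_C (PolyGrowth.apply i))
  refine (CoeffGrowth.X_sub_C (PolyGrowth.const x)).mul ((CoeffGrowth.C ?_).mul hs)
  simp only [sqPoly_eval]
  exact PolyGrowth.prod _ fun i _ => ((PolyGrowth.const x).sub (PolyGrowth.apply i)).pow 2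

/-- The kernel of the `β = 4` ensemble, as a polynomial. -/
noncomputable def fourKernel (α : ℝ) (n : ℕ) (x : ℝ) : ℝ[X] :=
  intPoly (2 * (n + 1)) (fourPoly x) (betaJointWeight 4 (laguerreWeight α) (n := n))

/-- Integrating the Hermite identity over all nodes gives n + 1 equal terms, each the skew form of q
with the averaged polynomial `fourKernel`. -/
theorem skewMoment_fourKernel (hα : -1 < α) (x : ℝ) {q : ℝ[X]}
    (hq : q.degree < (2 * (n + 1) : ℕ)) :
    ((n : ℝ) + 1) * skewMoment α q (fourKernel α n x) =
      (∫ z : Fin (n + 1) → ℝ, betaJointWeight 4 (laguerreWeight α) z) * q.eval x := by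
  set w := laguerreWeight α with hw
  set J : (Fin n → ℝ) → ℝ := betaJointWeight 4 w with hJ
  have hg := coeffGrowth_fourPoly (n := n) x
  have hd := fourPoly_natDegree (n := n) x
  have hint : ∀ k, Integrable fun t => (fourPoly x t).coeff k * J t := fun k =>
    (hg k).integrable_mul_betaJointWeight hα 4
  have hdd : ∀ t : Fin n → ℝ, (derivative (fourPoly x t)).natDegree < 2 * (n + 1) := fun t =>
    (natDegree_derivative_le _).trans_lt ((Nat.sub_le _ _).trans_lt (hd t))
  have hev : ∀ s, Integrable fun t => (fourPoly x t).eval s * J t := fun s =>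
    (hg.eval hd (e := id) Function.injective_id (PolyGrowth.const s)).integrable_mul_betaJointWeight
      hα 4
  have hdev : ∀ s, Integrable fun t => (fourPoly x t).derivative.eval s * J t := fun s =>
    (hg.derivative.eval hdd (e := id) Function.injective_id
      (PolyGrowth.const s)).integrable_mul_betaJointWeight hα 4
  set F : ℝ → (Fin n → ℝ) → ℝ := fun s t => w s * (q.eval s * (fourPoly x t).derivative.eval s
    - q.derivative.eval s * (fourPoly x t).eval s) * J t with hF
  have hFi : Integrable fun z : Fin (n + 1) → ℝ => F (z 0) (Fin.tail z) := by
    refine PolyGrowth.integrable_cons ?_ hα 4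
    have h0 := PolyGrowth.apply (ι := Fin (n + 1)) 0
    exact ((h0.eval q).mul (hg.derivative.eval hdd (Fin.succ_injective n) h0)).sub
      ((h0.eval (derivative q)).mul (hg.eval hd (Fin.succ_injective n) h0))
  have e1 : skewMoment α q (fourKernel α n x) = ∫ s, ∫ t, F s t := by
    rw [skewMoment, ← integral_laguerreWeight_mul_eval]
    congr 1; ext s
    rw [eval_sub, eval_mul, eval_mul, fourKernel, intPoly_eval hd hint,
      intPoly_derivative_eval hd hint, ← integral_const_mul, ← integral_const_mul,
      ← integral_sub ((hdev s).const_mul _) ((hev s).const_mul _), ← integral_const_mul]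
    congr 1; ext t
    simp only [hF, hw]; ring
  have e2 : ∑ l : Fin (n + 1), ∫ z : Fin (n + 1) → ℝ, F (z l) (l.removeNth z) =
      ((n : ℝ) + 1) * ∫ s, ∫ t, F s t := by
    rw [Finset.sum_congr rfl fun l _ => integral_removeNth hFi l]; simp
  rw [e1, ← e2, ← integral_finsetSum _ fun l _ => integrable_removeNth hFi l, ← integral_mul_const]
  congr 1; ext z
  rw [betaJointWeight_four_mul_eval w z hq x]
  refine Finset.sum_congr rfl fun l _ => ?_
  simp only [hF, hJ, fourPoly_eval, fourPoly_derivative_eval]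
  ring

theorem betaDensity_four {a : ℝ} (ha : -2 < a) (x : ℝ) :
    betaDensity 4 (laguerreWeight (a + 1)) (n + 1) x =
      laguerreWeight (a + 1) x * (skewKernel a (n + 1) x).derivative.eval x := by
  have hα : -1 < a + 1 := by linarith
  set Z := ∫ z : Fin (n + 1) → ℝ, betaJointWeight 4 (laguerreWeight (a + 1)) z with hZ
  have hZ0 : 0 < Z := integral_betaJointWeight_pos 4 hα (n + 1)
  have hn : (n : ℝ) + 1 ≠ 0 := by positivity
  -- Both kernels reproduce in degrees below 2(n + 1). Pairing one with the other and evaluating the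
  -- pairing in two ways identifies them.
  have key : fourKernel (a + 1) n x = C (Z / (n + 1)) * skewKernel a (n + 1) x := by
    refine Polynomial.funext fun z => ?_
    have h1 := skewMoment_fourKernel hα x (skewKernel_degree (a := a) (n + 1) z)
    rw [skewMoment_swap, skewMoment_skewKernel ha (n + 1) z
      (show (fourKernel (a + 1) n x).degree < _ from intPoly_degree_lt),
      skewKernel_swap, ← hZ] at h1
    rw [eval_mul, eval_C, div_mul_eq_mul_div, eq_div_iff hn]
    linarith
  -- The factor s - x in `fourPoly` means that on the diagonal only its derivative survives, leaving
  -- the fourth powers in the density.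
  have h2 : (fourKernel (a + 1) n x).derivative.eval x =
      ∫ t : Fin n → ℝ, (∏ i, |t i - x| ^ 4) * betaJointWeight 4 (laguerreWeight (a + 1)) t := by
    rw [fourKernel, intPoly_derivative_eval (fourPoly_natDegree x) fun k =>
      (coeffGrowth_fourPoly x k).integrable_mul_betaJointWeight hα 4]
    congr 1; ext t
    rw [fourPoly_derivative_eval, ← sqPoly_eval_sq]; ring
  have h3 : ∫ t : Fin n → ℝ, betaJointWeight 4 (laguerreWeight (a + 1))
      (Fin.cons x t : Fin (n + 1) → ℝ) =
      laguerreWeight (a + 1) x * (fourKernel (a + 1) n x).derivative.eval x := by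
    rw [h2, ← integral_const_mul]
    congr 1; ext t
    rw [betaJointWeight_cons]; ring
  rw [betaDensity, h3, key, derivative_C_mul, eval_mul, eval_C, ← hZ]
  field_simp

/-- The density of the `β = 4` ensemble in terms of the Laguerre polynomial of degree `2 N`. -/
theorem betaDensity_four_eq {a : ℝ} (ha : -2 < a) {x : ℝ} (hx : 0 < x) :
    x * betaDensity 4 (laguerreWeight (a + 1)) (n + 1) x =
      x ^ (a + 1) * Real.exp (-x) / 2 *
      ((x * (lag a (2 * n + 2)).derivative.eval x ^ 2
        + (a - x) * (lag a (2 * n + 2)).eval x * (lag a (2 * n + 2)).derivative.eval x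
        + (2 * n + 2) * (lag a (2 * n + 2)).eval x ^ 2) / lagNorm a (2 * n + 2)
      - (n + 1) / lagNorm a (2 * n + 1) * (lag a (2 * n + 2)).eval x * (lagPrim a n).eval x) := by
  have h1 := sum_lagPrim a ha n x
  have h2 := sum_lag_sq a ha (2 * n + 2) x hx.ne' (Or.inl (by omega))
  push_cast at h2
  rw [h2] at h1
  rw [← h1, betaDensity_four ha, laguerreWeight_of_pos hx, skewKernel, derivative_sum,
    eval_finsetSum, Finset.mul_sum, Finset.mul_sum, Finset.mul_sum, Finset.mul_sum]
  refine Finset.sum_congr rfl fun j _ => ?_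
  rw [derivative_C_mul, derivative_sub, derivative_C_mul, derivative_C_mul]
  simp only [eval_mul, eval_sub, eval_C]
  ring

end DensityFour

section EdgeFour
variable {a : ℝ}

/-- The hard edge scaled density of the `β = 4` ensemble. -/
theorem hardEdgeDensity_four (ha : -2 < a) (n : ℕ) {c : ℝ} (hc : c = 4 * shiftedN 4 a (n + 1))
    {y : ℝ} (hy : 0 < y) :
    hardEdgeDensity 4 a (n + 1) y = lagNorm a (2 * n + 2) * c ^ (-a) / 4 *
      hardEdgeQuad (a ^ 2 - 1) (c ^ 2)⁻¹ (edgeFun a (c ^ 2)⁻¹) (edgeFunDeriv a (2 * n + 2) c)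
        (edgePrim a (c ^ 2)⁻¹) y := by
  have hc' : c = 2 * ((2 * n + 2 : ℕ) : ℝ) + a + 1 := by
    rw [hc, shiftedN, if_neg (by norm_num)]; push_cast; ring
  have h : 1 ≤ 2 * n + 2 ∨ -1 < a := Or.inl (by omega)
  have hc0 : 0 < c := by rw [hc']; exact lag_param_pos h ha
  have hn0 := Nat.cast_nonneg (α := ℝ) n
  have hN := lagNorm_pos a (2 * n + 2) (by push_cast; linarith)
  have hN1 := lagNorm_pos a (2 * n + 1) (by push_cast; linarith)
  have hs := lagNorm_succ a (2 * n + 1) (by push_cast; linarith)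
  rw [show 2 * n + 1 + 1 = 2 * n + 2 by ring] at hs
  push_cast at hs hc'
  -- This combination is the polynomial representing T: by `lagPrim_spec` its first part yields 2(2n
  -- + 2 + a) L_(2n+1), and the recurrence turns the total into (c - x) L_(2n+2).
  have hP : ∀ x, 2 * x * (C (2 * (n : ℝ) + 2 + a) * lagPrim a n + lag a (2 * n + 2)).derivative.eval x
      + (a + 1 - x) * (C (2 * (n : ℝ) + 2 + a) * lagPrim a n + lag a (2 * n + 2)).eval x =
      (c - x) * (lag a (2 * n + 2)).eval x := fun x => by
    have e1 := lagPrim_spec a n x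
    have e2 := lag_tridiag a (2 * n + 1) x
    have e3 := lag_eval_rec a (2 * n + 1) x
    rw [show 2 * n + 1 + 1 = 2 * n + 2 by ring] at e2 e3
    push_cast at e2 e3
    simp only [derivative_add, derivative_C_mul, eval_add, eval_mul, eval_C]
    rw [hc']
    linear_combination (2 * (n : ℝ) + 2 + a) * e1 + e2 + e3
  have hP0 : (C (2 * (n : ℝ) + 2 + a) * lagPrim a n + lag a (2 * n + 2)).eval 0 =
      c * lagNorm a (2 * n + 2) / Real.Gamma (a + 2) := by
    rw [eval_add, eval_mul, eval_C, lagPrim_eval_zero a ha, lag_eval_zero a _ h ha, hc']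
    linear_combination -2 / Real.Gamma (a + 2) * hs
  have hE := edgeFun_eq h ha (c := c) (by push_cast; exact hc') y
  have hT := edgePrim_eq h ha (c := c) (by push_cast; exact hc') hP hP0 y
  have hρ := betaDensity_four_eq (n := n) ha (div_pos hy hc0)
  rw [hardEdgeDensity, ← hc, hardEdgeQuad, hE, hT, edgeFunDeriv,
    show weightExponent 4 a = a + 1 by rw [weightExponent, if_neg (by norm_num)]]
  have hx : y / c ≠ 0 := (div_pos hy hc0).ne'
  rw [mul_comm, ← eq_div_iff hx] at hρ
  rw [hρ]
  have w1 : y ^ (a + 1) = y ^ ((a + 1) / 2) * y ^ ((a + 1) / 2) := by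
    rw [← Real.rpow_add hy]; ring_nf
  have w2 : Real.exp (-(y / c)) = Real.exp (-(y / c / 2)) * Real.exp (-(y / c / 2)) := by
    rw [← Real.exp_add]; ring_nf
  rw [Real.div_rpow hy.le hc0.le, Real.rpow_add_one hc0.ne', Real.rpow_neg hc0.le, w1, w2]
  simp only [eval_add, eval_mul, eval_C]
  have hca := (Real.rpow_pos_of_pos hc0 a).ne'
  have hs' : (n + 1) / lagNorm a (2 * n + 1) = (2 * n + 2 + a) / (2 * lagNorm a (2 * n + 2)) := by
    rw [div_eq_div_iff hN1.ne' (by positivity)]; linear_combination hs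
  rw [hs']
  generalize y ^ ((a + 1) / 2) = e1
  generalize Real.exp (-(y / c / 2)) = e2
  generalize (lag a (2 * n + 2)).eval (y / c) = u
  generalize (lag a (2 * n + 2)).derivative.eval (y / c) = v
  generalize (lagPrim a n).eval (y / c) = p
  generalize c ^ a = ca at *
  generalize lagNorm a (2 * n + 2) = h2 at *
  have hn : (n : ℝ) = (c - a - 5) / 4 := by rw [hc']; ring
  rw [hn]
  field_simp
  ring

end EdgeFour

/-! ### Products of signs as sums over jumps. -/

section JumpIdentity

theorem Real.sign_mul_self_eq_abs (x : ℝ) : Real.sign x * x = |x| := by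
  rcases lt_trichotomy x 0 with h | rfl | h
  · rw [Real.sign_of_neg h, abs_of_neg h]; ring
  · simp
  · rw [Real.sign_of_pos h, abs_of_pos h]; ring

/-- As a function of y the product starts at (-1)^|S| and jumps at each t_l by twice the product of
the other signs there. -/
theorem prod_sign_sub_eq {n : ℕ} {t : Fin n → ℝ} (ht : Function.Injective t) {y : ℝ}
    (hy : ∀ m, t m ≠ y) (S : Finset (Fin n)) :
    ∏ m ∈ S, Real.sign (y - t m) = (-1) ^ S.card +
      2 * ∑ l ∈ S, if t l < y then ∏ m ∈ S.erase l, Real.sign (t l - t m) else 0 := by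
  -- Points are inserted in increasing order, so the earlier jumps all change sign and the jump at
  -- the new point has coefficient 1.
  induction S using Finset.induction_on_max_value t with
  | empty => simp
  | insert b S hb hmax ih =>
    have hlt : ∀ m ∈ S, t m < t b := fun m hm => lt_of_le_of_ne (hmax m hm) fun h =>
      hb (ht h ▸ hm)
    rw [Finset.prod_insert hb, Finset.card_insert_of_notMem hb, Finset.sum_insert hb,
      Finset.erase_insert hb]
    have h1 : ∏ m ∈ S, Real.sign (t b - t m) = 1 :=
      Finset.prod_eq_one fun m hm => Real.sign_of_pos (by linarith [hlt m hm])
    have h2 : ∑ l ∈ S, (if t l < y then ∏ m ∈ (insert b S).erase l, Real.sign (t l - t m) else 0) =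
        - ∑ l ∈ S, if t l < y then ∏ m ∈ S.erase l, Real.sign (t l - t m) else 0 := by
      rw [← Finset.sum_neg_distrib]
      refine Finset.sum_congr rfl fun l hl => ?_
      have hbl : b ≠ l := fun h => hb (h ▸ hl)
      rw [Finset.erase_insert_of_ne hbl, Finset.prod_insert (by simp [hb]),
        Real.sign_of_neg (by linarith [hlt l hl])]
      split_ifs <;> ring
    rw [h1, h2]
    rcases lt_or_gt_of_ne (hy b) with h | h
    · have h3 : ∏ m ∈ S, Real.sign (y - t m) = 1 :=
        Finset.prod_eq_one fun m hm => Real.sign_of_pos (by linarith [hlt m hm])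
      rw [h3] at ih ⊢
      rw [if_pos h, Real.sign_of_pos (by linarith), pow_succ]
      linear_combination -ih
    · rw [if_neg (not_lt.2 h.le), Real.sign_of_neg (by linarith), pow_succ]
      linear_combination -ih

theorem prod_sign_sub_removeNth {n : ℕ} {t : Fin (n + 1) → ℝ} (ht : Function.Injective t) {y : ℝ}
    (hy : ∀ m, t m ≠ y) :
    ∏ m, Real.sign (y - t m) = (-1) ^ (n + 1) +
      2 * ∑ l, if t l < y then ∏ m, Real.sign (t l - l.removeNth t m) else 0 := by
  rw [prod_sign_sub_eq ht hy, Finset.card_univ, Fintype.card_fin]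
  congr 3; ext l
  have : Finset.univ.erase l = Finset.univ.image l.succAbove := by
    rw [Fin.image_succAbove_univ, Finset.compl_singleton]
  rw [this, Finset.prod_image (Fin.succAbove_right_injective.injOn)]
  rfl

end JumpIdentity

/-! ### Lagrange interpolation and the kernel for β = 1. -/

section DensityOne
variable {α : ℝ} {n : ℕ}

/-- Lagrange interpolation at the nodes `z`, multiplied by the absolute value of the Vandermonde
determinant. -/
theorem betaJointWeight_one_mul_eval (w : ℝ → ℝ) (z : Fin (n + 1) → ℝ) {q : ℝ[X]}
    (hq : q.degree < (n + 1 : ℕ)) (x : ℝ) :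
    betaJointWeight 1 w z * q.eval x = ∑ l, w (z l) * (q.eval (z l) *
      ∏ m, ((x - l.removeNth z m) * Real.sign (z l - l.removeNth z m))) *
        betaJointWeight 1 w (l.removeNth z) := by
  by_cases hz : Function.Injective z
  · have hI := Lagrange.eq_interpolate (s := Finset.univ) (v := z) (f := q) hz.injOn (by simpa using hq)
    conv_lhs => rw [hI, Lagrange.interpolate_apply, eval_finsetSum, Finset.mul_sum]
    refine Finset.sum_congr rfl fun l _ => ?_
    rw [betaJointWeight_removeNth 1 w l z, eval_mul, eval_C, Lagrange.basis, eval_prod]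
    have : Finset.univ.erase l = Finset.univ.image l.succAbove := by
      rw [Fin.image_succAbove_univ, Finset.compl_singleton]
    rw [this, Finset.prod_image (Fin.succAbove_right_injective.injOn)]
    have e : (∏ i, |l.removeNth z i - z l| ^ 1) *
        ∏ i, (Lagrange.basisDivisor (z l) (z (l.succAbove i))).eval x =
        ∏ m, ((x - l.removeNth z m) * Real.sign (z l - l.removeNth z m)) := by
      rw [← Finset.prod_mul_distrib]
      refine Finset.prod_congr rfl fun i _ => ?_
      have hne : z l - z (l.succAbove i) ≠ 0 := sub_ne_zero.2 fun h =>
        Fin.succAbove_ne l i (hz h).symm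
      rw [Lagrange.basisDivisor, pow_one, Fin.removeNth, abs_sub_comm, ← Real.sign_mul_self_eq_abs]
      simp only [eval_mul, eval_C, eval_sub, eval_X]
      field_simp
    rw [← e]; ring
  · rw [betaJointWeight_eq_zero (by norm_num) w hz, zero_mul]
    refine (Finset.sum_eq_zero fun l _ => ?_).symm
    by_cases ht : Function.Injective (l.removeNth z)
    · obtain ⟨m, hm⟩ := exists_removeNth_eq hz ht
      rw [Finset.prod_eq_zero (Finset.mem_univ m) (by rw [hm]; simp)]
      ring
    · rw [betaJointWeight_eq_zero (by norm_num) w ht, mul_zero]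

/-- The kernel of the `β = 1` ensemble. -/
noncomputable def oneKernel (α : ℝ) (n : ℕ) (x y : ℝ) : ℝ :=
  ∫ t : Fin n → ℝ, (∏ m, ((x - t m) * Real.sign (y - t m))) * betaJointWeight 1 (laguerreWeight α) t

/-- The averaged characteristic polynomial. -/
noncomputable def oneMean (α : ℝ) (n : ℕ) (x : ℝ) : ℝ :=
  ∫ t : Fin n → ℝ, (∏ m, (x - t m)) * betaJointWeight 1 (laguerreWeight α) t

/-- The integrand of `oneKernelDeriv`. -/
noncomputable def onePoly (x : ℝ) (t : Fin n → ℝ) : ℝ[X] :=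
  (C x - X) * ∏ m, (C (x - t m) * (X - C (t m)))

/-- The derivative of the kernel of the `β = 1` ensemble, divided by the weight. -/
noncomputable def oneKernelDeriv (α : ℝ) : ℕ → ℝ → ℝ[X]
  | 0, _ => 0
  | n + 1, x => C (2 * ((n : ℝ) + 1)) *
      intPoly (n + 2) (onePoly x) (betaJointWeight 1 (laguerreWeight α) (n := n))

theorem onePoly_natDegree (x : ℝ) (t : Fin n → ℝ) : (onePoly x t).natDegree < n + 2 := by
  refine natDegree_mul_le.trans_lt ?_
  have h1 : (C x - X : ℝ[X]).natDegree ≤ 1 := by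
    rw [← neg_sub, natDegree_neg, natDegree_X_sub_C]
  have h2 : (∏ m, (C (x - t m) * (X - C (t m)))).natDegree ≤ n := by
    refine (natDegree_prod_le _ _).trans ((Finset.sum_le_card_nsmul _ _ 1 fun m _ => ?_).trans
      (by simp))
    exact (natDegree_C_mul_le _ _).trans (by rw [natDegree_X_sub_C])
  omega

theorem onePoly_eval (x : ℝ) (t : Fin n → ℝ) (u : ℝ) :
    (onePoly x t).eval u = (x - u) * ∏ m, ((x - t m) * (u - t m)) := by
  simp [onePoly, eval_prod]

theorem coeffGrowth_onePoly (x : ℝ) : CoeffGrowth (onePoly (n := n) x) := by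
  have h : CoeffGrowth fun _ : Fin n → ℝ => (C x - X : ℝ[X]) := fun k => PolyGrowth.const _
  exact h.mul (CoeffGrowth.prod _ fun m _ => (CoeffGrowth.C ((PolyGrowth.const x).sub
    (PolyGrowth.apply m))).mul (CoeffGrowth.X_sub_C (PolyGrowth.apply m)))

theorem oneKernelDeriv_degree (x : ℝ) : (oneKernelDeriv α n x).degree < (n + 1 : ℕ) := by
  rcases n with _ | n
  · rw [oneKernelDeriv, degree_zero]; exact WithBot.bot_lt_coe _
  · exact (degree_C_mul_le' _ _).trans_lt intPoly_degree_lt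

theorem oneKernelDeriv_eval (hα : -1 < α) (x u : ℝ) : (oneKernelDeriv α (n + 1) x).eval u =
    2 * ((n : ℝ) + 1) * ∫ t : Fin n → ℝ, (x - u) * (∏ m, ((x - t m) * (u - t m))) *
      betaJointWeight 1 (laguerreWeight α) t := by
  rw [oneKernelDeriv, eval_mul, eval_C, intPoly_eval (onePoly_natDegree x) fun k =>
    (coeffGrowth_onePoly x k).integrable_mul_betaJointWeight hα 1]
  simp only [onePoly_eval]

theorem oneKernelDeriv_swap (hα : -1 < α) (x u : ℝ) :
    (oneKernelDeriv α n x).eval u = - (oneKernelDeriv α n u).eval x := by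
  rcases n with _ | n
  · simp [oneKernelDeriv]
  · rw [oneKernelDeriv_eval hα, oneKernelDeriv_eval hα, ← mul_neg, ← integral_neg]
    congr 2; ext t
    have : ∏ m, ((x - t m) * (u - t m)) = ∏ m, ((u - t m) * (x - t m)) :=
      Finset.prod_congr rfl fun m _ => mul_comm _ _
    rw [this]; ring

theorem polyGrowth_ite {ι : Type*} [Fintype ι] {f : (ι → ℝ) → ℝ} (hf : PolyGrowth f)
    {p : (ι → ℝ) → Prop} [DecidablePred p] (hs : MeasurableSet {z | p z}) :
    PolyGrowth fun z => if p z then f z else 0 := by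
  obtain ⟨hm, C, k, hC⟩ := hf
  refine ⟨hm.ite hs measurable_const, C, k, fun z => ?_⟩
  dsimp only
  split_ifs
  · exact hC z
  · simpa using (abs_nonneg _).trans (hC z)

/-- The sum over the points below a threshold, integrated against the joint weight. -/
theorem sum_integral_jump (hα : -1 < α) (x : ℝ) {s : Set ℝ} (hs : MeasurableSet s)
    [DecidablePred (· ∈ s)] :
    (∀ l : Fin (n + 1), Integrable fun t : Fin (n + 1) → ℝ => (if t l ∈ s then
      (∏ m, (x - t m)) * ∏ m, Real.sign (t l - l.removeNth t m) else 0) *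
        betaJointWeight 1 (laguerreWeight α) t) ∧
    2 * ∑ l : Fin (n + 1), ∫ t : Fin (n + 1) → ℝ, (if t l ∈ s then
      (∏ m, (x - t m)) * ∏ m, Real.sign (t l - l.removeNth t m) else 0) *
        betaJointWeight 1 (laguerreWeight α) t =
      ∫ u in s, laguerreWeight α u * (oneKernelDeriv α (n + 1) x).eval u := by
  set w := laguerreWeight α with hw
  set F : ℝ → (Fin n → ℝ) → ℝ := fun u t => w u * (if u ∈ s then (x - u) *
    ∏ m, ((x - t m) * (u - t m)) else 0) * betaJointWeight 1 w t with hF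
  have hFi : Integrable fun z : Fin (n + 1) → ℝ => F (z 0) (Fin.tail z) := by
    refine PolyGrowth.integrable_cons ?_ hα 1
    have h0 := PolyGrowth.apply (ι := Fin (n + 1)) 0
    refine polyGrowth_ite (p := fun z : Fin (n + 1) → ℝ => z 0 ∈ s) ?_
      (measurable_pi_apply 0 hs)
    exact ((PolyGrowth.const x).sub h0).mul (PolyGrowth.prod _ fun m _ =>
      ((PolyGrowth.const x).sub (PolyGrowth.apply m.succ)).mul
        (h0.sub (PolyGrowth.apply m.succ)))
  have hFe : ∀ (l : Fin (n + 1)) (t : Fin (n + 1) → ℝ), F (t l) (l.removeNth t) = (if t l ∈ s then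
      (∏ m, (x - t m)) * ∏ m, Real.sign (t l - l.removeNth t m) else 0) *
        betaJointWeight 1 w t := fun l t => by
    simp only [hF]
    split_ifs
    · rw [betaJointWeight_removeNth 1 w l t, Fin.prod_univ_succAbove _ l]
      have : ∏ m, ((x - l.removeNth t m) * (t l - l.removeNth t m)) =
          (∏ m, (x - t (l.succAbove m))) * ((∏ m, Real.sign (t l - l.removeNth t m)) *
            ∏ i, |l.removeNth t i - t l| ^ 1) := by
        rw [← Finset.prod_mul_distrib, ← Finset.prod_mul_distrib]
        refine Finset.prod_congr rfl fun m _ => ?_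
        rw [pow_one, abs_sub_comm, ← Real.sign_mul_self_eq_abs, ← mul_assoc (Real.sign _)]
        -- This also holds at coincident points, where the sign and the difference are both 0.
        have hsq : Real.sign (t l - l.removeNth t m) * Real.sign (t l - l.removeNth t m) *
            (t l - l.removeNth t m) = t l - l.removeNth t m := by
          rw [mul_assoc, Real.sign_mul_self_eq_abs]
          rcases lt_trichotomy (t l - l.removeNth t m) 0 with h | h | h
          · rw [Real.sign_of_neg h, abs_of_neg h]; ring
          · rw [h]; simp
          · rw [Real.sign_of_pos h, abs_of_pos h]; ring
        rw [hsq]; rfl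
      rw [this]; ring
    · ring
  refine ⟨fun l => (integrable_removeNth hFi l).congr (Filter.Eventually.of_forall (hFe l)), ?_⟩
  rw [Finset.sum_congr rfl fun l _ => by rw [← integral_congr_ae
    (Filter.Eventually.of_forall (hFe l)), integral_removeNth hFi l]]
  rw [Finset.sum_const, Finset.card_univ, Fintype.card_fin, nsmul_eq_mul, ← integral_indicator hs,
    ← mul_assoc, ← integral_const_mul]
  congr 1; ext u
  by_cases hu : u ∈ s
  · rw [indicator_of_mem hu, oneKernelDeriv_eval hα]
    simp only [hF, if_pos hu, mul_assoc, integral_const_mul]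
    push_cast
    ring
  · rw [indicator_of_notMem hu]; simp [hF, hu]

theorem polyGrowth_prod_sub (x : ℝ) : PolyGrowth fun t : Fin n → ℝ => ∏ m, (x - t m) :=
  PolyGrowth.prod _ fun m _ => (PolyGrowth.const x).sub (PolyGrowth.apply m)

/-- The jump identity, averaged: jumps located at the eigenvalues become, after integration, the
density w(u) times a polynomial in u. -/
theorem oneKernel_eq (hα : -1 < α) (x y : ℝ) : oneKernel α n x y = (-1) ^ n * oneMean α n x +
    ∫ u in Iio y, laguerreWeight α u * (oneKernelDeriv α n x).eval u := by
  rcases n with _ | n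
  · simp [oneKernel, oneMean, oneKernelDeriv]
  classical
  obtain ⟨h1, h2⟩ := sum_integral_jump (n := n) hα x (measurableSet_Iio (a := y))
  rw [← h2, ← integral_finsetSum _ fun l _ => h1 l, oneMean, oneKernel, ← integral_const_mul,
    ← integral_const_mul, ← integral_add
      (((polyGrowth_prod_sub x).integrable_mul_betaJointWeight hα 1).const_mul _)
      ((integrable_finsetSum _ fun l _ => h1 l).const_mul _)]
  -- The jump identity fails if y is one of the points, which is a null set; repeated points have
  -- joint weight 0.
  have hae : ∀ᵐ t : Fin (n + 1) → ℝ, ∀ m, t m ≠ y :=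
    ae_all_iff.2 fun m => by
      rw [ae_iff]; simp only [not_not]; exact Measure.pi_hyperplane (fun _ : Fin (n + 1) => (volume : Measure ℝ)) m y
  refine integral_congr_ae (hae.mono fun t hy => ?_)
  dsimp only
  by_cases ht : Function.Injective t
  · rw [Finset.prod_mul_distrib, prod_sign_sub_removeNth ht hy, ← Finset.sum_mul]
    simp only [mem_Iio]
    rw [show (∑ l, if t l < y then (∏ m, (x - t m)) * ∏ m, Real.sign (t l - l.removeNth t m) else 0)
      = (∏ m, (x - t m)) * ∑ l, if t l < y then ∏ m, Real.sign (t l - l.removeNth t m) else 0 by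
      rw [Finset.mul_sum]; refine Finset.sum_congr rfl fun l _ => ?_; split_ifs <;> ring]
    ring
  · simp [betaJointWeight_eq_zero (show 1 ≠ 0 by norm_num) _ ht]

/-- The jump identity with y above all the points, where the product of signs is 1. -/
theorem integral_oneKernelDeriv (hα : -1 < α) (x : ℝ) :
    ∫ u, laguerreWeight α u * (oneKernelDeriv α n x).eval u =
      (1 - (-1) ^ n) * oneMean α n x := by
  rcases n with _ | n
  · simp [oneKernelDeriv]
  classical
  obtain ⟨h1, h2⟩ := sum_integral_jump (n := n) hα x MeasurableSet.univ
  rw [← setIntegral_univ, ← h2, ← integral_finsetSum _ fun l _ => h1 l, oneMean,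
    ← integral_const_mul, ← integral_const_mul]
  congr 1; ext t
  by_cases ht : Function.Injective t
  · obtain ⟨y, hy⟩ : ∃ y, ∀ m, t m < y := by
      obtain ⟨B, hB⟩ := (finite_range t).bddAbove
      exact ⟨B + 1, fun m => by linarith [hB (mem_range_self m)]⟩
    have h := prod_sign_sub_removeNth ht fun m => (hy m).ne
    rw [Finset.prod_eq_one fun m _ => Real.sign_of_pos (by linarith [hy m])] at h
    simp only [hy, if_true] at h
    simp only [mem_univ, if_true]
    rw [← Finset.sum_mul, ← Finset.mul_sum]
    linear_combination -(∏ m, (x - t m)) * betaJointWeight 1 (laguerreWeight α) t * h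
  · simp [betaJointWeight_eq_zero (show 1 ≠ 0 by norm_num) _ ht]

theorem measurable_sign : Measurable Real.sign := by
  unfold Real.sign
  exact Measurable.ite measurableSet_Iio measurable_const
    (Measurable.ite measurableSet_Ioi measurable_const measurable_const)

theorem PolyGrowth.sign {ι : Type*} [Fintype ι] {f : (ι → ℝ) → ℝ} (hf : PolyGrowth f) :
    PolyGrowth fun z => Real.sign (f z) := by
  refine PolyGrowth.of_bounded (measurable_sign.comp hf.1) (C := 1) fun z => ?_
  rcases Real.sign_apply_eq (f z) with h | h | h <;> simp [h]

/-- The integrated Lagrange identity: up to normalisation `oneKernel` reproduces polynomials of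
degree at most n. -/
theorem integral_oneKernel_mul_eval (hα : -1 < α) (x : ℝ) {q : ℝ[X]}
    (hq : q.degree < (n + 1 : ℕ)) :
    ((n : ℝ) + 1) * ∫ y, laguerreWeight α y * (oneKernel α n x y * q.eval y) =
      (∫ z : Fin (n + 1) → ℝ, betaJointWeight 1 (laguerreWeight α) z) * q.eval x := by
  set w := laguerreWeight α with hw
  set F : ℝ → (Fin n → ℝ) → ℝ := fun s t => w s * (q.eval s *
      ∏ m, ((x - t m) * Real.sign (s - t m))) * betaJointWeight 1 w t with hF
  have hFi : Integrable fun z : Fin (n + 1) → ℝ => F (z 0) (Fin.tail z) := by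
    refine PolyGrowth.integrable_cons ?_ hα 1
    have h0 := PolyGrowth.apply (ι := Fin (n + 1)) 0
    exact (h0.eval q).mul (PolyGrowth.prod _ fun m _ =>
      ((PolyGrowth.const x).sub (PolyGrowth.apply m.succ)).mul
        (h0.sub (PolyGrowth.apply m.succ)).sign)
  have e1 : ∫ y, w y * (oneKernel α n x y * q.eval y) = ∫ s, ∫ t, F s t := by
    congr 1; ext s
    simp only [hF, mul_assoc, integral_const_mul]
    rw [oneKernel]; ring
  have e2 : ∑ l : Fin (n + 1), ∫ z : Fin (n + 1) → ℝ, F (z l) (l.removeNth z) =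
      ((n : ℝ) + 1) * ∫ s, ∫ t, F s t := by
    rw [Finset.sum_congr rfl fun l _ => integral_removeNth hFi l]; simp
  rw [e1, ← e2, ← integral_finsetSum _ fun l _ => integrable_removeNth hFi l, ← integral_mul_const]
  congr 1; ext z
  rw [betaJointWeight_one_mul_eval w z hq x]

theorem betaDensity_one_eq_oneKernel (x : ℝ) :
    betaDensity 1 (laguerreWeight α) (n + 1) x = laguerreWeight α x * (((n : ℝ) + 1) *
      oneKernel α n x x / ∫ z : Fin (n + 1) → ℝ, betaJointWeight 1 (laguerreWeight α) z) := by
  have h : ∫ t : Fin n → ℝ, betaJointWeight 1 (laguerreWeight α) (Fin.cons x t : Fin (n + 1) → ℝ) =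
      laguerreWeight α x * oneKernel α n x x := by
    rw [oneKernel, ← integral_const_mul]
    congr 1; ext t
    rw [betaJointWeight_cons]
    simp only [pow_one, abs_sub_comm _ x, ← Real.sign_mul_self_eq_abs, mul_comm (Real.sign _)]
    ring
  rw [betaDensity, h]
  ring

end DensityOne

/-! ### Explicit primitives and integration by parts. -/

section LaguerrePrimitive
variable {α : ℝ}

/-- The first order operator `q ↦ x q' + (α + 1 - x) q`. -/
noncomputable def lagOp (α : ℝ) (q : ℝ[X]) : ℝ[X] := X * derivative q + (C (α + 1) - X) * q

/-- The primitive of `x ^ α * exp (-x) * lagOp α q`. -/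
noncomputable def lagPhi (α : ℝ) (q : ℝ[X]) (y : ℝ) : ℝ := y ^ (α + 1) * Real.exp (-y) * q.eval y

theorem lagPhi_zero (hα : -1 < α) (q : ℝ[X]) : lagPhi α q 0 = 0 := by
  rw [lagPhi, Real.zero_rpow (by linarith)]; ring

theorem lagPhi_eq {y : ℝ} (hy : 0 < y) (q : ℝ[X]) :
    lagPhi α q y = y * laguerreWeight α y * q.eval y := by
  rw [lagPhi, laguerreWeight_of_pos hy, Real.rpow_add_one hy.ne']; ring

theorem hasDerivAt_lagPhi (q : ℝ[X]) {y : ℝ} (hy : 0 < y) :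
    HasDerivAt (lagPhi α q) (laguerreWeight α y * (lagOp α q).eval y) y := by
  have h1 := Real.hasDerivAt_rpow_const (p := α + 1) (Or.inl hy.ne')
  have h2 : HasDerivAt (fun y => Real.exp (-y)) (-Real.exp (-y)) y := by
    simpa using (hasDerivAt_neg y).exp
  refine ((h1.fun_mul h2).fun_mul (q.hasDerivAt y)).congr_deriv ?_
  rw [laguerreWeight_of_pos hy, add_sub_cancel_right, Real.rpow_add_one hy.ne', lagOp]
  simp only [eval_add, eval_mul, eval_sub, eval_X, eval_C]
  ring

theorem continuous_lagPhi (hα : -1 < α) (q : ℝ[X]) : Continuous (lagPhi α q) :=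
  ((Real.continuous_rpow_const (by linarith)).mul (by fun_prop)).mul q.continuous

theorem tendsto_lagPhi (q : ℝ[X]) : Filter.Tendsto (lagPhi α q) Filter.atTop (nhds 0) := by
  induction q using Polynomial.induction_on' with
  | add p q hp hq =>
    have := hp.add hq
    rw [add_zero] at this
    refine this.congr fun y => ?_
    simp only [lagPhi, eval_add]; ring
  | monomial k c =>
    have := (tendsto_rpow_mul_exp_neg_mul_atTop_nhds_zero (α + 1 + k) 1 one_pos).const_mul c
    rw [mul_zero] at this
    refine this.congr' ((Filter.eventually_gt_atTop 0).mono fun y hy => ?_)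
    rw [lagPhi, eval_monomial, Real.rpow_add hy (α + 1), Real.rpow_natCast, neg_one_mul]; ring

theorem setIntegral_Iio_laguerreWeight_mul (f : ℝ → ℝ) {y : ℝ} (hy : 0 ≤ y) :
    ∫ u in Iio y, laguerreWeight α u * f u = ∫ u in (0 : ℝ)..y, laguerreWeight α u * f u := by
  rw [intervalIntegral.integral_of_le hy, ← integral_indicator measurableSet_Iio,
    ← integral_indicator measurableSet_Ioc]
  refine integral_congr_ae ?_
  have : ∀ᵐ u : ℝ, u ≠ y := by simp [ae_iff]
  refine this.mono fun u hu => ?_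
  by_cases h : u ∈ Ioc 0 y
  · rw [indicator_of_mem h, indicator_of_mem (show u ∈ Iio y from lt_of_le_of_ne h.2 hu)]
  · rw [indicator_of_notMem h]
    by_cases h' : u ∈ Iio y
    · have : ¬ 0 < u := fun h0 => h ⟨h0, (mem_Iio.1 h').le⟩
      rw [indicator_of_mem h', laguerreWeight, if_neg this, zero_mul]
    · rw [indicator_of_notMem h']

theorem intervalIntegral_lagOp (hα : -1 < α) (q : ℝ[X]) {y : ℝ} (hy : 0 ≤ y) :
    ∫ u in (0 : ℝ)..y, laguerreWeight α u * (lagOp α q).eval u = lagPhi α q y := by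
  rw [intervalIntegral.integral_eq_sub_of_hasDerivAt_of_le hy (continuous_lagPhi hα q).continuousOn
    (fun u hu => hasDerivAt_lagPhi q hu.1)
    (integrable_laguerreWeight_mul_eval hα _).intervalIntegrable, lagPhi_zero hα, sub_zero]

theorem continuous_primitive_laguerreWeight (hα : -1 < α) (q : ℝ[X]) :
    Continuous fun y => ∫ u in (0 : ℝ)..y, laguerreWeight α u * q.eval u :=
  intervalIntegral.continuous_primitive
    (fun _ _ => (integrable_laguerreWeight_mul_eval hα q).intervalIntegrable) 0

theorem abs_primitive_laguerreWeight_le (hα : -1 < α) (q : ℝ[X]) (y : ℝ) :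
    |∫ u in (0 : ℝ)..y, laguerreWeight α u * q.eval u| ≤
      ∫ u, |laguerreWeight α u * q.eval u| :=
  (intervalIntegral.norm_integral_le_integral_norm_uIoc).trans
    (setIntegral_le_integral (integrable_laguerreWeight_mul_eval hα q).norm
      (Filter.Eventually.of_forall fun _ => norm_nonneg _))

theorem hasDerivAt_primitive_laguerreWeight (hα : -1 < α) (q : ℝ[X]) {y : ℝ} (hy : 0 < y) :
    HasDerivAt (fun y => ∫ u in (0 : ℝ)..y, laguerreWeight α u * q.eval u)
      (laguerreWeight α y * q.eval y) y := by
  have hc : ContinuousAt (fun u => laguerreWeight α u * q.eval u) y := by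
    have : ContinuousAt (fun u => u ^ α * Real.exp (-u) * q.eval u) y :=
      ((Real.continuousAt_rpow_const y α (Or.inl hy.ne')).mul (by fun_prop)).mul q.continuous.continuousAt
    refine this.congr (Filter.eventually_of_mem (Ioi_mem_nhds hy) fun u hu => ?_)
    dsimp only
    rw [laguerreWeight_of_pos hu]
  exact intervalIntegral.integral_hasDerivAt_right
    (integrable_laguerreWeight_mul_eval hα q).intervalIntegrable
    (integrable_laguerreWeight_mul_eval hα q).aestronglyMeasurable.stronglyMeasurableAtFilter hc

/-- Integration by parts against a primitive of the weight. -/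
theorem integral_primitive_mul_lagOp (hα : -1 < α) (K : ℝ) (Q q : ℝ[X])
    (hi : IntegrableOn (fun u => laguerreWeight α u * Q.eval u * lagPhi α q u) (Ioi 0)) :
    ∫ y, laguerreWeight α y * ((K + ∫ u in (0 : ℝ)..y, laguerreWeight α u * Q.eval u) *
      (lagOp α q).eval y) = - ∫ u in Ioi 0, laguerreWeight α u * Q.eval u * lagPhi α q u := by
  set V : ℝ → ℝ := fun y => K + ∫ u in (0 : ℝ)..y, laguerreWeight α u * Q.eval u with hV
  have hVc : Continuous V := continuous_const.add (continuous_primitive_laguerreWeight hα Q)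
  have hVb : ∀ y, |V y| ≤ |K| + ∫ u, |laguerreWeight α u * Q.eval u| := fun y =>
    (abs_add_le _ _).trans (add_le_add le_rfl (abs_primitive_laguerreWeight_le hα Q y))
  have hVd : ∀ y, 0 < y → HasDerivAt V (laguerreWeight α y * Q.eval y) y := fun y hy =>
    (hasDerivAt_primitive_laguerreWeight hα Q hy).const_add K
  have h2 : Integrable fun y => V y * (laguerreWeight α y * (lagOp α q).eval y) :=
    (integrable_laguerreWeight_mul_eval hα _).bdd_mul hVc.aestronglyMeasurable
      (Filter.Eventually.of_forall hVb)
  have h3 := integral_Ioi_of_hasDerivAt_of_tendsto (a := 0) (m := 0) (f := fun y => V y * lagPhi α q y)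
    (f' := fun y => laguerreWeight α y * Q.eval y * lagPhi α q y +
      V y * (laguerreWeight α y * (lagOp α q).eval y))
    (hVc.mul (continuous_lagPhi hα q)).continuousWithinAt
    (fun y hy => (hVd y hy).fun_mul (hasDerivAt_lagPhi q hy)) (hi.add h2.integrableOn) (by
      refine squeeze_zero_norm (a := fun y => (|K| + ∫ u, |laguerreWeight α u * Q.eval u|) *
        |lagPhi α q y|) (fun y => ?_) ?_
      · rw [Real.norm_eq_abs, abs_mul]; gcongr; exact hVb y
      · simpa using ((tendsto_lagPhi q).abs).const_mul _)
  rw [lagPhi_zero hα, integral_add hi h2.integrableOn] at h3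
  have h4 : ∫ y, laguerreWeight α y * (V y * (lagOp α q).eval y) =
      ∫ y in Ioi 0, V y * (laguerreWeight α y * (lagOp α q).eval y) := by
    rw [← integral_indicator measurableSet_Ioi]
    congr 1; ext y
    by_cases hy : 0 < y
    · rw [indicator_of_mem (by exact hy)]; ring
    · rw [indicator_of_notMem (by exact hy), laguerreWeight, if_neg hy, zero_mul]
  rw [h4]
  linarith

end LaguerrePrimitive

/-! ### Doubling the variable: from weight exponent (a - 1)/2 to parameter a. -/

section Scaling
variable {a : ℝ}

/-- The substitution `p (2 x)`. -/
noncomputable def dbl (p : ℝ[X]) : ℝ[X] := p.comp (C 2 * X)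

theorem dbl_eval (p : ℝ[X]) (u : ℝ) : (dbl p).eval u = p.eval (2 * u) := by
  simp [dbl, eval_comp]

theorem dbl_derivative_eval (p : ℝ[X]) (u : ℝ) :
    (dbl p).derivative.eval u = 2 * p.derivative.eval (2 * u) := by
  simp [dbl, derivative_comp, eval_comp]

theorem exists_dbl_eq (q : ℝ[X]) : ∃ p, dbl p = q ∧ p.degree ≤ q.degree := by
  refine ⟨q.comp (C (1 / 2) * X), Polynomial.funext fun u => by simp [dbl_eval, eval_comp], ?_⟩
  by_cases hq : q = 0
  · simp [hq]
  refine degree_le_natDegree.trans ?_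
  rw [natDegree_comp, degree_eq_natDegree hq]
  refine Nat.cast_le.2 ?_
  have : (C (1 / 2) * X : ℝ[X]).natDegree ≤ 1 := by
    refine (natDegree_C_mul_le _ _).trans ?_
    rw [natDegree_X]
  nlinarith

theorem degree_dbl (p : ℝ[X]) : (dbl p).degree ≤ p.degree := by
  by_cases hp : p = 0
  · simp [hp, dbl]
  refine degree_le_natDegree.trans ?_
  rw [dbl, natDegree_comp, degree_eq_natDegree hp]
  refine Nat.cast_le.2 ?_
  have : (C 2 * X : ℝ[X]).natDegree ≤ 1 := by
    refine (natDegree_C_mul_le _ _).trans ?_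
    rw [natDegree_X]
  nlinarith

/-- For α = (a - 1)/2 the weight times u^(α+1) e^(-u) is u^a e^(-2u). Therefore the Laguerre
polynomials of parameter a at 2u are orthogonal for these integrals. -/
theorem laguerreWeight_mul_lagPhi (p q : ℝ[X]) {u : ℝ} (hu : 0 < u) :
    laguerreWeight ((a - 1) / 2) u * (dbl p).eval u * lagPhi ((a - 1) / 2) (dbl q) u =
      2 ^ (-a) * ((2 * u) ^ a * Real.exp (-(2 * u)) * (p * q).eval (2 * u)) := by
  rw [laguerreWeight_of_pos hu, lagPhi, dbl_eval, dbl_eval, eval_mul,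
    Real.mul_rpow (by norm_num) hu.le, Real.rpow_neg (by norm_num),
    show u ^ a = u ^ ((a - 1) / 2) * u ^ ((a - 1) / 2 + 1) by rw [← Real.rpow_add hu]; ring_nf,
    show Real.exp (-(2 * u)) = Real.exp (-u) * Real.exp (-u) by rw [← Real.exp_add]; ring_nf]
  have := (Real.rpow_pos_of_pos (show (0 : ℝ) < 2 by norm_num) a).ne'
  field_simp

theorem integrableOn_laguerreWeight_mul_lagPhi (ha : -1 < a) (p q : ℝ[X]) :
    IntegrableOn (fun u => laguerreWeight ((a - 1) / 2) u * (dbl p).eval u *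
      lagPhi ((a - 1) / 2) (dbl q) u) (Ioi 0) := by
  have h := lagMoment_integrable ha (p * q)
  have h' := (integrableOn_Ioi_comp_mul_left_iff
    (fun x => x ^ a * Real.exp (-x) * (p * q).eval x) 0 (show (0 : ℝ) < 2 by norm_num)).2
    (by rwa [mul_zero])
  exact IntegrableOn.congr_fun (h'.const_mul (2 ^ (-a)))
    (fun u hu => (laguerreWeight_mul_lagPhi p q hu).symm) measurableSet_Ioi

theorem integral_laguerreWeight_mul_lagPhi (p q : ℝ[X]) :
    ∫ u in Ioi 0, laguerreWeight ((a - 1) / 2) u * (dbl p).eval u *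
      lagPhi ((a - 1) / 2) (dbl q) u = 2 ^ (-a) / 2 * lagMoment a (p * q) := by
  rw [setIntegral_congr_fun measurableSet_Ioi fun u hu => laguerreWeight_mul_lagPhi p q hu,
    integral_const_mul, integral_comp_mul_left_Ioi (fun x => x ^ a * Real.exp (-x) * (p * q).eval x)
    0 (show (0 : ℝ) < 2 by norm_num), mul_zero, lagMoment, smul_eq_mul]
  ring

/-- The operator `q ↦ 2 x q' + (a + 1 - x) q`. -/
noncomputable def triOp (a : ℝ) (q : ℝ[X]) : ℝ[X] := 2 * X * derivative q + (C (a + 1) - X) * q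

theorem lagOp_dbl (q : ℝ[X]) : lagOp ((a - 1) / 2) (dbl q) = C (1 / 2) * dbl (triOp a q) := by
  refine Polynomial.funext fun u => ?_
  simp only [lagOp, triOp, eval_add, eval_mul, eval_sub, eval_X, eval_C, dbl_eval,
    dbl_derivative_eval, eval_ofNat]
  ring

theorem integral_triOp (ha : -1 < a) (q : ℝ[X]) {y : ℝ} (hy : 0 ≤ y) :
    ∫ u in (0 : ℝ)..y, laguerreWeight ((a - 1) / 2) u * (dbl (triOp a q)).eval u =
      2 * lagPhi ((a - 1) / 2) (dbl q) y := by
  rw [← intervalIntegral_lagOp (by linarith) _ hy, lagOp_dbl,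
    ← intervalIntegral.integral_const_mul]
  congr 1; ext u
  rw [eval_mul, eval_C]; ring

theorem lagMoment_triOp (ha : -1 < a) (q : ℝ[X]) :
    lagMoment ((a - 1) / 2) (dbl (triOp a q)) = 0 := by
  have h := lagMoment_parts (α := (a - 1) / 2) (by linarith) (dbl q)
  rw [show X * derivative (dbl q) + (C ((a - 1) / 2 + 1) - X) * dbl q =
    lagOp ((a - 1) / 2) (dbl q) from rfl, lagOp_dbl, lagMoment_C_mul] at h
  linarith

end Scaling

/-! ### The antisymmetric Laguerre kernel. -/

section OneStar
variable {a : ℝ}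

/-- The polynomial `(n + a) L_{n - 1}`. -/
noncomputable def lagLower (a : ℝ) (n : ℕ) : ℝ[X] :=
  C (n : ℝ) * lag a n - X * derivative (lag a n)

theorem lagLower_zero : lagLower a 0 = 0 := by simp [lagLower, lag_zero]

theorem lagLower_succ (n : ℕ) : lagLower a (n + 1) = C ((n : ℝ) + 1 + a) * lag a n := by
  refine Polynomial.funext fun x => ?_
  have := lag_X_mul_deriv a n x
  simp only [lagLower, eval_sub, eval_mul, eval_C, eval_X]
  push_cast
  linear_combination -this

theorem triOp_lag (n : ℕ) :
    triOp a (lag a n) = C ((n : ℝ) + 1) * lag a (n + 1) - lagLower a n := by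
  rcases n with _ | n
  · rw [lagLower_zero]; simp [triOp, lag_zero, lag_one]
  · refine Polynomial.funext fun x => ?_
    have := lag_tridiag a n x
    rw [lagLower_succ]
    simp only [triOp, eval_add, eval_sub, eval_mul, eval_C, eval_X, eval_ofNat]
    push_cast
    linear_combination this

theorem triOp_add (p q : ℝ[X]) : triOp a (p + q) = triOp a p + triOp a q := by
  simp only [triOp, derivative_add]; ring

theorem triOp_C_mul (c : ℝ) (q : ℝ[X]) : triOp a (C c * q) = C c * triOp a q := by
  simp only [triOp, derivative_C_mul]; ring

theorem degree_triOp (q : ℝ[X]) {n : ℕ} (hq : q.degree ≤ n) : (triOp a q).degree ≤ (n + 1 : ℕ) := by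
  have h1 : ∀ p : ℝ[X], p.degree ≤ n → (X * p).degree ≤ ((n + 1 : ℕ) : WithBot ℕ) := fun p hp => by
    rw [mul_comm]
    refine (degree_mul_le _ _).trans ?_
    rw [degree_X]; push_cast
    gcongr
  have h2 : ((n : ℕ) : WithBot ℕ) ≤ (n + 1 : ℕ) := Nat.cast_le.2 (by omega)
  rw [triOp, show 2 * X * derivative q + (C (a + 1) - X) * q =
    C 2 * (X * derivative q) + (C (a + 1) * q - X * q) by
      rw [show (C 2 : ℝ[X]) = 2 from rfl]; ring]
  refine (degree_add_le _ _).trans (max_le ((degree_C_mul_le' _ _).trans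
    (h1 _ ((degree_derivative_le).trans hq))) ((degree_sub_le _ _).trans (max_le
    ((degree_C_mul_le' _ _).trans (hq.trans h2)) (h1 _ hq))))

/-- The antisymmetric Laguerre kernel. -/
noncomputable def oneStar (a : ℝ) (n : ℕ) (ξ : ℝ) : ℝ[X] :=
  ∑ j ∈ Finset.range n, C (((j : ℝ) + 1) / lagNorm a j) *
    (C ((lag a j).eval ξ) * lag a (j + 1) - C ((lag a (j + 1)).eval ξ) * lag a j)

/-- The Christoffel-Darboux kernel. -/
noncomputable def lagSum (a : ℝ) (n : ℕ) (ξ : ℝ) : ℝ[X] :=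
  ∑ j ∈ Finset.range n, C ((lag a j).eval ξ / lagNorm a j) * lag a j

theorem oneStar_swap (n : ℕ) (ξ s : ℝ) : (oneStar a n ξ).eval s = - (oneStar a n s).eval ξ := by
  simp only [oneStar, eval_finsetSum, ← Finset.sum_neg_distrib]
  refine Finset.sum_congr rfl fun j _ => ?_
  simp only [eval_mul, eval_sub, eval_C]
  ring

theorem lagNorm_succ' (ha : -1 < a) (n : ℕ) :
    ((n : ℝ) + 1 + a) / lagNorm a (n + 1) = (n + 1) / lagNorm a n := by
  have hn := Nat.cast_nonneg (α := ℝ) n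
  have h1 := lagNorm_pos a n (by linarith)
  have h2 := lagNorm_pos a (n + 1) (by push_cast; linarith)
  rw [div_eq_div_iff h2.ne' h1.ne']
  linear_combination -lagNorm_succ a n (by linarith)

/-- The tridiagonal action telescopes up to a boundary term. Images of `triOp` have explicit
primitives, so only the boundary term contributes a genuine integral to the kernel. -/
theorem triOp_lagSum (ha : -1 < a) (n : ℕ) (ξ : ℝ) : triOp a (lagSum a n ξ) =
    oneStar a n ξ + C ((lag a n).eval ξ / lagNorm a n) * lagLower a n := by
  induction n with
  | zero => simp [lagSum, oneStar, lagLower_zero, triOp]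
  | succ n ih =>
    rw [show lagSum a (n + 1) ξ = lagSum a n ξ + C ((lag a n).eval ξ / lagNorm a n) * lag a n from
      Finset.sum_range_succ _ _, triOp_add, ih, triOp_C_mul, triOp_lag,
      show oneStar a (n + 1) ξ = oneStar a n ξ + _ from Finset.sum_range_succ _ _, lagLower_succ]
    refine Polynomial.funext fun x => ?_
    simp only [eval_add, eval_mul, eval_sub, eval_C]
    have := lagNorm_succ' ha n
    linear_combination -(lag a (n + 1)).eval ξ * (lag a n).eval x * this

theorem lagMoment_lag_mul (ha : -1 < a) (i j : ℕ) :
    lagMoment a (lag a i * lag a j) = if i = j then lagNorm a j else 0 := by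
  split_ifs with h
  · rw [h, lagMoment_sq ha]
  · exact lagMoment_orthogonal ha h

/-- Up to a constant these are the moments that the reproducing property forces on `oneKernelDeriv`
in `lagMoment_oneKernelDeriv`. -/
theorem lagMoment_oneStar (ha : -1 < a) {n k : ℕ} (hk : k < n) (ξ : ℝ) :
    lagMoment a (oneStar a n ξ * lag a k) = - (triOp a (lag a k)).eval ξ := by
  have hpos : ∀ j : ℕ, lagNorm a j ≠ 0 := fun j => (lagNorm_pos a j (by
    have := Nat.cast_nonneg (α := ℝ) j; linarith)).ne'
  have e : ∀ j : ℕ, lagMoment a (C (((j : ℝ) + 1) / lagNorm a j) *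
      (C ((lag a j).eval ξ) * lag a (j + 1) - C ((lag a (j + 1)).eval ξ) * lag a j) * lag a k) =
      (if j + 1 = k then ((j : ℝ) + 1) / lagNorm a j * ((lag a j).eval ξ * lagNorm a k) else 0) -
      if j = k then ((j : ℝ) + 1) / lagNorm a j * ((lag a (j + 1)).eval ξ * lagNorm a k) else 0 :=
    fun j => by
    rw [mul_assoc, lagMoment_C_mul, sub_mul, lagMoment_sub ha, mul_assoc, mul_assoc, lagMoment_C_mul,
      lagMoment_C_mul, lagMoment_lag_mul ha, lagMoment_lag_mul ha]
    split_ifs <;> ring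
  rw [oneStar, Finset.sum_mul, lagMoment_sum ha, Finset.sum_congr rfl fun j _ => e j,
    Finset.sum_sub_distrib, Finset.sum_ite_eq', if_pos (Finset.mem_range.2 hk), triOp_lag,
    eval_sub, eval_mul, eval_C]
  have hk0 := hpos k
  rcases k with _ | k
  · rw [lagLower_zero, Finset.sum_eq_zero fun j _ => if_neg (Nat.succ_ne_zero j)]
    simp; field_simp
  · simp only [add_left_inj]
    rw [lagLower_succ, Finset.sum_ite_eq', if_pos (Finset.mem_range.2 (by omega)), eval_mul, eval_C]
    have hk1 := hpos k
    have := lagNorm_succ a k (by have := Nat.cast_nonneg (α := ℝ) k; linarith)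
    push_cast
    field_simp
    linear_combination (lag a k).eval ξ * this

theorem oneStar_degree (n : ℕ) (ξ : ℝ) : (oneStar a n ξ).degree < (n + 1 : ℕ) := by
  refine (degree_sum_le _ _).trans_lt ((Finset.sup_lt_iff (WithBot.bot_lt_coe _)).2 fun j hj => ?_)
  have hj := Finset.mem_range.1 hj
  refine (degree_C_mul_le' _ _).trans_lt ((degree_sub_le _ _).trans_lt (max_lt ?_ ?_)) <;>
  · refine (degree_C_mul_le' _ _).trans_lt ?_
    rw [lag_degree]; exact Nat.cast_lt.2 (by omega)

theorem eq_sum_lagMoment (ha : -1 < a) {n : ℕ} {q : ℝ[X]} (hq : q.degree < n) :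
    q = ∑ k ∈ Finset.range n, C (lagMoment a (q * lag a k) / lagNorm a k) * lag a k := by
  refine Polynomial.degree_lt_induction (S := lag a) (p := fun q =>
    q = ∑ k ∈ Finset.range n, C (lagMoment a (q * lag a k) / lagNorm a k) * lag a k) (lag_degree a)
    (by simp [lagMoment_zero]) (fun q r hq hr => ?_) (fun c q hq => ?_) n (fun i hi => ?_) hq
  · nth_rw 1 [hq, hr]
    rw [← Finset.sum_add_distrib]
    refine Finset.sum_congr rfl fun k _ => ?_
    rw [add_mul, lagMoment_add ha, add_div, C_add, add_mul]
  · nth_rw 1 [hq]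
    rw [Finset.mul_sum]
    refine Finset.sum_congr rfl fun k _ => ?_
    rw [mul_assoc, lagMoment_C_mul, mul_div_assoc, C_mul, mul_assoc]
  · rw [Finset.sum_eq_single i]
    · rw [lagMoment_sq ha, div_self (lagNorm_pos a i (by
        have := Nat.cast_nonneg (α := ℝ) i; linarith)).ne', C_1, one_mul]
    · intro k _ hk
      rw [lagMoment_orthogonal ha (Ne.symm hk)]; simp
    · intro h; exact absurd (Finset.mem_range.2 hi) h

theorem lagMoment_mul_lag_eq_zero (ha : -1 < a) {n : ℕ} {q : ℝ[X]} (hq : q.degree < n) :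
    lagMoment a (q * lag a n) = 0 := by
  rw [eq_sum_lagMoment ha hq, Finset.sum_mul, lagMoment_sum ha]
  refine Finset.sum_eq_zero fun k hk => ?_
  rw [mul_assoc, lagMoment_C_mul, lagMoment_orthogonal ha (Finset.mem_range.1 hk).ne, mul_zero]

end OneStar

/-! ### Determination of the derivative of the β = 1 kernel. -/

section OneKernel
variable {a : ℝ} {n : ℕ}

theorem weight_mul_oneKernel (hα : -1 < (a - 1) / 2) (x : ℝ) (f : ℝ → ℝ) (y : ℝ) :
    laguerreWeight ((a - 1) / 2) y * (oneKernel ((a - 1) / 2) n x y * f y) =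
    laguerreWeight ((a - 1) / 2) y * (((-1) ^ n * oneMean ((a - 1) / 2) n x +
      ∫ u in (0 : ℝ)..y, laguerreWeight ((a - 1) / 2) u *
        (oneKernelDeriv ((a - 1) / 2) n x).eval u) * f y) := by
  by_cases hy : 0 < y
  · rw [oneKernel_eq hα, setIntegral_Iio_laguerreWeight_mul _ hy.le]
  · rw [laguerreWeight, if_neg hy, zero_mul, zero_mul]

/-- The ratio of the normalisation constant to the number of eigenvalues. -/
noncomputable def oneRatio (a : ℝ) (n : ℕ) : ℝ :=
  (∫ z : Fin (n + 1) → ℝ, betaJointWeight 1 (laguerreWeight ((a - 1) / 2)) z) / (n + 1)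

theorem integral_oneKernel (hα : -1 < (a - 1) / 2) (x : ℝ) {q : ℝ[X]}
    (hq : q.degree < (n + 1 : ℕ)) :
    ∫ y, laguerreWeight ((a - 1) / 2) y * (((-1) ^ n * oneMean ((a - 1) / 2) n x +
      ∫ u in (0 : ℝ)..y, laguerreWeight ((a - 1) / 2) u *
        (oneKernelDeriv ((a - 1) / 2) n x).eval u) * q.eval y) = oneRatio a n * q.eval x := by
  have h := integral_oneKernel_mul_eval hα x hq
  have hn : (n : ℝ) + 1 ≠ 0 := by positivity
  simp only [weight_mul_oneKernel hα x (fun y => q.eval y)] at h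
  rw [oneRatio, div_mul_eq_mul_div, eq_div_iff hn, ← h]
  ring

/-- The reproducing property is tested on `lagOp` of L_k(2·). Integration by parts removes the
unknown constant of the kernel and leaves a moment of its derivative; k < n keeps the degree of the
test polynomial at most n. -/
theorem lagMoment_oneKernelDeriv (ha : -1 < a) (x : ℝ) {Q : ℝ[X]}
    (hQ : dbl Q = oneKernelDeriv ((a - 1) / 2) n x) {k : ℕ} (hk : k < n) :
    lagMoment a (Q * lag a k) = - (2 ^ a * oneRatio a n * (triOp a (lag a k)).eval (2 * x)) := by
  have hα : -1 < (a - 1) / 2 := by linarith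
  have hd : (lagOp ((a - 1) / 2) (dbl (lag a k))).degree < (n + 1 : ℕ) := by
    rw [lagOp_dbl]
    refine (degree_C_mul_le' _ _).trans_lt ((degree_dbl _).trans_lt
      ((degree_triOp _ (lag_degree a k).le).trans_lt (Nat.cast_lt.2 (by omega))))
  have h := integral_oneKernel hα x hd
  rw [integral_primitive_mul_lagOp hα _ _ _ (by
      rw [← hQ]; exact integrableOn_laguerreWeight_mul_lagPhi ha _ _), ← hQ,
    integral_laguerreWeight_mul_lagPhi, lagOp_dbl, eval_mul, eval_C, dbl_eval,
    Real.rpow_neg (by norm_num)] at h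
  have := (Real.rpow_pos_of_pos (show (0 : ℝ) < 2 by norm_num) a).ne'
  field_simp at h
  linear_combination -h

theorem oneKernelDeriv_eq (ha : -1 < a) (x : ℝ) : oneKernelDeriv ((a - 1) / 2) n x =
    C (2 ^ a * oneRatio a n) * dbl (oneStar a n (2 * x)) := by
  have hα : -1 < (a - 1) / 2 := by linarith
  -- The difference has degree at most n and vanishing moments against L_k for k < n, so it is a
  -- multiple of L_n.
  have hc : ∀ x, ∃ c, ∀ u, (oneKernelDeriv ((a - 1) / 2) n x).eval u -
      2 ^ a * oneRatio a n * (oneStar a n (2 * x)).eval (2 * u) = c * (lag a n).eval (2 * u) := by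
    intro x
    obtain ⟨Q, hQ, hQd⟩ := exists_dbl_eq (oneKernelDeriv ((a - 1) / 2) n x)
    set D := Q - C (2 ^ a * oneRatio a n) * oneStar a n (2 * x) with hD
    have hDd : D.degree < (n + 1 : ℕ) := (degree_sub_le _ _).trans_lt
      (max_lt (hQd.trans_lt (oneKernelDeriv_degree x))
        ((degree_C_mul_le' _ _).trans_lt (oneStar_degree _ _)))
    refine ⟨lagMoment a (D * lag a n) / lagNorm a n, fun u => ?_⟩
    have h := eq_sum_lagMoment ha hDd
    rw [Finset.sum_range_succ, Finset.sum_eq_zero, zero_add] at h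
    · have h' := congrArg (fun p => p.eval (2 * u)) h
      simp only [eval_mul, eval_C] at h'
      rw [← h', hD, ← hQ, dbl_eval, eval_sub, eval_mul, eval_C]
    · intro k hk
      have hk := Finset.mem_range.1 hk
      have : lagMoment a (D * lag a k) = 0 := by
        rw [hD, sub_mul, lagMoment_sub ha, mul_assoc, lagMoment_C_mul, lagMoment_oneStar ha hk,
          lagMoment_oneKernelDeriv ha x hQ hk]
        ring
      rw [this]; simp
  choose c hc using hc
  have hanti : ∀ x u, c x * (lag a n).eval (2 * u) = - (c u * (lag a n).eval (2 * x)) := by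
    intro x u
    rw [← hc, ← hc, oneKernelDeriv_swap hα x u, oneStar_swap n (2 * x)]
    ring
  -- Antisymmetry at x = u = s/2 forces the factor to vanish there; antisymmetry between x and s/2
  -- then forces it to vanish everywhere.
  obtain ⟨s, hs⟩ : ∃ s, (lag a n).eval s ≠ 0 := by
    by_contra! h
    have h0 : lag a n = 0 := Polynomial.funext fun s => by rw [h, eval_zero]
    have := lag_degree a n
    rw [h0, degree_zero] at this
    exact absurd this (by simp)
  have hs' : (lag a n).eval (2 * (s / 2)) ≠ 0 := by rwa [mul_div_cancel₀ s two_ne_zero]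
  have h1 : c (s / 2) = 0 := by
    have := hanti (s / 2) (s / 2)
    have h2 : c (s / 2) * (lag a n).eval (2 * (s / 2)) = 0 := by linarith
    exact (mul_eq_zero.1 h2).resolve_right hs'
  have h2 : c x = 0 := by
    have := hanti x (s / 2)
    rw [h1, zero_mul, neg_zero] at this
    exact (mul_eq_zero.1 this).resolve_right hs'
  refine Polynomial.funext fun u => ?_
  have := hc x u
  rw [h2, zero_mul] at this
  rw [eval_mul, eval_C, dbl_eval]
  linarith

/-- The primitive of `(n + a) L_{n - 1}(2 u)` against the weight. -/
noncomputable def lowPrim (a : ℝ) (n : ℕ) (x : ℝ) : ℝ :=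
  ∫ u in (0 : ℝ)..x, laguerreWeight ((a - 1) / 2) u * (dbl (lagLower a n)).eval u

theorem integral_oneKernelDeriv_eq (ha : -1 < a) (x : ℝ) {y : ℝ} (hy : 0 ≤ y) :
    ∫ u in (0 : ℝ)..y, laguerreWeight ((a - 1) / 2) u * (oneKernelDeriv ((a - 1) / 2) n x).eval u =
      2 ^ a * oneRatio a n * (2 * lagPhi ((a - 1) / 2) (dbl (lagSum a n (2 * x))) y -
        (lag a n).eval (2 * x) / lagNorm a n * lowPrim a n y) := by
  have hα : -1 < (a - 1) / 2 := by linarith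
  have hi := fun p : ℝ[X] => (integrable_laguerreWeight_mul_eval hα p).intervalIntegrable
    (a := 0) (b := y)
  rw [← integral_triOp ha _ hy, triOp_lagSum ha, oneKernelDeriv_eq ha, lowPrim,
    ← intervalIntegral.integral_const_mul, ← intervalIntegral.integral_sub (hi _)
      ((hi _).const_mul _), ← intervalIntegral.integral_const_mul]
  congr 1; ext u
  simp only [eval_mul, eval_C, dbl_eval, eval_add]
  ring

end OneKernel

/-! ### The averaged characteristic polynomial and the density for β = 1. -/

section OneConstant
variable {a : ℝ} {n : ℕ}

/-- The moment of `triOp` of L_(2k+1) is zero, which relates the moments in degrees 2k and 2k + 2.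
-/
theorem lagMoment_dbl_lag_even (ha : -1 < a) (k : ℕ) :
    lagMoment ((a - 1) / 2) (dbl (lag a (2 * k))) =
      Real.Gamma (k + (a + 1) / 2) / k.factorial := by
  have hα : -1 < (a - 1) / 2 := by linarith
  induction k with
  | zero =>
    have := lagMoment_monomial hα 0 1
    rw [monomial_zero_left, C_1, one_mul] at this
    rw [mul_zero, lag_zero, show dbl 1 = 1 from one_comp, this]
    simp
    congr 1; ring
  | succ k ih =>
    have h := lagMoment_triOp ha (lag a (2 * k + 1))
    have hk : 0 < (k : ℝ) + (a + 1) / 2 := by have := Nat.cast_nonneg (α := ℝ) k; linarith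
    have e : dbl (triOp a (lag a (2 * k + 1))) = C (2 * (k : ℝ) + 2) * dbl (lag a (2 * (k + 1))) -
        C (2 * (k : ℝ) + 1 + a) * dbl (lag a (2 * k)) := by
      refine Polynomial.funext fun u => ?_
      rw [triOp_lag, lagLower_succ]
      simp only [dbl_eval, eval_sub, eval_mul, eval_C]
      rw [show 2 * (k + 1) = 2 * k + 1 + 1 by ring]
      push_cast
      ring
    rw [e, lagMoment_sub hα, lagMoment_C_mul, lagMoment_C_mul, ih] at h
    have h1 : (k.factorial : ℝ) ≠ 0 := by exact_mod_cast k.factorial_ne_zero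
    have h2 : (k : ℝ) + 1 ≠ 0 := by positivity
    rw [Nat.factorial_succ]
    push_cast
    rw [show (k : ℝ) + 1 + (a + 1) / 2 = (k + (a + 1) / 2) + 1 by ring, Real.Gamma_add_one hk.ne']
    rw [eq_div_iff (mul_ne_zero h2 h1)]
    generalize Real.Gamma (k + (a + 1) / 2) = G at *
    field_simp at h
    linear_combination 1 / 2 * h

/-- The coefficient of `L_n` in the averaged characteristic polynomial. -/
noncomputable def oneConst (a : ℝ) (n : ℕ) : ℝ :=
  Real.Gamma ((n : ℝ) / 2 + 1) / Real.Gamma (((n : ℝ) + a + 1) / 2)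

theorem lagSum_degree (ξ : ℝ) : (lagSum a n ξ).degree < n := by
  refine (degree_sum_le _ _).trans_lt ((Finset.sup_lt_iff (WithBot.bot_lt_coe _)).2 fun j hj => ?_)
  refine (degree_C_mul_le' _ _).trans_lt ?_
  rw [lag_degree]; exact Nat.cast_lt.2 (Finset.mem_range.1 hj)

theorem triOp_lagPrim (j : ℕ) : triOp a (lagPrim a j) = C 2 * lag a (2 * j + 1) := by
  refine Polynomial.funext fun x => ?_
  have := lagPrim_spec a j x
  simp only [triOp, eval_add, eval_sub, eval_mul, eval_C, eval_X, eval_ofNat]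
  linear_combination this

/-- For even index `lagLower` is a multiple of an odd Laguerre polynomial, which is an image of
`triOp` by the choice of `lagPrim`. -/
theorem exists_lowPrim_even (ha : -1 < a) (k : ℕ) : ∃ P : ℝ[X], P.degree < (2 * k : ℕ) ∧
    ∀ y, 0 ≤ y → lowPrim a (2 * k) y = lagPhi ((a - 1) / 2) (dbl P) y := by
  rcases k with _ | k
  · refine ⟨0, by simp, fun y _ => ?_⟩
    simp [lowPrim, lagLower_zero, dbl, lagPhi]
  · refine ⟨C (2 * (k : ℝ) + 2 + a) * lagPrim a k, (degree_C_mul_le' _ _).trans_lt ?_, fun y hy => ?_⟩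
    · rw [lagPrim_degree]; exact Nat.cast_lt.2 (by omega)
    · have h := integral_triOp ha (C (2 * (k : ℝ) + 2 + a) * lagPrim a k) hy
      have e : lagLower a (2 * (k + 1)) =
          C (1 / 2) * triOp a (C (2 * (k : ℝ) + 2 + a) * lagPrim a k) := by
        rw [triOp_C_mul, triOp_lagPrim, show 2 * (k + 1) = 2 * k + 1 + 1 by ring, lagLower_succ]
        refine Polynomial.funext fun x => ?_
        simp only [eval_mul, eval_C]
        push_cast; ring
      rw [lowPrim, e, show (fun u => laguerreWeight ((a - 1) / 2) u * (dbl (C (1 / 2) *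
        triOp a (C (2 * (k : ℝ) + 2 + a) * lagPrim a k))).eval u) = fun u => 1 / 2 *
        (laguerreWeight ((a - 1) / 2) u * (dbl (triOp a (C (2 * (k : ℝ) + 2 + a) *
          lagPrim a k))).eval u) by
          ext u; simp only [dbl_eval, eval_mul, eval_C]; ring,
        intervalIntegral.integral_const_mul, h]
      ring

theorem integral_lag_mul_lagPhi (ha : -1 < a) {P : ℝ[X]} (hP : P.degree < n) :
    ∫ u in Ioi 0, laguerreWeight ((a - 1) / 2) u * (dbl (lag a n)).eval u *
      lagPhi ((a - 1) / 2) (dbl P) u = 0 := by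
  rw [integral_laguerreWeight_mul_lagPhi, mul_comm, mul_comm (lag a n),
    lagMoment_mul_lag_eq_zero ha hP, zero_mul]

/-- The reproducing property is tested on L_(2k)(2·). The integral part of the kernel is a weight
times a polynomial of degree below 2k, orthogonal to it, so only the constant contributes. -/
theorem oneMean_even (ha : -1 < a) (k : ℕ) (x : ℝ) :
    (-1) ^ (2 * k) * oneMean ((a - 1) / 2) (2 * k) x =
      oneRatio a (2 * k) * oneConst a (2 * k) * (lag a (2 * k)).eval (2 * x) := by
  have hα : -1 < (a - 1) / 2 := by linarith
  obtain ⟨P, hPd, hP⟩ := exists_lowPrim_even ha k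
  have hd : (dbl (lag a (2 * k))).degree < (2 * k + 1 : ℕ) :=
    (degree_dbl _).trans_lt (by rw [lag_degree]; exact Nat.cast_lt.2 (by omega))
  have h := integral_oneKernel hα x hd
  set K := (-1) ^ (2 * k) * oneMean ((a - 1) / 2) (2 * k) x
  set w := laguerreWeight ((a - 1) / 2) with hw
  set S : ℝ[X] := C (2 ^ a * oneRatio a (2 * k)) * (C 2 * lagSum a (2 * k) (2 * x) -
    C ((lag a (2 * k)).eval (2 * x) / lagNorm a (2 * k)) * P) with hS
  have hSd : S.degree < (2 * k : ℕ) := (degree_C_mul_le' _ _).trans_lt ((degree_sub_le _ _).trans_lt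
    (max_lt ((degree_C_mul_le' _ _).trans_lt (lagSum_degree _)) ((degree_C_mul_le' _ _).trans_lt hPd)))
  have hQ : ∀ y, 0 ≤ y → ∫ u in (0 : ℝ)..y, w u * (oneKernelDeriv ((a - 1) / 2) (2 * k) x).eval u =
      lagPhi ((a - 1) / 2) (dbl S) y := fun y hy => by
    rw [integral_oneKernelDeriv_eq ha x hy, hP y hy]
    simp only [lagPhi, dbl_eval, hS, eval_mul, eval_sub, eval_C]
    ring
  have e : ∀ y, w y * ((K + ∫ u in (0 : ℝ)..y, w u *
      (oneKernelDeriv ((a - 1) / 2) (2 * k) x).eval u) * (dbl (lag a (2 * k))).eval y) =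
      K * (w y * (dbl (lag a (2 * k))).eval y) + (Ioi (0 : ℝ)).indicator (fun u => w u *
        (dbl (lag a (2 * k))).eval u * lagPhi ((a - 1) / 2) (dbl S) u) y := fun y => by
    by_cases hy : 0 < y
    · rw [indicator_of_mem (by exact hy), hQ y hy.le]; ring
    · rw [indicator_of_notMem (by exact hy), hw, laguerreWeight, if_neg hy]; ring
  simp only [e] at h
  rw [integral_add ((integrable_laguerreWeight_mul_eval hα _).const_mul K)
    ((integrable_indicator_iff measurableSet_Ioi).2 (integrableOn_laguerreWeight_mul_lagPhi ha _ _)),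
    integral_indicator measurableSet_Ioi, integral_lag_mul_lagPhi ha hSd, add_zero,
    integral_const_mul, integral_laguerreWeight_mul_eval, lagMoment_dbl_lag_even ha, dbl_eval] at h
  have hk : 0 < (k : ℝ) + (a + 1) / 2 := by have := Nat.cast_nonneg (α := ℝ) k; linarith
  have hG := (Real.Gamma_pos_of_pos hk).ne'
  have h1 : (k.factorial : ℝ) ≠ 0 := by exact_mod_cast k.factorial_ne_zero
  rw [oneConst]
  push_cast
  rw [show 2 * (k : ℝ) / 2 + 1 = k + 1 by ring, Real.Gamma_nat_eq_factorial,
    show (2 * (k : ℝ) + a + 1) / 2 = k + (a + 1) / 2 by ring]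
  clear_value K
  generalize Real.Gamma (k + (a + 1) / 2) = G at *
  field_simp at h ⊢
  linear_combination h

/-- Legendre's duplication formula, used for both Gamma factors, brings the odd constant to the form
of the even one. -/
theorem gamma_duplication_ratio (ha : -1 < a) (k : ℕ) :
    2 ^ a / (2 * lagNorm a (2 * k + 1)) * ((2 * k + 1 + a) *
      (Real.Gamma (k + (a + 1) / 2) / k.factorial)) = oneConst a (2 * k + 1) := by
  have hk := Nat.cast_nonneg (α := ℝ) k
  have d1 := Real.Gamma_mul_Gamma_add_half ((k : ℝ) + (a + 1) / 2)
  have d2 := Real.Gamma_mul_Gamma_add_half ((k : ℝ) + 1)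
  rw [show (k : ℝ) + (a + 1) / 2 + 1 / 2 = k + 1 + a / 2 by ring,
    show 2 * ((k : ℝ) + (a + 1) / 2) = 2 * k + 1 + a by ring,
    show 1 - (2 * (k : ℝ) + 1 + a) = -(2 * k) + -a by ring, Real.rpow_add (by norm_num),
    Real.rpow_neg (by norm_num) a] at d1
  rw [Real.Gamma_nat_eq_factorial, show (k : ℝ) + 1 + 1 / 2 = k + 3 / 2 by ring,
    show 2 * ((k : ℝ) + 1) = ((2 * k + 1 : ℕ) : ℝ) + 1 by push_cast; ring,
    Real.Gamma_nat_eq_factorial,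
    show 1 - (((2 * k + 1 : ℕ) : ℝ) + 1) = -(2 * k) + -1 by push_cast; ring,
    Real.rpow_add (by norm_num), Real.rpow_neg_one] at d2
  have p1 := Real.Gamma_pos_of_pos (show 0 < (k : ℝ) + (a + 1) / 2 by linarith)
  have p2 := Real.Gamma_pos_of_pos (show 0 < (k : ℝ) + 1 + a / 2 by linarith)
  have p3 := Real.Gamma_pos_of_pos (show 0 < 2 * (k : ℝ) + 1 + a by linarith)
  have f1 : (0 : ℝ) < k.factorial := by exact_mod_cast k.factorial_pos
  have f2 : (0 : ℝ) < (2 * k + 1).factorial := by exact_mod_cast (2 * k + 1).factorial_pos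
  have q1 := Real.rpow_pos_of_pos (show (0 : ℝ) < 2 by norm_num) a
  have q2 := Real.rpow_pos_of_pos (show (0 : ℝ) < 2 by norm_num) (-(2 * (k : ℝ)))
  have q3 : 0 < √Real.pi := Real.sqrt_pos.2 Real.pi_pos
  have hc : 2 * (k : ℝ) + 1 + a ≠ 0 := by linarith
  rw [oneConst, lagNorm]
  push_cast
  rw [show (2 * (k : ℝ) + 1) / 2 + 1 = k + 3 / 2 by ring,
    show (2 * (k : ℝ) + 1 + a + 1) / 2 = k + 1 + a / 2 by ring, Real.Gamma_add_one hc]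
  rw [eq_div_iff p2.ne', ← mul_right_inj' f1.ne', d2]
  have : Real.Gamma (k + 1 + a / 2) = Real.Gamma (2 * k + 1 + a) *
      (2 ^ (-(2 * (k : ℝ))) * (2 ^ a)⁻¹) * √Real.pi / Real.Gamma (k + (a + 1) / 2) := by
    rw [eq_div_iff p1.ne', ← d1]; ring
  rw [this]
  clear this d1 d2
  generalize Real.Gamma (k + (a + 1) / 2) = G at *
  field_simp

/-- For odd n, `integral_oneKernelDeriv` gives twice the mean; in the known derivative only the
boundary term of `triOp_lagSum` has nonzero integral. -/
theorem oneMean_odd (ha : -1 < a) (k : ℕ) (x : ℝ) :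
    (-1) ^ (2 * k + 1) * oneMean ((a - 1) / 2) (2 * k + 1) x =
      oneRatio a (2 * k + 1) * oneConst a (2 * k + 1) * (lag a (2 * k + 1)).eval (2 * x) := by
  have hα : -1 < (a - 1) / 2 := by linarith
  have h := integral_oneKernelDeriv (n := 2 * k + 1) hα x
  have hpow : (-1 : ℝ) ^ (2 * k + 1) = -1 := Odd.neg_one_pow ⟨k, rfl⟩
  have e : oneStar a (2 * k + 1) (2 * x) = triOp a (lagSum a (2 * k + 1) (2 * x)) -
      C ((lag a (2 * k + 1)).eval (2 * x) / lagNorm a (2 * k + 1) * (2 * k + 1 + a)) *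
        lag a (2 * k) := by
    rw [triOp_lagSum ha, lagLower_succ, C_mul, mul_assoc]; push_cast; ring
  have e2 : dbl (oneStar a (2 * k + 1) (2 * x)) =
      dbl (triOp a (lagSum a (2 * k + 1) (2 * x))) -
      C ((lag a (2 * k + 1)).eval (2 * x) / lagNorm a (2 * k + 1) * (2 * k + 1 + a)) *
        dbl (lag a (2 * k)) := by
    rw [e]; simp [dbl, sub_comp, mul_comp]
  rw [integral_laguerreWeight_mul_eval, oneKernelDeriv_eq ha, lagMoment_C_mul, e2,
    lagMoment_sub hα, lagMoment_triOp ha, lagMoment_C_mul, lagMoment_dbl_lag_even ha, hpow] at h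
  rw [← gamma_duplication_ratio ha, hpow]
  linear_combination 1 / 2 * h

theorem oneMean_eq (ha : -1 < a) (n : ℕ) (x : ℝ) :
    (-1) ^ n * oneMean ((a - 1) / 2) n x =
      oneRatio a n * oneConst a n * (lag a n).eval (2 * x) := by
  rcases Nat.even_or_odd' n with ⟨k, rfl | rfl⟩
  · exact oneMean_even ha k x
  · exact oneMean_odd ha k x

/-- The density of the `β = 1` ensemble. -/
theorem betaDensity_one (ha : -1 < a) (n : ℕ) {x : ℝ} (hx : 0 < x) :
    betaDensity 1 (laguerreWeight ((a - 1) / 2)) (n + 1) x = laguerreWeight ((a - 1) / 2) x *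
      (oneConst a n * (lag a n).eval (2 * x) + 2 ^ a *
        (2 * (x * laguerreWeight ((a - 1) / 2) x * (lagSum a n (2 * x)).eval (2 * x)) -
          (lag a n).eval (2 * x) / lagNorm a n * lowPrim a n x)) := by
  have hα : -1 < (a - 1) / 2 := by linarith
  have hZ := integral_betaJointWeight_pos 1 hα (n + 1)
  have hn : (n : ℝ) + 1 ≠ 0 := by positivity
  have hr : oneRatio a n ≠ 0 := div_ne_zero hZ.ne' hn
  have e : ((n : ℝ) + 1) * oneKernel ((a - 1) / 2) n x x /
      ∫ z : Fin (n + 1) → ℝ, betaJointWeight 1 (laguerreWeight ((a - 1) / 2)) z =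
      oneKernel ((a - 1) / 2) n x x / oneRatio a n := by
    rw [oneRatio]; field_simp
  rw [betaDensity_one_eq_oneKernel, e, oneKernel_eq hα,
    setIntegral_Iio_laguerreWeight_mul _ hx.le, integral_oneKernelDeriv_eq ha x hx.le,
    oneMean_eq ha, lagPhi_eq hx, dbl_eval]
  field_simp

end OneConstant

/-! ### The scaled density for β = 1. -/

section EdgeOne
variable {a : ℝ}

/-- Both sides have the same derivative for y > 0, extend continuously to 0 and vanish there, which
uses a > -1. -/
theorem edgePrim_eq_lowPrim (ha : -1 < a) {n : ℕ} {c : ℝ} (hc : c = 2 * n + a + 1) {y : ℝ}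
    (hy : 0 < y) : edgePrim a (c ^ 2)⁻¹ y = (2 * c) ^ ((a + 1) / 2) / (c * lagNorm a n) *
      (lowPrim a n (y / (2 * c)) + lagPhi ((a - 1) / 2) (dbl (lag a n)) (y / (2 * c))) := by
  have hα : -1 < (a - 1) / 2 := by linarith
  have h : 1 ≤ n ∨ -1 < a := Or.inr ha
  have h2 : -2 < a := by linarith
  have hc0 : 0 < c := by rw [hc]; exact lag_param_pos h h2
  have hN := lagNorm_pos a n (by have := Nat.cast_nonneg (α := ℝ) n; linarith)
  set k := (2 * c) ^ ((a + 1) / 2) / (c * lagNorm a n) with hk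
  set g : ℝ → ℝ := fun y => edgePrim a (c ^ 2)⁻¹ y - k *
      (lowPrim a n (y / (2 * c)) + lagPhi ((a - 1) / 2) (dbl (lag a n)) (y / (2 * c))) with hg
  have hd : ∀ y, 0 < y → HasDerivAt g 0 y := fun y hy => by
    have hx : 0 < y / (2 * c) := by positivity
    have i1 : HasDerivAt (fun y => y / (2 * c)) (1 / (2 * c)) y := (hasDerivAt_id y).div_const _
    have d1 := (hasDerivAt_primitive_laguerreWeight hα (dbl (lagLower a n)) hx).comp y i1
    have d2 := (hasDerivAt_lagPhi (α := (a - 1) / 2) (dbl (lag a n)) hx).comp y i1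
    refine ((hasDerivAt_edgePrim h2 (c ^ 2)⁻¹ hy).fun_sub ((d1.fun_add d2).const_mul k)).congr_deriv ?_
    rw [edgeFun_eq h h2 hc, lagOp_dbl, eval_mul, eval_C, dbl_eval, dbl_eval,
      laguerreWeight_of_pos hx, Real.div_rpow hy.le (by positivity),
      show (a - 1) / 2 = (a + 1) / 2 - 1 by ring, Real.rpow_sub_one hy.ne',
      Real.rpow_sub_one (by positivity), hk, show 2 * (y / (2 * c)) = y / c by field_simp,
      show y / (2 * c) = y / c / 2 by field_simp]
    have p := (Real.rpow_pos_of_pos (show 0 < 2 * c by positivity) ((a + 1) / 2)).ne'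
    simp only [lagLower, triOp, eval_sub, eval_add, eval_mul, eval_C, eval_X, eval_ofNat]
    have hn : (n : ℝ) = (c - a - 1) / 2 := by rw [hc]; ring
    rw [hn]
    field_simp
    ring
  have hcont : Continuous g := by
    refine Continuous.sub (Continuous.mul (Real.continuous_rpow_const (by linarith)) ?_)
      (continuous_const.mul (Continuous.add ?_ ?_))
    · exact continuous_iff_continuousAt.2 fun y =>
        (hasDerivAt_edgePrimSeries h2 (c ^ 2)⁻¹ y).continuousAt
    · exact (continuous_primitive_laguerreWeight hα _).comp (continuous_id.div_const _)
    · exact (continuous_lagPhi hα _).comp (continuous_id.div_const _)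
  have h0 : g 0 = 0 := by
    simp only [hg, edgePrim, zero_div, lagPhi_zero hα, lowPrim, intervalIntegral.integral_same]
    rw [Real.zero_rpow (by linarith)]; ring
  have := intervalIntegral.integral_eq_sub_of_hasDerivAt_of_le (f := g) (f' := fun _ => 0) hy.le
    hcont.continuousOn (fun u hu => hd u hu.1) intervalIntegrable_const
  rw [h0, intervalIntegral.integral_zero, sub_zero] at this
  exact sub_eq_zero.1 this.symm

/-- The hard edge scaled density of the `β = 1` ensemble. -/
theorem hardEdgeDensity_one (ha : -1 < a) (n : ℕ) {c : ℝ} (hc : c = 2 * shiftedN 1 a (n + 1))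
    {y : ℝ} (hy : 0 < y) :
    hardEdgeDensity 1 a (n + 1) y = lagNorm a n * c ^ (-a) / 2 *
      hardEdgeQuad (a ^ 2 - 1) (c ^ 2)⁻¹ (edgeFun a (c ^ 2)⁻¹) (edgeFunDeriv a n c)
        (edgePrim a (c ^ 2)⁻¹) y +
      (2 * c) ^ (-((a + 1) / 2)) * oneConst a n * lagNorm a n * (edgeFun a (c ^ 2)⁻¹ y / y) := by
  have hc' : c = 2 * n + a + 1 := by
    rw [hc, shiftedN, if_pos rfl]; push_cast; ring
  have h : 1 ≤ n ∨ -1 < a := Or.inr ha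
  have h2 : -2 < a := by linarith
  have hc0 : 0 < c := by rw [hc']; exact lag_param_pos h h2
  have hN := lagNorm_pos a n (by have := Nat.cast_nonneg (α := ℝ) n; linarith)
  have hx : 0 < y / (2 * c) := by positivity
  have hx2 : 2 * (y / (2 * c)) = y / c := by field_simp
  have hE := edgeFun_eq h h2 hc' y
  have hT := edgePrim_eq_lowPrim ha hc' hy
  have hρ := betaDensity_one ha n hx
  have hS : (lagSum a n (y / c)).eval (y / c) =
      ((y / c) * (lag a n).derivative.eval (y / c) ^ 2 + (a - y / c) * (lag a n).eval (y / c) *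
        (lag a n).derivative.eval (y / c) + n * (lag a n).eval (y / c) ^ 2) / lagNorm a n := by
    rw [lagSum, eval_finsetSum]
    refine Eq.trans (Finset.sum_congr rfl fun j _ => ?_)
      (sum_lag_sq a h2 n (y / c) (div_pos hy hc0).ne' h)
    rw [eval_mul, eval_C]; ring
  have p := Real.rpow_pos_of_pos (show 0 < 2 * c by positivity) ((a + 1) / 2)
  have hlow : lowPrim a n (y / (2 * c)) = edgePrim a (c ^ 2)⁻¹ y * (c * lagNorm a n) /
      (2 * c) ^ ((a + 1) / 2) - lagPhi ((a - 1) / 2) (dbl (lag a n)) (y / (2 * c)) := by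
    rw [hT]; field_simp; ring
  have hw : laguerreWeight ((a - 1) / 2) (y / (2 * c)) = y ^ ((a + 1) / 2) *
      Real.exp (-(y / c / 2)) * (2 * c) / ((2 * c) ^ ((a + 1) / 2) * y) := by
    rw [laguerreWeight_of_pos hx, Real.div_rpow hy.le (by positivity),
      show (a - 1) / 2 = (a + 1) / 2 - 1 by ring, Real.rpow_sub_one hy.ne',
      Real.rpow_sub_one (by positivity), show y / (2 * c) = y / c / 2 by field_simp]
    field_simp
  have hpow : ((2 * c) ^ ((a + 1) / 2)) ^ 2 = 2 ^ a * c ^ a * (2 * c) := by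
    rw [← Real.mul_rpow (by norm_num) hc0.le, ← Real.rpow_add_one (by positivity),
      ← Real.rpow_natCast, ← Real.rpow_mul (by positivity)]
    congr 1; push_cast; ring
  rw [hardEdgeDensity, show weightExponent 1 a = (a - 1) / 2 by rw [weightExponent, if_pos rfl],
    show 4 * shiftedN 1 a (n + 1) = 2 * c by rw [hc]; ring, hρ, hlow, lagPhi_eq hx, dbl_eval, hw,
    hx2, hS, hardEdgeQuad, hE, edgeFunDeriv, Real.rpow_neg hc0.le,
    Real.rpow_neg (show 0 ≤ 2 * c by positivity)]
  have hca := (Real.rpow_pos_of_pos hc0 a).ne'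
  have h2a := (Real.rpow_pos_of_pos (show (0 : ℝ) < 2 by norm_num) a).ne'
  generalize edgePrim a (c ^ 2)⁻¹ y = T
  generalize y ^ ((a + 1) / 2) = e1
  generalize Real.exp (-(y / c / 2)) = e2
  generalize (lag a n).eval (y / c) = u
  generalize (lag a n).derivative.eval (y / c) = v
  generalize lagNorm a n = h0 at *
  generalize oneConst a n = C₁
  generalize c ^ a = ca at *
  generalize (2 : ℝ) ^ a = ta at *
  generalize (2 * c) ^ ((a + 1) / 2) = q at *
  have hn : (n : ℝ) = (c - a - 1) / 2 := by rw [hc']; ring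
  have hta : ta = q ^ 2 / (ca * (2 * c)) := by
    rw [hpow]; field_simp
  rw [hn, hta]
  have hp := p.ne'
  field_simp
  ring

end EdgeOne

end

section
open Filter Topology

/-! ### Expansions of the normalising constants. -/

section Coefficients
variable {a : ℝ}

/-- The arguments of Γ(m + a + 1)/Γ(m + 1) lie symmetrically about c/2 + 1/2, so `gammaRatio_asymp`
applies with z = c/2 and s = a. -/
theorem expandsTo_lagNorm {m : ℕ → ℕ} {c ε : ℕ → ℝ} (hc : ∀ n, c n = 2 * m n + a + 1)
    (hpos : ∀ n, 0 < c n) (hlim : Tendsto c atTop atTop) (hε : ∀ n, ε n = (c n ^ 2)⁻¹)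
    {e : ℝ} (he : ∀ n, |ε n| ≤ e) (k : ℝ) (M : ℕ) :
    ExpandsTo ε M fun n _ => k * (lagNorm a (m n) * c n ^ (-a)) := by
  have h := expandsTo_gammaRatio a (ε := ε) (z := fun n => c n / 2) (κ := 1 / 4) (by norm_num)
    (fun n => half_pos (hpos n)) (hlim.atTop_div_const (by norm_num))
    (fun n => by rw [hε, div_pow, inv_div]; have := (hpos n).ne'; field_simp; norm_num) M
  refine ((ExpandsTo.of_smooth (f := fun _ => k * 2 ^ (-a)) contDiffOn_const M).mul he h).congr
    fun n y _ => ?_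
  have e1 : c n / 2 + (1 + a) / 2 = m n + a + 1 := by rw [hc]; ring
  have e2 : c n / 2 + (1 - a) / 2 = m n + 1 := by rw [hc]; ring
  have h2 : (2 : ℝ) ^ (-a) ≠ 0 := (Real.rpow_pos_of_pos (by norm_num) _).ne'
  simp only [e1, e2, Real.Gamma_nat_eq_factorial, lagNorm, Real.div_rpow (hpos n).le zero_le_two]
  field_simp

/-- Duplication leaves one ratio of Gamma functions, symmetric about c/4 + 1/2 with c = 2n + a + 1,
which is why z = c/4 and s = (a + 1)/2 are used next. -/
theorem oneConst_mul_lagNorm (ha : -1 < a) (n : ℕ) : oneConst a n * lagNorm a n =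
    2 ^ a * (Real.Gamma (((n : ℝ) + a) / 2 + 1) / Real.Gamma (((n : ℝ) + 1) / 2)) := by
  have hn := Nat.cast_nonneg (α := ℝ) n
  have d1 := Real.Gamma_mul_Gamma_add_half (((n : ℝ) + a + 1) / 2)
  have d2 := Real.Gamma_mul_Gamma_add_half (((n : ℝ) + 1) / 2)
  rw [show ((n : ℝ) + a + 1) / 2 + 1 / 2 = (n + a) / 2 + 1 by ring,
    show 2 * (((n : ℝ) + a + 1) / 2) = n + a + 1 by ring,
    show 1 - ((n : ℝ) + a + 1) = -n + -a by ring, Real.rpow_add (by norm_num),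
    Real.rpow_neg (by norm_num) a] at d1
  rw [show ((n : ℝ) + 1) / 2 + 1 / 2 = n / 2 + 1 by ring,
    show 2 * (((n : ℝ) + 1) / 2) = n + 1 by ring, Real.Gamma_nat_eq_factorial,
    show 1 - ((n : ℝ) + 1) = -n by ring] at d2
  have p1 := (Real.Gamma_pos_of_pos (show 0 < ((n : ℝ) + a + 1) / 2 by linarith)).ne'
  have p2 := (Real.Gamma_pos_of_pos (show 0 < ((n : ℝ) + 1) / 2 by linarith)).ne'
  have f1 : (n.factorial : ℝ) ≠ 0 := by exact_mod_cast n.factorial_ne_zero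
  have q1 := (Real.rpow_pos_of_pos (show (0 : ℝ) < 2 by norm_num) a).ne'
  have q2 := (Real.rpow_pos_of_pos (show (0 : ℝ) < 2 by norm_num) (-(n : ℝ))).ne'
  have q3 := (Real.sqrt_pos.2 Real.pi_pos).ne'
  rw [oneConst, lagNorm]
  generalize Real.Gamma (((n : ℝ) + a + 1) / 2) = G1 at *
  generalize Real.Gamma (((n : ℝ) + 1) / 2) = G2 at *
  generalize Real.Gamma (((n : ℝ) + a) / 2 + 1) = G3 at *
  generalize Real.Gamma ((n : ℝ) / 2 + 1) = G4 at *
  generalize Real.Gamma ((n : ℝ) + a + 1) = G5 at *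
  generalize (2 : ℝ) ^ (-(n : ℝ)) = u at *
  generalize (2 : ℝ) ^ a = v at *
  have e3 : G3 = G5 * (u * v⁻¹) * √Real.pi / G1 := by rw [eq_div_iff p1, ← d1]; ring
  have e4 : G4 = n.factorial * u * √Real.pi / G2 := by rw [eq_div_iff p2, ← d2]; ring
  rw [e3, e4]
  field_simp

theorem expandsTo_oneConst (ha : -1 < a) {c ε : ℕ → ℝ} (hc : ∀ n, c n = 2 * n + a + 1)
    (hpos : ∀ n, 0 < c n) (hlim : Tendsto c atTop atTop) (hε : ∀ n, ε n = (c n ^ 2)⁻¹)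
    {e : ℝ} (he : ∀ n, |ε n| ≤ e) (M : ℕ) :
    ExpandsTo ε M fun n _ => (2 * c n) ^ (-((a + 1) / 2)) * oneConst a n * lagNorm a n := by
  have h := expandsTo_gammaRatio ((a + 1) / 2) (ε := ε) (z := fun n => c n / 4) (κ := 1 / 16)
    (by norm_num) (fun n => div_pos (hpos n) (by norm_num)) (hlim.atTop_div_const (by norm_num))
    (fun n => by rw [hε, div_pow, inv_div]; have := (hpos n).ne'; field_simp; norm_num) M
  refine ((ExpandsTo.of_smooth (f := fun _ => 2 ^ a * 8 ^ (-((a + 1) / 2)))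
    contDiffOn_const M).mul he h).congr fun n y _ => ?_
  have e1 : c n / 4 + (1 + (a + 1) / 2) / 2 = (n + a) / 2 + 1 := by rw [hc]; ring
  have e2 : c n / 4 + (1 - (a + 1) / 2) / 2 = (n + 1) / 2 := by rw [hc]; ring
  have e3 : 2 * c n = 8 * (c n / 4) := by ring
  have := (hpos n).le
  simp only [e1, e2]
  rw [mul_assoc, oneConst_mul_lagNorm ha, e3, Real.mul_rpow (by norm_num) (by positivity)]
  ring

end Coefficients

/-! ### Differential equation and expansion of the density. -/

section Assembly
variable {a : ℝ}

/-- In both cases the hard edge scaled densities are given by the same quadratic expression. -/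
theorem exists_hardEdgeDensity_eq {β : ℕ} (hβ : β = 1 ∨ β = 4) (ha : -1 < weightExponent β a) :
    -2 < a ∧ ∃ (m : ℕ → ℕ) (c A B : ℕ → ℝ) (e : ℝ), (∀ n, 1 ≤ m n ∨ -1 < a) ∧
      (∀ n, c n = 2 * m n + a + 1) ∧ (∀ n, 0 < c n) ∧ Tendsto c atTop atTop ∧
      (∀ n, hardEdgeParam β a (n + 1) = (c n ^ 2)⁻¹) ∧
      0 < e ∧ (∀ n, |hardEdgeParam β a (n + 1)| ≤ e) ∧ (∀ n, 0 < A n) ∧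
      (∀ M, ExpandsTo (fun n => hardEdgeParam β a (n + 1)) M fun n _ => A n) ∧
      (∀ M, ExpandsTo (fun n => hardEdgeParam β a (n + 1)) M fun n _ => B n) ∧
      ∀ n y, 0 < y → hardEdgeDensity β a (n + 1) y = A n *
        hardEdgeQuad (a ^ 2 - 1) (c n ^ 2)⁻¹ (edgeFun a (c n ^ 2)⁻¹) (edgeFunDeriv a (m n) (c n))
          (edgePrim a (c n ^ 2)⁻¹) y + B n * (edgeFun a (c n ^ 2)⁻¹ y / y) := by
  have main : ∀ {m : ℕ → ℕ}, Monotone m → Tendsto m atTop atTop → -2 < a →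
      (∀ n, 1 ≤ m n ∨ -1 < a) → (∀ n, 0 < 2 * (m n : ℝ) + a + 1) ∧
      Tendsto (fun n => 2 * (m n : ℝ) + a + 1) atTop atTop ∧
      (∀ n, |((2 * (m n : ℝ) + a + 1) ^ 2)⁻¹| ≤ ((2 * (m 0 : ℝ) + a + 1) ^ 2)⁻¹) ∧
      ∀ n, 0 < lagNorm a (m n) * (2 * (m n : ℝ) + a + 1) ^ (-a) := by
    intro m hm hlim h2 h
    have hpos := fun n => lag_param_pos (h n) h2
    refine ⟨hpos, ?_, fun n => ?_, fun n => mul_pos (lagNorm_pos a _ ?_)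
      (Real.rpow_pos_of_pos (hpos n) _)⟩
    · exact tendsto_atTop_add_const_right _ _ (tendsto_atTop_add_const_right _ _
        ((tendsto_natCast_atTop_atTop.comp hlim).const_mul_atTop (by norm_num)))
    · have h0 := hpos 0
      have : (m 0 : ℝ) ≤ m n := by exact_mod_cast hm n.zero_le
      rw [abs_of_pos (inv_pos.2 (pow_pos (hpos n) 2))]
      gcongr
    · rcases h n with h | h
      · have : (1 : ℝ) ≤ m n := by exact_mod_cast h
        linarith
      · have := Nat.cast_nonneg (α := ℝ) (m n); linarith
  rcases hβ with rfl | rfl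
  · have ha : -1 < a := by rw [weightExponent, if_pos rfl] at ha; linarith
    have h2 : -2 < a := by linarith
    have hc : ∀ n : ℕ, 2 * shiftedN 1 a (n + 1) = 2 * (n : ℝ) + a + 1 := fun n => by
      rw [shiftedN, if_pos rfl]; push_cast; ring
    obtain ⟨hpos, hlim, he, hA⟩ := main (m := fun n => n) monotone_id tendsto_id h2
      fun _ => Or.inr ha
    have hε : ∀ n, hardEdgeParam 1 a (n + 1) = ((2 * (n : ℝ) + a + 1) ^ 2)⁻¹ := fun n => by
      rw [hardEdgeParam_eq_one, hc]
    have he' : ∀ n, |hardEdgeParam 1 a (n + 1)| ≤ ((2 * ((0 : ℕ) : ℝ) + a + 1) ^ 2)⁻¹ := fun n => by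
      rw [hε]; exact he n
    refine ⟨h2, fun n => n, fun n => 2 * (n : ℝ) + a + 1,
      fun n => 1 / 2 * (lagNorm a n * (2 * (n : ℝ) + a + 1) ^ (-a)), _, _, fun _ => Or.inr ha,
      fun _ => rfl, hpos, hlim, hε, inv_pos.2 (pow_pos (hpos 0) 2), he',
      fun n => mul_pos (by norm_num) (hA n),
      expandsTo_lagNorm (m := fun n => n) (fun _ => rfl) hpos hlim hε he' _,
      expandsTo_oneConst ha (fun _ => rfl) hpos hlim hε he', fun n y hy => ?_⟩
    rw [hardEdgeDensity_one ha n (hc n).symm hy]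
    ring
  · have h2 : -2 < a := by rw [weightExponent, if_neg (by norm_num)] at ha; linarith
    have hc : ∀ n : ℕ, 4 * shiftedN 4 a (n + 1) = 2 * ((2 * n + 2 : ℕ) : ℝ) + a + 1 := fun n => by
      rw [shiftedN, if_neg (by norm_num)]; push_cast; ring
    have h1 : ∀ n, 1 ≤ 2 * n + 2 ∨ -1 < a := fun n => Or.inl (by omega)
    obtain ⟨hpos, hlim, he, hA⟩ := main (m := fun n => 2 * n + 2) (fun _ _ _ => by dsimp; omega)
      (tendsto_atTop_mono (fun n => by dsimp; omega) tendsto_id) h2 h1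
    have hε : ∀ n, hardEdgeParam 4 a (n + 1) = ((2 * ((2 * n + 2 : ℕ) : ℝ) + a + 1) ^ 2)⁻¹ :=
      fun n => by rw [hardEdgeParam_eq_four, hc]
    have he' : ∀ n, |hardEdgeParam 4 a (n + 1)| ≤ ((2 * ((2 * 0 + 2 : ℕ) : ℝ) + a + 1) ^ 2)⁻¹ :=
      fun n => by rw [hε]; exact he n
    refine ⟨h2, fun n => 2 * n + 2, fun n => 2 * ((2 * n + 2 : ℕ) : ℝ) + a + 1,
      fun n => 1 / 4 * (lagNorm a (2 * n + 2) * (2 * ((2 * n + 2 : ℕ) : ℝ) + a + 1) ^ (-a)),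
      fun _ => 0, _, h1, fun _ => rfl, hpos, hlim, hε, inv_pos.2 (pow_pos (hpos 0) 2), he',
      fun n => mul_pos (by norm_num) (hA n),
      expandsTo_lagNorm (m := fun n => 2 * n + 2) (fun _ => rfl) hpos hlim hε he' _,
      ExpandsTo.of_smooth contDiffOn_const, fun n y hy => ?_⟩
    rw [hardEdgeDensity_four h2 n (hc n).symm hy]
    ring

/-- The equations for E and T are linear and T enters only through its derivative. Replacing T by T
- B/A absorbs the last term, and scaling all three functions by √A absorbs A. -/
theorem hardEdgeOp_const_mul_quad_eq_zero (a : ℝ) {t ε A B : ℝ} {E E1 T f : ℝ → ℝ}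
    (ht : t = a ^ 2 - 1) (hA : 0 < A) (hE : ∀ y, 0 < y → HasDerivAt E (E1 y) y)
    (hE1 : ∀ y, 0 < y → HasDerivAt E1 ((t / (4 * y ^ 2) - 1 / (2 * y) + ε / 4) * E y) y)
    (hT : ∀ y, 0 < y → HasDerivAt T ((1 / (2 * y) - ε / 2) * E y) y)
    (hf : EqOn f (fun y => A * hardEdgeQuad t ε E E1 T y + B * (E y / y)) (Ioi 0))
    {y : ℝ} (hy : 0 < y) : hardEdgeOp a ε f y = 0 := by
  refine hardEdgeOp_quad_eq_zero a (E := fun y => √A * E y) (E1 := fun y => √A * E1 y)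
    (T := fun y => √A * (T y - B / A)) ht
    (fun y hy => (hE y hy).const_mul _)
    (fun y hy => ((hE1 y hy).const_mul _).congr_deriv (by ring))
    (fun y hy => (((hT y hy).sub_const _).const_mul _).congr_deriv (by ring)) (fun y hy => ?_) hy
  have hs : √A ^ 2 = A := Real.sq_sqrt hA.le
  have hy' : y ≠ 0 := ne_of_gt hy
  rw [hf hy]
  simp only [hardEdgeQuad]
  have hA' := hA.ne'
  calc _ = A * ((2 * y * E1 y ^ 2 - 2 * E y * E1 y + (-t / (2 * y) + 1 - ε * y / 2) * E y ^ 2 -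
        E y * (T y - B / A)) / y) := by field_simp; ring
    _ = √A ^ 2 * ((2 * y * E1 y ^ 2 - 2 * E y * E1 y + (-t / (2 * y) + 1 - ε * y / 2) * E y ^ 2 -
        E y * (T y - B / A)) / y) := by rw [hs]
    _ = _ := by ring

theorem hardEdgeOp_hardEdgeDensity {β : ℕ} (hβ : β = 1 ∨ β = 4) (ha : -1 < weightExponent β a)
    {N : ℕ} (hN : 1 ≤ N) {y : ℝ} (hy : 0 < y) :
    hardEdgeOp a (hardEdgeParam β a N) (hardEdgeDensity β a N) y = 0 := by
  obtain ⟨h2, m, c, A, B, e, hm, hc, -, -, hε, -, -, hA, -, -, hf⟩ := exists_hardEdgeDensity_eq hβ ha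
  obtain ⟨n, rfl⟩ : ∃ n, N = n + 1 := ⟨N - 1, by omega⟩
  rw [hε]
  exact hardEdgeOp_const_mul_quad_eq_zero a rfl (hA n)
    (fun y hy => hasDerivAt_edgeFun (hm n) h2 (hc n) hy)
    (fun y hy => hasDerivAt_edgeFunDeriv (hm n) h2 (hc n) hy)
    (fun y hy => hasDerivAt_edgePrim h2 _ hy) (fun y hy => hf n y hy) hy

theorem expandsTo_hardEdgeDensity {β : ℕ} (hβ : β = 1 ∨ β = 4) (ha : -1 < weightExponent β a) :
    (∀ n, 0 < hardEdgeParam β a (n + 1)) ∧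
    Tendsto (fun n => hardEdgeParam β a (n + 1)) atTop (𝓝 0) ∧
    (∃ e, ∀ n, |hardEdgeParam β a (n + 1)| ≤ e) ∧
    ∀ M, ExpandsTo (fun n => hardEdgeParam β a (n + 1)) M
      fun n => hardEdgeDensity β a (n + 1) := by
  obtain ⟨h2, m, c, A, B, e, hm, hc, hpos, hlim, hε, he0, he, -, hA, hB, hf⟩ :=
    exists_hardEdgeDensity_eq hβ ha
  refine ⟨fun n => by rw [hε]; exact inv_pos.2 (pow_pos (hpos n) 2), ?_, ⟨e, he⟩, fun M => ?_⟩
  · simp only [hε]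
    exact tendsto_inv_atTop_zero.comp ((tendsto_pow_atTop two_ne_zero).comp hlim)
  have hE := expandsTo_edgeFun h2 he0 he M
  have hT := expandsTo_edgePrim h2 he0 he M
  have hE1 := hE.deriv he
  have hi : ContDiffOn ℝ (⊤ : ℕ∞) (fun y : ℝ => y⁻¹) (Ioi 0) :=
    fun y hy => (contDiffAt_inv ℝ (ne_of_gt hy)).contDiffWithinAt
  -- Coefficients of this shape cover every term of the quadratic form after division by y, except
  -- -ε/2 · E², which is supplied by `mul_param`.
  have smooth : ∀ p q r : ℝ, ExpandsTo (fun n => hardEdgeParam β a (n + 1)) M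
      fun _ y => p + q * y⁻¹ + r * (y⁻¹ * y⁻¹) := fun p q r =>
    ExpandsTo.of_smooth ((contDiffOn_const.add (contDiffOn_const.mul hi)).add
      (contDiffOn_const.mul (hi.mul hi))) M
  refine (((hA M).mul he (((((smooth 2 0 0).mul he (hE1.mul he hE1)).add
    ((smooth 0 (-2) 0).mul he (hE.mul he hE1))).add
    ((smooth 0 1 (-(a ^ 2 - 1) / 2)).mul he (hE.mul he hE))).add
    ((((smooth (-1 / 2) 0 0).mul he (hE.mul he hE)).mul_param he).add
    ((smooth 0 (-1) 0).mul he (hE.mul he hT))))).add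
    ((hB M).mul he ((smooth 0 1 0).mul he hE))).congr fun n y hy => ?_
  have hy' : y ≠ 0 := ne_of_gt hy
  dsimp only
  rw [hf n y hy, hε n, (hasDerivAt_edgeFun (hm n) h2 (hc n) hy).deriv, hardEdgeQuad]
  field_simp
  ring

theorem laguerreOp_betaDensity {β : ℕ} (hβ : β = 1 ∨ β = 4) (ha : -1 < weightExponent β a)
    {N : ℕ} (hN : 1 ≤ N) {x : ℝ} (hx : 0 < x) :
    laguerreOp β N (weightExponent β a)
      (betaDensity β (laguerreWeight (weightExponent β a)) N) x = 0 := by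
  have hs := shiftedN_pos hβ ha hN
  set q := 4 * shiftedN β a N with hq
  have hq0 : 0 < q := by positivity
  have e : betaDensity β (laguerreWeight (weightExponent β a)) N =
      fun x => (fun y => q * hardEdgeDensity β a N y) (q * x) := by
    funext x
    simp only [hardEdgeDensity, ← hq, mul_div_cancel_left₀ x hq0.ne']
    field_simp
  have h := laguerreOp_comp_mul hβ ha hN (fun y => q * hardEdgeDensity β a N y) (q * x)
  rw [← hq, mul_div_cancel_left₀ x hq0.ne', ← e] at h
  have h0 := hardEdgeOp_hardEdgeDensity hβ ha hN (mul_pos hq0 hx)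
  rw [h]
  simp only [hardEdgeOp, hardEdgeOp0, hardEdgeOp1, hardEdgeOp2, iteratedDeriv_const_mul_field,
    deriv_const_mul_field] at h0 ⊢
  linear_combination q * h0

end Assembly

end

theorem mainTheorem9 (β : ℕ) (hβ : β = 1 ∨ β = 4) (a : ℝ) (ha : -1 < weightExponent β a) :
    -- the fifth order operator annihilates the density
    (∀ N : ℕ, 1 ≤ N → ∀ x : ℝ, 0 < x →
      laguerreOp β N (weightExponent β a)
        (betaDensity β (laguerreWeight (weightExponent β a)) N) x = 0) ∧
    -- decomposition of this operator in the hard edge variable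
    (∀ N : ℕ, 1 ≤ N → ∀ f : ℝ → ℝ, ContDiffOn ℝ 5 f (Set.Ioi 0) → ∀ y : ℝ, 0 < y →
      laguerreOp β N (weightExponent β a)
          (fun x => f (4 * shiftedN β a N * x)) (y / (4 * shiftedN β a N)) =
        hardEdgeOp0 a f y
          + (2 * √(β : ℝ) * shiftedN β a N) ^ (-2 : ℤ) * hardEdgeOp1 a f y
          + (2 * √(β : ℝ) * shiftedN β a N) ^ (-4 : ℤ) * hardEdgeOp2 f y) ∧
    -- differential equation for the hard edge scaled density
    (∀ N : ℕ, 1 ≤ N →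
      ContDiffOn ℝ (⊤ : ℕ∞) (hardEdgeDensity β a N) (Set.Ioi 0) ∧
      ∀ y : ℝ, 0 < y →
        hardEdgeOp0 a (hardEdgeDensity β a N) y
          + (2 * √(β : ℝ) * shiftedN β a N) ^ (-2 : ℤ) *
              hardEdgeOp1 a (hardEdgeDensity β a N) y
          + (2 * √(β : ℝ) * shiftedN β a N) ^ (-4 : ℤ) *
              hardEdgeOp2 (hardEdgeDensity β a N) y = 0) ∧
    -- asymptotic expansion and nested equations for its terms
    ∃ r : ℤ → ℝ → ℝ,
      (∀ j : ℕ, ContDiffOn ℝ (⊤ : ℕ∞) (r j) (Set.Ioi 0)) ∧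
      (∀ (J k : ℕ) (K : Set ℝ), IsCompact K → K ⊆ Set.Ioi 0 →
        ∃ C : ℝ, ∀ N : ℕ, 1 ≤ N → ∀ y ∈ K,
          |iteratedDeriv k (hardEdgeDensity β a N) y
              - ∑ j ∈ Finset.range (J + 1),
                  hardEdgeParam β a N ^ j * iteratedDeriv k (r j) y|
            ≤ C * hardEdgeParam β a N ^ (J + 1)) ∧
      r (-1) = 0 ∧ r (-2) = 0 ∧
      ∀ j : ℕ, ∀ y : ℝ, 0 < y →
        hardEdgeOp0 a (r j) y = - hardEdgeOp1 a (r (j - 1)) y - hardEdgeOp2 (r (j - 2)) y := by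
  refine ⟨fun N hN x hx => laguerreOp_betaDensity hβ ha hN hx, fun N hN f _ y _ => ?_,
    fun N hN => ⟨?_, fun y hy => ?_⟩, ?_⟩
  · rw [laguerreOp_comp_mul hβ ha hN, hardEdgeOp, hardEdgeParam_sq, hardEdgeParam]
  · obtain ⟨-, -, -, h⟩ := expandsTo_hardEdgeDensity hβ ha
    obtain ⟨n, rfl⟩ : ∃ n, N = n + 1 := ⟨N - 1, by omega⟩
    exact (h 0).1 n
  · have h := hardEdgeOp_hardEdgeDensity hβ ha hN hy
    rwa [hardEdgeOp, hardEdgeParam_sq, hardEdgeParam] at h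
  · obtain ⟨hpos, hlim, ⟨e, he⟩, hF⟩ := expandsTo_hardEdgeDensity hβ ha
    obtain ⟨r, G, hr, hG, hG0, h⟩ := ExpandsTo.exists_expansion (fun n => (hpos n).ne') hlim he hF
    -- Extension by 0 to negative indices supplies r_(-1) and r_(-2). After J + 1 terms the
    -- remainder is exactly ε^(J+1) times a bounded family.
    refine ⟨fun z => if 0 ≤ z then r z.toNat else 0, fun j => by simpa using hr j,
      fun J k K hK hK0 => ?_, by simp, by simp, fun j y hy => ?_⟩
    · obtain ⟨C, hC⟩ := (hG (J + 1)).2 k K hK hK0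
      refine ⟨C, fun N hN y hy => ?_⟩
      obtain ⟨n, rfl⟩ : ∃ n, N = n + 1 := ⟨N - 1, by omega⟩
      have := iteratedDeriv_expansion hr hG h k n (J + 1) (hK0 hy)
      rw [hG0] at this
      simp only [Int.natCast_nonneg, if_true, Int.toNat_natCast]
      rw [this, add_sub_cancel_left, abs_mul, abs_of_pos (pow_pos (hpos n) _), mul_comm]
      exact mul_le_mul_of_nonneg_right (hC n y hy) (pow_pos (hpos n) _).le
    · refine hardEdgeOp_nested a (fun n => (hpos n).ne') hlim hr hG h hy (fun n => ?_)
        (fun z => if 0 ≤ z then r z.toNat else 0) (by simp) (by simp) (by simp) j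
      rw [hG0]
      exact hardEdgeOp_hardEdgeDensity hβ ha (by omega) hy
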